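/- Let $k\ge 1$. Let $V$ be the space of homogeneous polynomials of degree $2k$ in $(z,w)\in\mathbb C^2$, on which $\mathrm{SU}(2)$ acts by $(\rho(g)p)(x)=p(g^{-1}x)$, and let $V^\tau=\{p\in V: p(-\bar w,\bar z)=(-1)^k\,\overline{p(z,w)}\}$, an $\mathrm{SU}(2)$-invariant real form of $V$. Let $G^\tau=\mathrm{SU}(2)\ltimes V^\tau$ (semidirect product, with the product topology), with Lie algebra $\mathfrak g^\tau=\mathfrak{su}(2)\oplus V^\tau$ and complexification $\mathfrak g=\mathfrak{sl}_2(\mathbb C)\oplus V$, and let $T^\tau=\{\mathrm{diag}(e^{it},e^{-it}):t\in\mathbb R\}\subset \mathrm{SU}(2)\subset G^\tau$, the circle generated by the Cartan subalgebra $\mathfrak t^\tau=\mathbb R\,\mathrm{diag}(i,-i)$ of $\mathfrak{su}(2)$. Let $\mathfrak t=\mathfrak t^\tau\otimes\mathbb C$, and let $\mathfrak f=\mathfrak b\oplus V^+\subset\mathfrak g$, where $\mathfrak b\subset \mathfrak{sl}_2(\mathbb C)$ is the subalgebra of upper triangular matrices and $V^+$ is the sum of the eigenspaces with eigenvalue $h>0$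 of $\rho(E)$ on $V$, for $E=\tfrac12\mathrm{diag}(1,-1)$ ($\rho$ also denotes the complex-linear extension to $\mathfrak{sl}_2(\mathbb C)$ of the differential of $\rho$). A CR structure of CR dimension $n$ and CR codimension $d$ on a smooth manifold $M$ of dimension $2n+d$ is a smooth complex subbundle $T^{0,1}M\subset\mathbb C\otimes TM$ of rank $n$ with $T^{0,1}M\cap\overline{T^{0,1}M}=0$ whose sections are closed under the Lie bracket. Its iterated Levi kernels are $\mathcal F^0=T^{0,1}M$ and $\mathcal F^{j+1}$, whose local sections are the local sections $X$ of $\mathcal F^{j}$ such that, for every local section $Y$ of $T^{0,1}M$, $[X,\overline Y]$ is the sum of a local section of $\mathcal F^j$ and the conjugate of a local section of $T^{0,1}M$; $\mathcal F^j_m$ is the set of values at $m$ of local sections of $\mathcal F^j$. The CR structure is $k$-nondegenerate at $m$ if $\mathcal F^{k-1}_m\supsetneq\mathcal F^{k}_m=\{0\}$. Then $V^\tau$ is an irreducible real representation of $\mathrm{SU}(2)$ of dimension $2k+1$; $G^\tau$ is a Lie group, the quotient $M=G^\tau/T^\tau$ is a smooth (Hausdorff, second countable) manifold of dimension $2k+3$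 for which $G^\tau\to M$ is a smooth submersion, and $(g,v)\mapsto (g\cdot v)\,T^\tau$ (product in $G^\tau$) induces an isomorphism $\mathrm{SU}(2)\times_{T^\tau}V^\tau\cong M$, where $(gt,v)\sim(g,\rho(t)v)$ for $t\in T^\tau$. The distribution $T^{0,1}M=G^\tau\times_{T^\tau}(\mathfrak f/\mathfrak t)$, whose value at $gT^\tau$ is the image of the left translate of $\mathfrak f$ to $g$ under the complexified differential of $G^\tau\to M$, is a well-defined $G^\tau$-invariant CR structure on $M$ of CR dimension $k+1$ and CR codimension $1$, and it is $k$-nondegenerate at every point. Finally, the map sending the class in $M$ of an element of $G^\tau$ with $\mathrm{SU}(2)$-component $g$ to $g\cdot[e_1]\in\mathbb{CP}^1$ makes $M$ a smooth locally trivial fibre bundle over $\mathbb{CP}^1$ with fibre $\mathbb R^{2k+1}$. -/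

import Mathlib

open scoped Manifold ContDiff TensorProduct Matrix

noncomputable section

namespace CRGeom

/-! ### CR structures on smooth manifolds -/

section General

variable {E H : Type*} [NormedAddCommGroup E] [NormedSpace ℝ E] [TopologicalSpace H]
  (I : ModelWithCorners ℝ E H) {M : Type*} [TopologicalSpace M] [ChartedSpace H M]

/-- The complexified tangent space `ℂ ⊗ T_m M`. -/
abbrev CTangent (m : M) : Type _ := ℂ ⊗[ℝ] TangentSpace I m

/-- Complex conjugation of the complexified tangent space. -/
def conjTangent (m : M) : CTangent I m →ₗ[ℝ] CTangent I m :=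
  LinearMap.rTensor (TangentSpace I m) Complex.conjAe.toLinearMap

lemma conjTangent_smul (m : M) (c : ℂ) (w : CTangent I m) :
    conjTangent I m (c • w) = (starRingEnd ℂ c) • conjTangent I m w := by
  induction w using TensorProduct.induction_on with
  | zero => simp
  | tmul z v => simp [conjTangent, TensorProduct.smul_tmul']
  | add x y hx hy => simp [smul_add, hx, hy]

/-- The conjugate of a complex subspace of `ℂ ⊗ T_m M`. -/
def conjSubmodule (m : M) (D : Submodule ℂ (CTangent I m)) : Submodule ℂ (CTangent I m) where
  carrier := {w | conjTangent I m w ∈ D}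
  add_mem' {a b} ha hb := by
    simp only [Set.mem_ofPred_eq, map_add] at *
    exact D.add_mem ha hb
  zero_mem' := by simp
  smul_mem' c w hw := by
    simp only [Set.mem_ofPred_eq, conjTangent_smul] at *
    exact D.smul_mem _ hw

/-- A complex vector field `re + i im`, given by its real and its imaginary part. -/
structure CVectorField (M : Type*) [TopologicalSpace M] [ChartedSpace H M] where
  /-- the real part -/
  re : ∀ m : M, TangentSpace I m
  /-- the imaginary part -/
  im : ∀ m : M, TangentSpace I m

namespace CVectorField

variable {I}

/-- The value of a complex vector field at a point. -/
def eval (X : CVectorField I M) (m : M) : CTangent I m :=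
  (1 : ℂ) ⊗ₜ[ℝ] X.re m + Complex.I ⊗ₜ[ℝ] X.im m

/-- The conjugate complex vector field. -/
def conj (X : CVectorField I M) : CVectorField I M where
  re := X.re
  im := fun m => -X.im m

/-- The complex bilinear extension of the Lie bracket of vector fields. -/
def bracket (X Y : CVectorField I M) : CVectorField I M where
  re := fun m => VectorField.mlieBracket I X.re Y.re m - VectorField.mlieBracket I X.im Y.im m
  im := fun m => VectorField.mlieBracket I X.re Y.im m + VectorField.mlieBracket I X.im Y.re m

/-- Smoothness of a complex vector field on a set. -/
def SmoothOn [IsManifold I ∞ M] (X : CVectorField I M) (U : Set M) : Prop :=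
  ContMDiffOn I I.tangent ∞ (fun m => (⟨m, X.re m⟩ : TangentBundle I M)) U ∧
  ContMDiffOn I I.tangent ∞ (fun m => (⟨m, X.im m⟩ : TangentBundle I M)) U

end CVectorField

variable {I}

/-- `X` is, over the open set `U`, a smooth section of the complex distribution `D`. -/
def IsSection [IsManifold I ∞ M] (D : ∀ m : M, Submodule ℂ (CTangent I m)) (U : Set M) (X : CVectorField I M) :
    Prop :=
  X.SmoothOn U ∧ ∀ m ∈ U, X.eval m ∈ D m

/-- `D` is a CR structure (the bundle of vectors of type `(0,1)`) of CR dimension `n` and CR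
codimension `d` on the manifold `M`. -/
structure IsCRStructure [IsManifold I ∞ M] (D : ∀ m : M, Submodule ℂ (CTangent I m)) (n d : ℕ) :
    Prop where
  /-- `D` is a smooth complex subbundle of rank `n` of the complexified tangent bundle. -/
  subbundle : ∀ m : M, ∃ U : Set M, IsOpen U ∧ m ∈ U ∧ ∃ Z : Fin n → CVectorField I M,
    (∀ i, IsSection D U (Z i)) ∧
    ∀ x ∈ U, LinearIndependent ℂ (fun i => (Z i).eval x) ∧
      Submodule.span ℂ (Set.range fun i => (Z i).eval x) = D x
  /-- `D` meets its conjugate in zero. -/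
  inf_conj : ∀ m : M, D m ⊓ conjSubmodule I m (D m) = ⊥
  /-- `D` and its conjugate together have codimension `d`. -/
  codim : ∀ m : M, Module.finrank ℂ (CTangent I m ⧸ (D m ⊔ conjSubmodule I m (D m))) = d
  /-- The sections of `D` are closed under the Lie bracket. -/
  involutive : ∀ U : Set M, IsOpen U → ∀ X Y : CVectorField I M,
    IsSection D U X → IsSection D U Y → ∀ m ∈ U, (X.bracket Y).eval m ∈ D m

/-- The sections over `U` of the iterated Levi kernels of `D`. The zeroth kernel is `D`; a section
of the `j`-th kernel belongs to the next one if its brackets with the conjugates of all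
local sections of `D` vanish modulo the sum of the `j`-th kernel and the conjugate of `D`. -/
def IsKernelSection [IsManifold I ∞ M] (D : ∀ m : M, Submodule ℂ (CTangent I m)) :
    ℕ → Set M → CVectorField I M → Prop
  | 0, U, X => IsSection D U X
  | j + 1, U, X => IsKernelSection D j U X ∧
      ∀ W : Set M, IsOpen W → W ⊆ U → ∀ Y : CVectorField I M, IsSection D W Y →
        ∃ X' Z : CVectorField I M, IsKernelSection D j W X' ∧ IsSection D W Z ∧
          ∀ m ∈ W, (X.bracket Y.conj).eval m = X'.eval m + Z.conj.eval m

/-- The `j`-th iterated Levi kernel at `m`: the values at `m` of its sections near `m`. -/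
def leviKernel [IsManifold I ∞ M] (D : ∀ m : M, Submodule ℂ (CTangent I m)) (j : ℕ) (m : M) :
    Set (CTangent I m) :=
  {w | ∃ U : Set M, IsOpen U ∧ m ∈ U ∧ ∃ X : CVectorField I M,
    IsKernelSection D j U X ∧ X.eval m = w}

/-- `k`-nondegeneracy at `m`: the `k`-th iterated Levi kernel at `m` is zero and strictly smaller
than its predecessor. -/
def IsNondegenerateAt [IsManifold I ∞ M] (D : ∀ m : M, Submodule ℂ (CTangent I m)) (k : ℕ)
    (m : M) : Prop :=
  1 ≤ k ∧ leviKernel D k m ⊂ leviKernel D (k - 1) m ∧ leviKernel D k m = {0}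

/-- Invariance of a complex distribution under the action of a group by diffeomorphisms. -/
def IsInvariant (I : ModelWithCorners ℝ E H) {M : Type*} [TopologicalSpace M] [ChartedSpace H M]
    (G : Type*) [Group G] [MulAction G M]
    (D : ∀ m : M, Submodule ℂ (CTangent I m)) : Prop :=
  ∀ g : G, ContMDiff I I ∞ (fun x : M => g • x) ∧
    ∀ m : M, (D m).map (LinearMap.baseChange ℂ
      (mfderiv I I (fun x : M => g • x) m).toLinearMap) = D (g • m)

/-- Smooth submersions between finite-dimensional manifolds. -/
def IsSmoothSubmersion {E' H' : Type*} [NormedAddCommGroup E'] [NormedSpace ℝ E']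
    [TopologicalSpace H'] (I : ModelWithCorners ℝ E H) (J : ModelWithCorners ℝ E' H')
    {M N : Type*} [TopologicalSpace M] [ChartedSpace H M] [TopologicalSpace N]
    [ChartedSpace H' N] (f : M → N) : Prop :=
  ContMDiff I J ∞ f ∧ ∀ x, Function.Surjective (mfderiv I J f x)

/-- `p` is a smooth, locally trivial fibre bundle with typical fibre `F`. -/
def IsSmoothFibreBundle {E' H' : Type*} [NormedAddCommGroup E'] [NormedSpace ℝ E']
    [TopologicalSpace H'] (I : ModelWithCorners ℝ E H) (J : ModelWithCorners ℝ E' H')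
    (F : Type*) [NormedAddCommGroup F] [NormedSpace ℝ F]
    {M B : Type*} [TopologicalSpace M] [ChartedSpace H M] [TopologicalSpace B]
    [ChartedSpace H' B] (p : M → B) : Prop :=
  ∀ b : B, ∃ e : Bundle.Trivialization F p, b ∈ e.baseSet ∧
    ContMDiffOn I (J.prod 𝓘(ℝ, F)) ∞ e e.source ∧
    ContMDiffOn (J.prod 𝓘(ℝ, F)) I ∞ e.toOpenPartialHomeomorph.symm e.target

end General

/-! ### The real irreducible representation `V^τ` of `SU(2)` -/

/-- The group `SU(2)`. -/
abbrev SU2 : Type := Matrix.specialUnitaryGroup (Fin 2) ℂ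

/-- The Lie algebra `𝔰𝔲(2)`: traceless skew-Hermitian matrices. -/
def su2 : Submodule ℝ (Matrix (Fin 2) (Fin 2) ℂ) where
  carrier := {A | Aᴴ = -A ∧ A.trace = 0}
  add_mem' {A B} hA hB := by
    refine ⟨?_, ?_⟩
    · rw [Matrix.conjTranspose_add, hA.1, hB.1]; abel
    · rw [Matrix.trace_add, hA.2, hB.2, add_zero]
  zero_mem' := by simp
  smul_mem' c A hA := by
    refine ⟨?_, ?_⟩
    · rw [Matrix.conjTranspose_smul, hA.1]; simp
    · rw [Matrix.trace_smul, hA.2, smul_zero]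

/-- Complex valued functions on `ℂ²`. -/
abbrev Fun2 : Type := (Fin 2 → ℂ) → ℂ

/-- The evaluation of polynomials in two variables as functions on `ℂ²`. -/
def evalMap : MvPolynomial (Fin 2) ℂ →ₗ[ℂ] Fun2 :=
  LinearMap.pi fun x => (MvPolynomial.aeval x).toLinearMap

/-- The space `V` of homogeneous polynomials of degree `2k` on `ℂ²`. -/
def binaryForms (k : ℕ) : Submodule ℂ Fun2 :=
  (MvPolynomial.homogeneousSubmodule (Fin 2) ℂ (2 * k)).map evalMap

lemma binaryForms_comp (k : ℕ) (A : Matrix (Fin 2) (Fin 2) ℂ) {q : Fun2}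
    (hq : q ∈ binaryForms k) : (fun x => q (A *ᵥ x)) ∈ binaryForms k := by
  obtain ⟨P, hP, rfl⟩ := hq
  have hP' : P.IsHomogeneous (2 * k) := hP
  refine ⟨MvPolynomial.aeval (fun i => ∑ j, MvPolynomial.C (A i j) * MvPolynomial.X j) P, ?_, ?_⟩
  · have h := hP'.aeval (S := ℂ) (n := 1)
      (fun i => ∑ j, MvPolynomial.C (A i j) * (MvPolynomial.X j : MvPolynomial (Fin 2) ℂ)) ?_
    · rw [one_mul] at h
      exact h
    · intro i
      refine MvPolynomial.IsHomogeneous.sum _ _ _ fun j _ => ?_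
      have := (MvPolynomial.isHomogeneous_C (Fin 2) (A i j)).mul
        (MvPolynomial.isHomogeneous_X ℂ j)
      simpa using this
  · funext x
    simp only [evalMap, LinearMap.pi_apply, AlgHom.toLinearMap_apply]
    have h : ((MvPolynomial.aeval x).comp (MvPolynomial.aeval fun i => ∑ j,
        MvPolynomial.C (A i j) * (MvPolynomial.X j : MvPolynomial (Fin 2) ℂ)) :
        MvPolynomial (Fin 2) ℂ →ₐ[ℂ] ℂ) = MvPolynomial.aeval (A *ᵥ x) := by
      ext i
      simp only [AlgHom.comp_apply, MvPolynomial.aeval_X, map_sum, map_mul]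
      simp only [MvPolynomial.algHom_C, Algebra.algebraMap_self,
        RingHom.id_apply]
      rfl
    exact DFunLike.congr_fun h P

/-- The quaternionic structure `(z, w) ↦ (-w̄, z̄)` of `ℂ²`, which commutes with `SU(2)`. -/
def quatJ (x : Fin 2 → ℂ) : Fin 2 → ℂ := ![-starRingEnd ℂ (x 1), starRingEnd ℂ (x 0)]

/-- The real form `V^τ` of `V`. In terms of the coefficients, `∑ a_h z^(k+h) w^(k-h)` belongs to it
if and only if `a_(-h) = (-1)^h ā_h` for all `h`. -/
def realForms (k : ℕ) : Submodule ℝ Fun2 where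
  carrier := {q | q ∈ binaryForms k ∧ ∀ x, q (quatJ x) = (-1) ^ k * starRingEnd ℂ (q x)}
  add_mem' {p q} hp hq := by
    refine ⟨Submodule.add_mem _ hp.1 hq.1, fun x => ?_⟩
    simp only [Pi.add_apply, hp.2, hq.2, map_add]
    ring
  zero_mem' := ⟨Submodule.zero_mem _, by simp⟩
  smul_mem' c p hp := by
    refine ⟨?_, fun x => ?_⟩
    · have h : c • p = (c : ℂ) • p := by
        funext x; simp
      rw [h]
      exact Submodule.smul_mem _ _ hp.1
    · simp only [Pi.smul_apply, hp.2, Complex.real_smul, map_mul, Complex.conj_ofReal]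
      ring

/-- `V^τ`, with the topology of pointwise convergence (on this finite-dimensional space of
functions: the usual topology). -/
abbrev Vtau (k : ℕ) : Type := realForms k

lemma SU2.mulVec_quatJ (g : SU2) (x : Fin 2 → ℂ) :
    (g : Matrix (Fin 2) (Fin 2) ℂ) *ᵥ quatJ x = quatJ ((g : Matrix (Fin 2) (Fin 2) ℂ) *ᵥ x) := by
  have hu : (g : Matrix (Fin 2) (Fin 2) ℂ)ᴴ * g = 1 := g.2.1.1
  have hd : (g : Matrix (Fin 2) (Fin 2) ℂ).det = 1 := g.2.2
  have hadj : (g : Matrix (Fin 2) (Fin 2) ℂ)ᴴ = (g : Matrix (Fin 2) (Fin 2) ℂ).adjugate := by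
    have h := Matrix.mul_adjugate (g : Matrix (Fin 2) (Fin 2) ℂ)
    rw [hd, one_smul] at h
    calc (g : Matrix (Fin 2) (Fin 2) ℂ)ᴴ
        = (g : Matrix (Fin 2) (Fin 2) ℂ)ᴴ * (g * (g : Matrix (Fin 2) (Fin 2) ℂ).adjugate) := by
          rw [h, mul_one]
      _ = _ := by rw [← mul_assoc, hu, one_mul]
  rw [Matrix.adjugate_fin_two] at hadj
  have h00 := congrFun (congrFun hadj 0) 0
  have h01 := congrFun (congrFun hadj 0) 1
  have h10 := congrFun (congrFun hadj 1) 0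
  have h11 := congrFun (congrFun hadj 1) 1
  simp [Matrix.conjTranspose_apply] at h00 h01 h10 h11
  funext i
  fin_cases i
  · simp [quatJ, Matrix.mulVec, dotProduct, Fin.sum_univ_two, h01, h11]
  · simp [quatJ, Matrix.mulVec, dotProduct, Fin.sum_univ_two, h00, h10]
    ring

/-- The representation of `SU(2)` on `V^τ`, `(ρ(g) p)(x) = p(g⁻¹ x)`. -/
def rho (k : ℕ) : Representation ℝ SU2 (Vtau k) where
  toFun g :=
    { toFun := fun p => ⟨fun x => p.1 ((g⁻¹ : SU2).1 *ᵥ x),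
        binaryForms_comp k _ p.2.1, fun x => by
          simp only [SU2.mulVec_quatJ, p.2.2]⟩
      map_add' := fun p q => rfl
      map_smul' := fun c p => rfl }
  map_one' := by
    ext p x
    simp
  map_mul' g h := by
    ext p x
    change p.1 (((g * h)⁻¹ : SU2).1 *ᵥ x) = p.1 ((h⁻¹ : SU2).1 *ᵥ ((g⁻¹ : SU2).1 *ᵥ x))
    rw [Matrix.mulVec_mulVec, mul_inv_rev]
    rfl

/-! ### The group `G^τ = SU(2) ⋉ V^τ`, the circle `T^τ` and the homogeneous space -/

/-- The semidirect product `G^τ = SU(2) ⋉ V^τ`. -/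
@[ext] structure Gtau (k : ℕ) where
  /-- the component in `SU(2)` -/
  rot : SU2
  /-- the component in `V^τ` -/
  trans : Vtau k

namespace Gtau

variable {k : ℕ}

instance : Mul (Gtau k) := ⟨fun x y => ⟨x.rot * y.rot, x.trans + rho k x.rot y.trans⟩⟩
instance : One (Gtau k) := ⟨⟨1, 0⟩⟩
instance : Inv (Gtau k) := ⟨fun x => ⟨x.rot⁻¹, -rho k x.rot⁻¹ x.trans⟩⟩

lemma mul_def (x y : Gtau k) : x * y = ⟨x.rot * y.rot, x.trans + rho k x.rot y.trans⟩ := rfl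
lemma one_def : (1 : Gtau k) = ⟨1, 0⟩ := rfl
lemma inv_def (x : Gtau k) : x⁻¹ = ⟨x.rot⁻¹, -rho k x.rot⁻¹ x.trans⟩ := rfl

instance : Group (Gtau k) := Group.ofLeftAxioms
  (fun x y z => by simp [mul_def, mul_assoc, add_assoc])
  (fun x => by simp [mul_def, one_def])
  (fun x => by simp [mul_def, one_def, inv_def])

/-- `G^τ` carries the product topology of `SU(2)` and `V^τ`. -/
instance : TopologicalSpace (Gtau k) :=
  TopologicalSpace.induced (fun x => (x.rot, x.trans)) inferInstance

/-- The inclusion of `SU(2)` in `G^τ`. -/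
def ofRot (k : ℕ) : SU2 →* Gtau k where
  toFun g := ⟨g, 0⟩
  map_one' := rfl
  map_mul' g h := by simp [mul_def]

/-- The inclusion of `V^τ` in `G^τ`. -/
def ofTrans (v : Vtau k) : Gtau k := ⟨1, v⟩

end Gtau

/-- The circle `T^τ = {diag(e^{it}, e^{-it})}` in `SU(2)`, generated by the Cartan subalgebra
`ℝ · diag(i, -i)` of `𝔰𝔲(2)`. -/
def torus : Subgroup SU2 where
  carrier := {g | ∃ t : ℝ, (g : Matrix (Fin 2) (Fin 2) ℂ) =
    Matrix.diagonal ![Complex.exp (t * Complex.I), Complex.exp (-(t * Complex.I))]}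
  mul_mem' := by
    rintro a b ⟨s, hs⟩ ⟨t, ht⟩
    refine ⟨s + t, ?_⟩
    rw [Submonoid.coe_mul, hs, ht, Matrix.diagonal_mul_diagonal]
    congr 1
    funext i
    fin_cases i
    · simp [add_mul, Complex.exp_add]
    · simp [add_mul, ← Complex.exp_add, add_comm]
  one_mem' := ⟨0, by
    ext i j; fin_cases i <;> fin_cases j <;> simp⟩
  inv_mem' := by
    rintro a ⟨s, hs⟩
    refine ⟨-s, ?_⟩
    have h : ((a⁻¹ : SU2) : Matrix (Fin 2) (Fin 2) ℂ) = (a : Matrix (Fin 2) (Fin 2) ℂ)ᴴ := rfl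
    rw [h, hs, Matrix.diagonal_conjTranspose]
    congr 1
    funext i
    fin_cases i <;> simp [← Complex.exp_conj]

/-- The homogeneous space `M = G^τ / T^τ`. -/
abbrev HomSpace (k : ℕ) : Type := Gtau k ⧸ (torus.map (Gtau.ofRot k))

/-- The projection of `G^τ` onto `M = G^τ / T^τ`. -/
abbrev HomSpace.proj (k : ℕ) (g : Gtau k) : HomSpace k := QuotientGroup.mk g

/-- The associated bundle `SU(2) ×_{T^τ} V^τ`: the quotient of the product by the relation
`(g t, v) ∼ (g, ρ(t) v)` for `t` in the circle, with the quotient topology. -/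
abbrev AssocBundle (k : ℕ) : Type :=
  Quot fun a b : SU2 × Vtau k =>
    ∃ g : SU2, ∃ t ∈ torus, ∃ v : Vtau k, a = (g * t, v) ∧ b = (g, rho k t v)

/-- The complex projective line. -/
def CP1 : Type := Projectivization ℂ (Fin 2 → ℂ)

/-- The complex projective line carries the quotient topology. -/
instance : TopologicalSpace CP1 :=
  inferInstanceAs (TopologicalSpace (Quotient (projectivizationSetoid ℂ (Fin 2 → ℂ))))

lemma SU2.mulVec_ne_zero (g : SU2) :
    (g : Matrix (Fin 2) (Fin 2) ℂ) *ᵥ ![1, 0] ≠ 0 := by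
  intro h
  have hu : (g : Matrix (Fin 2) (Fin 2) ℂ)ᴴ * g = 1 := g.2.1.1
  have h2 := congrArg (fun v => (g : Matrix (Fin 2) (Fin 2) ℂ)ᴴ *ᵥ v) h
  simp only [Matrix.mulVec_mulVec, hu, Matrix.one_mulVec, Matrix.mulVec_zero] at h2
  simpa using congrFun h2 0

/-- The point `g · [e₁]` of the complex projective line. -/
def SU2.line (g : SU2) : CP1 :=
  Projectivization.mk ℂ ((g : Matrix (Fin 2) (Fin 2) ℂ) *ᵥ ![1, 0]) g.mulVec_ne_zero

/-! ### The CR algebra -/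

/-- The Borel subalgebra `𝔟` of upper triangular matrices in `𝔰𝔩₂(ℂ)`. -/
def borel : Submodule ℂ (Matrix (Fin 2) (Fin 2) ℂ) where
  carrier := {B | B.trace = 0 ∧ B 1 0 = 0}
  add_mem' {A B} hA hB := by
    refine ⟨?_, ?_⟩
    · rw [Matrix.trace_add, hA.1, hB.1, add_zero]
    · rw [Matrix.add_apply, hA.2, hB.2, add_zero]
  zero_mem' := by simp
  smul_mem' c A hA := by
    refine ⟨?_, ?_⟩
    · rw [Matrix.trace_smul, hA.1, smul_zero]
    · rw [Matrix.smul_apply, hA.2, smul_zero]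

/-- The complex linear extension to `𝔰𝔩₂(ℂ)` of the differential of `(ρ(g) q)(x) = q(g⁻¹ x)`. -/
def infinitesimalAction (B : Matrix (Fin 2) (Fin 2) ℂ) (q : Fun2) : Fun2 :=
  fun x => -(fderiv ℂ q x (B *ᵥ x))

/-- The characteristic element `E = H / 2` of `𝔰𝔩₂(ℂ)`. -/
def charElement : Matrix (Fin 2) (Fin 2) ℂ := !![1 / 2, 0; 0, -1 / 2]

/-- The space `V⁺`, the sum of the eigenspaces `V_h`, `h > 0`, of the characteristic element. -/
def Vplus (k : ℕ) : Submodule ℂ Fun2 :=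
  Submodule.span ℂ {q | q ∈ binaryForms k ∧
    ∃ h : ℕ, 0 < h ∧ infinitesimalAction charElement q = (h : ℂ) • q}

/-- The complex subspace `𝔣 = 𝔟 ⊕ V⁺` of the complexification `𝔤 = 𝔰𝔩₂(ℂ) ⊕ V` of
`𝔤^τ = 𝔰𝔲(2) ⊕ V^τ`. -/
def crAlgebra (k : ℕ) : Submodule ℂ (Matrix (Fin 2) (Fin 2) ℂ × Fun2) :=
  borel.prod (Vplus k)

lemma exp_mem_SU2 (A : su2) : NormedSpace.exp (A : Matrix (Fin 2) (Fin 2) ℂ) ∈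
    Matrix.specialUnitaryGroup (Fin 2) ℂ := by
  obtain ⟨A, hA, htr⟩ := A
  have hstar : (NormedSpace.exp A)ᴴ = NormedSpace.exp (-A) := by
    rw [← Matrix.exp_conjTranspose, hA]
  have hmul : NormedSpace.exp (-A) * NormedSpace.exp A = 1 := by
    rw [← Matrix.exp_add_of_commute _ _ (Commute.neg_left (Commute.refl A)), neg_add_cancel,
      NormedSpace.exp_zero]
  have hunit : (NormedSpace.exp A)ᴴ * NormedSpace.exp A = 1 := by rw [hstar, hmul]
  refine ⟨Matrix.mem_unitaryGroup_iff'.2 hunit, ?_⟩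
  -- conjugation by the matrix `J` turns a traceless matrix into minus its transpose
  have htr' : A 1 1 = -A 0 0 := by
    rw [Matrix.trace_fin_two] at htr
    linear_combination htr
  let J : Matrix (Fin 2) (Fin 2) ℂ := !![0, 1; -1, 0]
  let J' : Matrix (Fin 2) (Fin 2) ℂ := !![0, -1; 1, 0]
  have hJ : J * J' = 1 := by
    ext i j; fin_cases i <;> fin_cases j <;> simp [J, J']
  have hJ' : J' * J = 1 := by
    ext i j; fin_cases i <;> fin_cases j <;> simp [J, J']
  let u : (Matrix (Fin 2) (Fin 2) ℂ)ˣ := ⟨J, J', hJ, hJ'⟩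
  have hconj : J * A * J' = -Aᵀ := by
    ext i j; fin_cases i <;> fin_cases j <;>
      simp [J, J', Matrix.mul_apply, Matrix.vecMul, dotProduct, Fin.sum_univ_two, htr']
  have h1 : J * NormedSpace.exp A * J' = (NormedSpace.exp (-A))ᵀ := by
    have h := Matrix.exp_units_conj u A
    change NormedSpace.exp (J * A * J') = J * NormedSpace.exp A * J' at h
    rw [← h, hconj, ← Matrix.transpose_neg, Matrix.exp_transpose]
  have h2 : J * NormedSpace.exp A * J' = (NormedSpace.exp A).adjugateᵀ := by
    rw [Matrix.adjugate_fin_two]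
    ext i j; fin_cases i <;> fin_cases j <;>
      simp [J, J', Matrix.mul_apply, Matrix.vecMul, dotProduct, Fin.sum_univ_two]
  have h3 : NormedSpace.exp (-A) = (NormedSpace.exp A).adjugate :=
    Matrix.transpose_injective (h1.symm.trans h2)
  have h4 := Matrix.adjugate_mul (NormedSpace.exp A)
  rw [← h3, hmul] at h4
  have h5 := congrFun (congrFun h4 0) 0
  simpa using h5.symm

/-- The exponential map of `SU(2)`. -/
def expSU2 (A : su2) : SU2 := ⟨NormedSpace.exp (A : Matrix (Fin 2) (Fin 2) ℂ), exp_mem_SU2 A⟩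

/-- The charts of the homogeneous space take their values in `ℝ² × ℝ^(2k+1)`. -/
abbrev ModelM (k : ℕ) : Type :=
  ModelProd (EuclideanSpace ℝ (Fin 2)) (EuclideanSpace ℝ (Fin (2 * k + 1)))

/-- For `X = (A, p)` in `𝔤^τ = 𝔰𝔲(2) ⊕ V^τ`, the velocity at `t = 0` of the curve
`t ↦ g · exp(t p) exp(t A) · T^τ` in `M`. It is the image of the value at `g` of the left invariant
vector field `X` under the differential of the projection of `G^τ` onto `M`. -/
def tangentOf (k : ℕ) [ChartedSpace (ModelM k) (HomSpace k)] (g : Gtau k) (A : su2) (p : Vtau k) :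
    TangentSpace ((𝓡 2).prod (𝓡 (2 * k + 1))) (HomSpace.proj k g) :=
  mfderiv 𝓘(ℝ, ℝ) ((𝓡 2).prod (𝓡 (2 * k + 1)))
    (fun t : ℝ => HomSpace.proj k
      (g * (Gtau.ofTrans (t • p) * Gtau.ofRot k (expSU2 (t • A))))) 0 (1 : ℝ)

/-- `D` is the distribution `G^τ ×_{T^τ} (𝔣/𝔱)`: its value at `g T^τ` is the image of `𝔣`, placed at
`g` by left translation, under the differential of the projection of `G^τ` onto `M`. -/
def IsInducedBy (k : ℕ) [ChartedSpace (ModelM k) (HomSpace k)]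
    (D : ∀ m : HomSpace k, Submodule ℂ (CTangent ((𝓡 2).prod (𝓡 (2 * k + 1))) m)) : Prop :=
  ∀ g : Gtau k, (D (HomSpace.proj k g) : Set _) =
    {w | ∃ (A B : su2) (p q : Vtau k),
      ((A : Matrix (Fin 2) (Fin 2) ℂ) + Complex.I • (B : Matrix (Fin 2) (Fin 2) ℂ),
        (p : Fun2) + Complex.I • (q : Fun2)) ∈ crAlgebra k ∧
      w = (1 : ℂ) ⊗ₜ[ℝ] tangentOf k g A p + Complex.I ⊗ₜ[ℝ] tangentOf k g B q}

end CRGeom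

end

/-! Order of vanishing of binary forms governs everything. A form of degree 2k is a polynomial of
degree at most 2k in t = w/z, and z^(2k-j) w^j has weight j - k for E. So V⁺ consists of the forms
vanishing to order at least k+1 at [e₁], the point t = 0 (`form_mem_Vplus_iff`), and ρ(g) moves this
condition to the point g·[e₁].

Right multiplication by T^τ does not change the translation component, so g T^τ ↦ (g·[e₁], v)
identifies M with CP¹ × V^τ. This gives the manifold, the submersions and the fibration at once; the
associated bundle is matched through (g, v) ↦ (g·[e₁], ρ(g)v). In an affine coordinate ζ of CP¹, the
Borel subalgebra contributes exactly ∂/∂ζ̄. Hence T^{0,1}M at (ζ, v) is spanned by ∂/∂ζ̄ and the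
forms vanishing to order at least k+1 at ζ. This is `modelKernel k 0 ζ`, and `mem_modelKernel_iff`
shows that every chart displays the induced distribution in this shape. The rest is calculus in a
constant coframe (dz, dz̄, dc), carried out for any distribution satisfying `IsModelled`.

Conjugation on forms is `tau`, which exchanges vanishing at ζ and vanishing at the antipode of ζ. A
form with a zero of order k at one of them and of order k+1 at the other has too many zeros for its
degree (`eq_zero_of_taylorCoef_tau`). Therefore T^{0,1}M meets its conjugate trivially, and the
dimensions k+1, k+1 inside 2k+3 leave codimension 1.

Write T_i for the i-th Taylor coefficient at ζ. It is holomorphic in ζ, so differentiating T_i(f) =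
0 along ξ yields T_i(D_ξ f) = -(i+1) dz(ξ) T_{i+1}(f) (`taylorCoef_deriv`). Directions with dz = 0
preserve the order of vanishing, which gives integrability; ∂/∂z lowers it by at most one. For j ≥ 1
the j-th Levi kernel therefore consists of the vertical fields vanishing to order at least k+j+1.
One inclusion is direct (`isKernelSection_of_rep_mem`). The other tests brackets against two frame
fields and uses the count of zeros again to kill the conjugate summand
(`rep_mem_of_isKernelSection`). The (k-1)-st kernel still contains (w - ζz)^(2k), while the k-th
would need order 2k+1 and is zero.

Irreducibility is the classical argument on the complexification: the torus isolates monomials, and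
one rotation with no zero entry connects them all (`eq_top_of_invariant`, `rho_irreducible`). -/

noncomputable section

namespace CRGeom

/-! ### Binary forms in terms of their coefficients -/

/-- The coefficients of binary forms of degree `2k`. -/
abbrev Coef (k : ℕ) : Type := Fin (2 * k + 1) → ℂ

/-- The binary form `∑ c_j x₀^(2k-j) x₁^j`. -/
def form (k : ℕ) : Coef k →ₗ[ℂ] Fun2 where
  toFun c := fun x => ∑ j : Fin (2 * k + 1), c j * (x 0 ^ (2 * k - (j : ℕ)) * x 1 ^ (j : ℕ))
  map_add' c d := by
    funext x
    simp [add_mul, Finset.sum_add_distrib]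
  map_smul' a c := by
    funext x
    simp [mul_assoc, Finset.mul_sum]

variable {k : ℕ}

lemma form_apply (c : Coef k) (x : Fin 2 → ℂ) :
    form k c x = ∑ j : Fin (2 * k + 1), c j * (x 0 ^ (2 * k - (j : ℕ)) * x 1 ^ (j : ℕ)) := rfl

/-- The polynomial `∑ c_j X^j`. -/
def poly (c : Coef k) : Polynomial ℂ := ∑ j : Fin (2 * k + 1), Polynomial.monomial (j : ℕ) (c j)

lemma poly_eval (c : Coef k) (t : ℂ) : (poly c).eval t = form k c ![1, t] := by
  simp [poly, form_apply, Polynomial.eval_finsetSum]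

lemma poly_coeff (c : Coef k) (i : Fin (2 * k + 1)) : (poly c).coeff i = c i := by
  simp [poly, Polynomial.finsetSum_coeff, Polynomial.coeff_monomial, Fin.val_inj]

/-- A homogeneous form is recovered from its dehomogenization, and a complex polynomial from its
values. Later identities between coefficient vectors are checked on the points (1, t) only. -/
lemma eq_of_form_line {c d : Coef k} (h : ∀ t, form k c ![1, t] = form k d ![1, t]) : c = d := by
  have h1 : poly c = poly d := Polynomial.funext fun t => by rw [poly_eval, poly_eval, h]
  funext i
  rw [← poly_coeff c, h1, poly_coeff]

lemma form_injective : Function.Injective (form k) := fun _ _ h =>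
  eq_of_form_line fun t => congrFun h ![1, t]

lemma form_mem (c : Coef k) : form k c ∈ binaryForms k := by
  refine ⟨∑ j : Fin (2 * k + 1), MvPolynomial.C (c j) *
    (MvPolynomial.X 0 ^ (2 * k - (j : ℕ)) * MvPolynomial.X 1 ^ (j : ℕ)), ?_, ?_⟩
  · refine Submodule.sum_mem _ fun j _ => ?_
    have h : 2 * k = 0 + (1 * (2 * k - (j : ℕ)) + 1 * (j : ℕ)) := by omega
    have h2 := (MvPolynomial.isHomogeneous_C (Fin 2) (c j)).mul
      (((MvPolynomial.isHomogeneous_X ℂ (0 : Fin 2)).pow (2 * k - (j : ℕ))).mul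
        ((MvPolynomial.isHomogeneous_X ℂ (1 : Fin 2)).pow (j : ℕ)))
    rwa [← h] at h2
  · funext x
    simp [evalMap, form_apply]

lemma exists_form_eq {q : Fun2} (hq : q ∈ binaryForms k) : ∃ c : Coef k, form k c = q := by
  obtain ⟨P, hP, rfl⟩ := hq
  have hP' : P.IsHomogeneous (2 * k) := hP
  change evalMap P ∈ LinearMap.range (form k)
  rw [P.as_sum, map_sum]
  refine Submodule.sum_mem _ fun d hd => ?_
  have hdeg : d 0 + d 1 = 2 * k := by
    have h := hP' (MvPolynomial.mem_support_iff.1 hd)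
    rw [Finsupp.weight_apply, Finsupp.sum_fintype _ _ (by simp)] at h
    simpa [Fin.sum_univ_two] using h
  -- Homogeneity gives d 0 = 2k - d 1, so the exponent of the second variable alone indexes the
  -- monomial.
  refine ⟨Pi.single ⟨d 1, by omega⟩ (P.coeff d), ?_⟩
  funext x
  rw [form_apply, Finset.sum_eq_single ⟨d 1, by omega⟩]
  · have h0 : 2 * k - d 1 = d 0 := by omega
    simp [evalMap, MvPolynomial.aeval_monomial, Finsupp.prod_fintype, h0]
  · intro j _ hj
    simp [Pi.single_eq_of_ne hj]
  · simp

/-- Binary forms are determined by their coefficients. -/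
def formEquiv (k : ℕ) : Coef k ≃ₗ[ℂ] binaryForms k :=
  LinearEquiv.ofBijective ((form k).codRestrict _ form_mem)
    ⟨fun _ _ h => form_injective (congrArg Subtype.val h), fun q => by
      obtain ⟨c, hc⟩ := exists_form_eq q.2
      exact ⟨c, Subtype.ext hc⟩⟩

lemma formEquiv_coe (c : Coef k) : (formEquiv k c : Fun2) = form k c := rfl

lemma form_formEquiv_symm (q : binaryForms k) : form k ((formEquiv k).symm q) = q := by
  rw [← formEquiv_coe, LinearEquiv.apply_symm_apply]

/-- The linear substitution `q ↦ q ∘ A`, in terms of coefficients. -/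
def subst (A : Matrix (Fin 2) (Fin 2) ℂ) : Coef k →ₗ[ℂ] Coef k :=
  (formEquiv k).symm.toLinearMap ∘ₗ
    { toFun := fun q : binaryForms k =>
        (⟨fun x => q.1 (A *ᵥ x), binaryForms_comp k A q.2⟩ : binaryForms k)
      map_add' := fun _ _ => rfl
      map_smul' := fun _ _ => rfl } ∘ₗ (formEquiv k).toLinearMap

lemma form_subst (A : Matrix (Fin 2) (Fin 2) ℂ) (c : Coef k) (x : Fin 2 → ℂ) :
    form k (subst A c) x = form k c (A *ᵥ x) := by
  simp only [subst, LinearMap.comp_apply, LinearEquiv.coe_coe, form_formEquiv_symm]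
  rfl

lemma subst_subst (A B : Matrix (Fin 2) (Fin 2) ℂ) (c : Coef k) :
    subst B (subst A c) = subst (A * B) c := by
  apply form_injective
  funext x
  rw [form_subst, form_subst, form_subst, Matrix.mulVec_mulVec]

lemma subst_one (c : Coef k) : subst 1 c = c := by
  apply form_injective
  funext x
  rw [form_subst, Matrix.one_mulVec]

/-- The real structure of the space of binary forms. -/
def tau (c : Coef k) : Coef k := fun j => (-1) ^ (k + (j : ℕ)) * starRingEnd ℂ (c j.rev)

lemma tau_add (c d : Coef k) : tau (c + d) = tau c + tau d := by
  funext j; simp [tau, mul_add]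

lemma tau_smul (a : ℂ) (c : Coef k) : tau (a • c) = starRingEnd ℂ a • tau c := by
  funext j; simp [tau]; ring

lemma tau_tau (c : Coef k) : tau (tau c) = c := by
  funext j
  have h : (-1 : ℂ) ^ (k + (j : ℕ)) * (-1) ^ (k + (j.rev : ℕ)) = 1 := by
    rw [← pow_add, Fin.val_rev]
    exact Even.neg_one_pow ⟨2 * k, by omega⟩
  simp only [tau, map_mul, map_pow, map_neg, map_one, Complex.conj_conj, Fin.rev_rev]
  rw [← mul_assoc, h, one_mul]

lemma tau_zero : tau (0 : Coef k) = 0 := by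
  funext j; simp [tau]

/-- The map `quatJ` swaps the two variables up to conjugation and a sign. The swap explains the
reversal of indices in `tau`, the sign its factor (-1)^j. -/
lemma form_tau (c : Coef k) (x : Fin 2 → ℂ) :
    form k (tau c) x = (-1) ^ k * starRingEnd ℂ (form k c (quatJ x)) := by
  rw [form_apply, form_apply, map_sum, Finset.mul_sum, ← Equiv.sum_comp Fin.revPerm]
  refine Finset.sum_congr rfl fun j _ => ?_
  have h1 : 2 * k - (j.rev : ℕ) = j := by rw [Fin.val_rev]; omega
  have h2 : (j.rev : ℕ) = 2 * k - j := by rw [Fin.val_rev]; omega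
  have h3 : (-1 : ℂ) ^ (j.rev : ℕ) = (-1) ^ (2 * k - (j : ℕ)) := by rw [h2]
  simp only [Fin.revPerm_apply, tau, Fin.rev_rev, h1, quatJ, Matrix.cons_val_zero,
    Matrix.cons_val_one, map_mul, map_pow, map_neg, Complex.conj_conj]
  rw [neg_pow (x 1), pow_add, h3, h2]
  ring

/-- This is the commutation of SU(2) with the quaternionic structure of ℂ², read off on
coefficients. -/
lemma tau_subst (g : SU2) (c : Coef k) : tau (subst g.1 c) = subst g.1 (tau c) := by
  apply form_injective
  funext x
  rw [form_tau, form_subst, form_subst, form_tau, SU2.mulVec_quatJ]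

/-- The coefficients of an element of the real form. -/
def coef (k : ℕ) : Vtau k →ₗ[ℝ] Coef k where
  toFun v := (formEquiv k).symm ⟨v.1, v.2.1⟩
  map_add' v w := (formEquiv k).symm.map_add ⟨v.1, v.2.1⟩ ⟨w.1, w.2.1⟩
  map_smul' a v := by
    have h := (formEquiv k).symm.map_smul (a : ℂ) ⟨v.1, v.2.1⟩
    refine Eq.trans (congrArg (formEquiv k).symm (Subtype.ext ?_)) h
    funext x
    simp

lemma form_coef (v : Vtau k) : form k (coef k v) = v.1 := form_formEquiv_symm _

lemma coef_injective : Function.Injective (coef k) := fun v w h =>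
  Subtype.ext (by rw [← form_coef, h, form_coef])

lemma form_mem_realForms {c : Coef k} (hc : tau c = c) : form k c ∈ realForms k := by
  refine ⟨form_mem c, fun x => ?_⟩
  conv_rhs => rw [← hc, form_tau]
  have h : ((-1 : ℂ) ^ k) * (-1) ^ k = 1 := by
    rw [← pow_add]; exact Even.neg_one_pow ⟨k, rfl⟩
  simp only [map_mul, map_pow, map_neg, map_one, Complex.conj_conj]
  rw [← mul_assoc, h, one_mul]

/-- The element of the real form with given coefficients. -/
def ofCoef (c : Coef k) (hc : tau c = c) : Vtau k := ⟨form k c, form_mem_realForms hc⟩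

lemma coef_ofCoef (c : Coef k) (hc : tau c = c) : coef k (ofCoef c hc) = c :=
  form_injective (form_coef _)

lemma tau_coef (v : Vtau k) : tau (coef k v) = coef k v := by
  apply form_injective
  funext x
  have h : ((-1 : ℂ) ^ k) * (-1) ^ k = 1 := by
    rw [← pow_add]; exact Even.neg_one_pow ⟨k, rfl⟩
  rw [form_tau, form_coef, v.2.2]
  simp only [map_mul, map_pow, map_neg, map_one, Complex.conj_conj]
  rw [← mul_assoc, h, one_mul]

lemma coef_rho (g : SU2) (v : Vtau k) : coef k (rho k g v) = subst (g⁻¹ : SU2).1 (coef k v) := by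
  apply form_injective
  funext x
  rw [form_coef, form_subst, form_coef]
  rfl

/-- Every binary form is the sum of an element of the real form and `i` times another one. -/
lemma exists_real_imag (c : Coef k) :
    ∃ p q : Vtau k, coef k p + Complex.I • coef k q = c := by
  -- The real and imaginary parts for the conjugation `tau`: (c + τc)/2 and (c - τc)/(2i).
  refine ⟨ofCoef ((1 / 2 : ℂ) • (c + tau c)) ?_, ofCoef ((-Complex.I / 2) • (c - tau c)) ?_, ?_⟩
  · rw [tau_smul, tau_add, tau_tau, add_comm (tau c), map_div₀, map_one,
      Complex.conj_ofNat]
  · rw [tau_smul, sub_eq_add_neg, tau_add, show -tau c = (-1 : ℂ) • tau c by simp, tau_smul,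
      tau_tau]
    funext j
    simp only [map_div₀, map_neg, map_one, Complex.conj_I, Complex.conj_ofNat, Pi.smul_apply,
      Pi.add_apply, smul_eq_mul]
    ring
  · rw [coef_ofCoef, coef_ofCoef]
    funext j
    simp
    linear_combination (-1 / 2 * c j + 1 / 2 * tau c j) * Complex.I_sq

/-! ### Taylor coefficients and the order of vanishing -/

/-- The `i`-th Taylor coefficient at `ζ` of the dehomogenized form `t ↦ q(1, t)`. -/
def taylorCoef (i : ℕ) (ζ : ℂ) : Coef k →ₗ[ℂ] ℂ where
  toFun c := ∑ j : Fin (2 * k + 1), c j * (((j : ℕ).choose i : ℂ) * ζ ^ ((j : ℕ) - i))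
  map_add' c d := by simp [add_mul, Finset.sum_add_distrib]
  map_smul' a c := by simp [mul_assoc, Finset.mul_sum]

lemma taylorCoef_apply (i : ℕ) (ζ : ℂ) (c : Coef k) : taylorCoef i ζ c =
    ∑ j : Fin (2 * k + 1), c j * (((j : ℕ).choose i : ℂ) * ζ ^ ((j : ℕ) - i)) := rfl

lemma taylorCoef_eq_zero_of_lt {i : ℕ} (hi : 2 * k < i) (ζ : ℂ) (c : Coef k) :
    taylorCoef i ζ c = 0 := by
  rw [taylorCoef_apply]
  refine Finset.sum_eq_zero fun j _ => ?_
  rw [Nat.choose_eq_zero_of_lt (by omega)]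
  simp

/-- The lower triangular unipotent matrices. -/
def lower (ζ : ℂ) : Matrix (Fin 2) (Fin 2) ℂ := !![1, 0; ζ, 1]

lemma lower_mul (ζ η : ℂ) : lower ζ * lower η = lower (ζ + η) := by
  simp [lower]

lemma lower_zero : lower 0 = 1 := by
  simp [lower, Matrix.one_fin_two]

/-- On the points (1, t) the matrix acts as the translation t ↦ t + ζ, so the new coefficients are
the Taylor coefficients at ζ. -/
lemma subst_lower (ζ : ℂ) (c : Coef k) (i : Fin (2 * k + 1)) :
    subst (lower ζ) c i = taylorCoef i ζ c := by
  have h : subst (lower ζ) c = fun i : Fin (2 * k + 1) => taylorCoef i ζ c := by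
    refine eq_of_form_line fun t => ?_
    rw [form_subst]
    have hv : lower ζ *ᵥ ![1, t] = ![1, t + ζ] := by
      funext i
      fin_cases i <;> simp [lower, Matrix.mulVec, dotProduct, Fin.sum_univ_two, add_comm]
    rw [hv, form_apply, form_apply]
    simp only [taylorCoef_apply, Matrix.cons_val_zero, Matrix.cons_val_one, one_pow, one_mul,
      Finset.sum_mul]
    rw [Finset.sum_comm]
    refine Finset.sum_congr rfl fun j _ => ?_
    rw [Fin.sum_univ_eq_sum_range (fun i : ℕ =>
      c j * (((j : ℕ).choose i : ℂ) * ζ ^ ((j : ℕ) - i)) * t ^ i) (2 * k + 1), add_pow,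
      Finset.mul_sum]
    refine Finset.sum_subset_zero_on_sdiff (Finset.range_subset_range.2 (by omega)) ?_ ?_
    · intro i hi
      rw [Finset.mem_sdiff, Finset.mem_range, Finset.mem_range] at hi
      rw [Nat.choose_eq_zero_of_lt (by omega)]
      simp
    · intro i _
      ring
  rw [h]

lemma taylorCoef_subst_lower_neg (ζ : ℂ) (c : Coef k) (i : Fin (2 * k + 1)) :
    taylorCoef i ζ (subst (lower (-ζ)) c) = c i := by
  rw [← subst_lower, subst_subst, lower_mul, neg_add_cancel, lower_zero, subst_one]

lemma eq_zero_of_taylorCoef {ζ : ℂ} {c : Coef k} (h : ∀ i ≤ 2 * k, taylorCoef i ζ c = 0) :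
    c = 0 := by
  have h1 : subst (lower ζ) c = 0 := by
    funext i
    rw [subst_lower, h i (by omega), Pi.zero_apply]
  rw [← subst_one c, ← lower_zero, ← add_neg_cancel ζ, ← lower_mul, ← subst_subst, h1, map_zero]

/-- The derivative is a complex one: Taylor coefficients are holomorphic in their base point, so
∂/∂z̄ will not see the motion of ζ. -/
lemma hasDerivAt_taylorCoef (i : ℕ) (ζ : ℂ) (c : Coef k) :
    HasDerivAt (fun z => taylorCoef i z c) ((i + 1) * taylorCoef (i + 1) ζ c) ζ := by
  simp only [taylorCoef_apply, Finset.mul_sum]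
  refine HasDerivAt.fun_sum fun j _ => ?_
  have h := (((hasDerivAt_pow ((j : ℕ) - i) ζ).const_mul ((j : ℕ).choose i : ℂ)).const_mul (c j))
  refine h.congr_deriv ?_
  have h2 : ((j : ℕ).choose (i + 1) : ℂ) * (i + 1) = (j : ℕ).choose i * ((j : ℕ) - i : ℕ) := by
    exact_mod_cast Nat.choose_succ_right_eq (j : ℕ) i
  rw [Nat.sub_sub]
  linear_combination (-c j * ζ ^ ((j : ℕ) - (i + 1))) * h2

/-- An upper triangular matrix fixes the line [e₁], hence preserves the order of vanishing there. In
the variable t, every surviving term keeps a factor t^m. -/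
lemma subst_upper {A : Matrix (Fin 2) (Fin 2) ℂ} (hA : A 1 0 = 0) {m : ℕ} {c : Coef k}
    (hc : ∀ i : Fin (2 * k + 1), (i : ℕ) < m → c i = 0) (i : Fin (2 * k + 1)) (hi : (i : ℕ) < m) :
    subst A c i = 0 := by
  have h : poly (subst A c) = ∑ j : Fin (2 * k + 1), Polynomial.C (c j) *
      ((Polynomial.C (A 0 0) + Polynomial.C (A 0 1) * Polynomial.X) ^ (2 * k - (j : ℕ)) *
        (Polynomial.C (A 1 1) * Polynomial.X) ^ (j : ℕ)) := by
    refine Polynomial.funext fun t => ?_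
    rw [poly_eval, form_subst, form_apply]
    simp [Polynomial.eval_finsetSum, Matrix.mulVec, dotProduct, Fin.sum_univ_two, hA]
  have hd : Polynomial.X ^ m ∣ poly (subst A c) := by
    rw [h]
    refine Finset.dvd_sum fun j _ => ?_
    by_cases hj : (j : ℕ) < m
    · simp [hc j hj]
    · rw [mul_pow]
      exact ((pow_dvd_pow _ (not_lt.1 hj)).mul_left _).mul_left _ |>.mul_left _
  rw [← poly_coeff (subst A c)]
  exact Polynomial.X_pow_dvd_iff.1 hd i hi

/-- Substitution of a unimodular matrix whose first column is a multiple of `(1, ζ)` turns the order of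
vanishing at `ζ` into the order of vanishing at `0`. -/
lemma subst_low_iff {A : Matrix (Fin 2) (Fin 2) ℂ} (hA : A.det = 1) {ζ : ℂ}
    (hζ : A 1 0 = ζ * A 0 0) (m : ℕ) (c : Coef k) :
    (∀ i : Fin (2 * k + 1), (i : ℕ) < m → subst A c i = 0) ↔ ∀ i < m, taylorCoef i ζ c = 0 := by
  -- `A` and `lower ζ` send [e₁] to the same point, so each is the other times an upper triangular
  -- matrix on the right; `subst_upper` then applies in both directions.
  have e1 : A * (A.adjugate * lower ζ) = lower ζ := by
    rw [← mul_assoc, Matrix.mul_adjugate, hA, one_smul, one_mul]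
  have e2 : lower ζ * (lower (-ζ) * A) = A := by
    rw [← mul_assoc, lower_mul, add_neg_cancel, lower_zero, one_mul]
  have u1 : (A.adjugate * lower ζ) 1 0 = 0 := by
    simp [Matrix.adjugate_fin_two, lower, Matrix.mul_apply, Fin.sum_univ_two, hζ]
    ring
  have u2 : (lower (-ζ) * A) 1 0 = 0 := by
    simp [lower, Matrix.mul_apply, Fin.sum_univ_two, hζ]
  constructor
  · intro h i hi
    by_cases hik : i < 2 * k + 1
    · have h3 := subst_upper u1 h ⟨i, hik⟩ hi
      rw [subst_subst, e1, subst_lower] at h3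
      exact h3
    · exact taylorCoef_eq_zero_of_lt (by omega) ζ c
  · intro h i hi
    rw [← e2, ← subst_subst]
    exact subst_upper u2 (fun j hj => by rw [subst_lower]; exact h j hj) i hi

/-- The special unitary matrix with first column proportional to `(1, ζ)`. -/
def unitaryOf (ζ : ℂ) : SU2 :=
  ⟨((Real.sqrt (1 + Complex.normSq ζ))⁻¹ : ℂ) • !![1, -starRingEnd ℂ ζ; ζ, 1], by
    have hpos : 0 < 1 + Complex.normSq ζ := by
      have := Complex.normSq_nonneg ζ
      linarith
    have hs : ((Real.sqrt (1 + Complex.normSq ζ) : ℂ)⁻¹) * (Real.sqrt (1 + Complex.normSq ζ) : ℂ)⁻¹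
        * (1 + ζ * starRingEnd ℂ ζ) = 1 := by
      rw [Complex.mul_conj, ← mul_inv, ← Complex.ofReal_mul, Real.mul_self_sqrt hpos.le]
      have h1 : (1 : ℂ) + (Complex.normSq ζ : ℂ) = ((1 + Complex.normSq ζ : ℝ) : ℂ) := by simp
      rw [h1]
      exact inv_mul_cancel₀ (by exact_mod_cast hpos.ne')
    refine ⟨Matrix.mem_unitaryGroup_iff'.2 ?_, ?_⟩
    · ext i j
      fin_cases i <;> fin_cases j <;>
        simp [Matrix.mul_apply, Fin.sum_univ_two, Matrix.star_eq_conjTranspose]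
      · linear_combination hs
      · ring
      · ring
      · linear_combination hs
    · simp [Matrix.det_fin_two]
      linear_combination hs⟩

lemma unitaryOf_apply (ζ : ℂ) : (unitaryOf ζ : Matrix (Fin 2) (Fin 2) ℂ) =
    ((Real.sqrt (1 + Complex.normSq ζ))⁻¹ : ℂ) • !![1, -starRingEnd ℂ ζ; ζ, 1] := rfl

lemma unitaryOf_col (ζ : ℂ) : (unitaryOf ζ).1 1 0 = ζ * (unitaryOf ζ).1 0 0 := by
  rw [unitaryOf_apply]
  simp
  ring

/-- A form vanishing to order `k` at `ζ` and to order `k + 1` at the antipode is zero. -/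
lemma eq_zero_of_taylorCoef_tau {ζ : ℂ} {c : Coef k} (h : ∀ i < k, taylorCoef i ζ c = 0)
    (h' : ∀ i < k + 1, taylorCoef i ζ (tau c) = 0) : c = 0 := by
  -- A unitary matrix carrying [e₁] to ζ commutes with `tau` and reduces both conditions to ζ = 0,
  -- where they speak of single coefficients.
  rw [← subst_low_iff (unitaryOf ζ).2.2 (unitaryOf_col ζ)] at h h'
  have h0 : subst (unitaryOf ζ).1 c = 0 := by
    funext i
    by_cases hi : (i : ℕ) < k
    · exact h i hi
    -- For i ≥ k the reversed index 2k - i is at most k. The two hypotheses cover the 2k+1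
    -- coefficients exactly once.
    · have h1 := h' i.rev (by rw [Fin.val_rev]; omega)
      rw [← tau_subst] at h1
      simpa [tau] using h1
  have h2 : subst (unitaryOf ζ).1.adjugate (subst (unitaryOf ζ).1 c) = c := by
    have hdet : (unitaryOf ζ).1.det = 1 := (unitaryOf ζ).2.2
    rw [subst_subst, Matrix.mul_adjugate, hdet, one_smul, subst_one]
  rw [← h2, h0, map_zero]

/-! ### The subspace `V⁺` -/

/-- Monomials are weight vectors. The inverse in the definition of ρ makes the weight j - k rather
than k - j, so high powers of the second variable are the positive ones. -/
lemma infinitesimalAction_charElement (c : Coef k) :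
    infinitesimalAction charElement (form k c) =
      form k (fun j => (((j : ℕ) : ℂ) - k) * c j) := by
  funext x
  have hd : DifferentiableAt ℂ (form k c) x := by
    have : form k c = fun x : Fin 2 → ℂ =>
      ∑ j : Fin (2 * k + 1), c j * (x 0 ^ (2 * k - (j : ℕ)) * x 1 ^ (j : ℕ)) := rfl
    rw [this]
    fun_prop
  have h1 : HasDerivAt (fun s : ℂ => form k c (x + s • (charElement *ᵥ x)))
      (fderiv ℂ (form k c) x (charElement *ᵥ x)) 0 := by
    have := hd.hasFDerivAt.hasLineDerivAt (charElement *ᵥ x)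
    exact this
  have h2 : HasDerivAt (fun s : ℂ => form k c (x + s • (charElement *ᵥ x)))
      (∑ j : Fin (2 * k + 1), c j * (x 0 ^ (2 * k - (j : ℕ)) * x 1 ^ (j : ℕ)) *
        ((k : ℂ) - (j : ℕ))) 0 := by
    -- Moving from x along s·Ex scales the coordinates by 1 + s/2 and 1 - s/2, so each monomial
    -- differentiates as a product of powers in s.
    have e : ∀ s : ℂ, form k c (x + s • (charElement *ᵥ x)) =
        ∑ j : Fin (2 * k + 1), c j * (x 0 ^ (2 * k - (j : ℕ)) * x 1 ^ (j : ℕ)) *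
          ((1 + s / 2) ^ (2 * k - (j : ℕ)) * (1 - s / 2) ^ (j : ℕ)) := by
      intro s
      rw [form_apply]
      refine Finset.sum_congr rfl fun j _ => ?_
      have e0 : (x + s • (charElement *ᵥ x)) 0 = x 0 * (1 + s / 2) := by
        simp [charElement, dotProduct, Fin.sum_univ_two]; ring
      have e1 : (x + s • (charElement *ᵥ x)) 1 = x 1 * (1 - s / 2) := by
        simp [charElement, dotProduct, Fin.sum_univ_two]; ring
      rw [e0, e1, mul_pow, mul_pow]
      ring
    simp only [e]
    refine HasDerivAt.fun_sum fun j _ => HasDerivAt.const_mul _ ?_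
    have a1 : HasDerivAt (fun s : ℂ => 1 + s / 2) (1 / 2) 0 :=
      ((hasDerivAt_id (0 : ℂ)).div_const 2).const_add 1
    have a2 : HasDerivAt (fun s : ℂ => 1 - s / 2) (-(1 / 2)) 0 :=
      ((hasDerivAt_id (0 : ℂ)).div_const 2).const_sub 1
    refine ((a1.fun_pow (2 * k - (j : ℕ))).fun_mul (a2.fun_pow (j : ℕ))).congr_deriv ?_
    have hj : ((2 * k - (j : ℕ) : ℕ) : ℂ) = 2 * k - (j : ℕ) := by
      rw [Nat.cast_sub (by omega)]; push_cast; ring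
    simp only [zero_div, add_zero, sub_zero, one_pow, mul_one, one_mul, hj]
    ring
  simp only [infinitesimalAction]
  rw [h1.unique h2, form_apply, ← Finset.sum_neg_distrib]
  exact Finset.sum_congr rfl fun j _ => by ring

/-- The weight j - k is positive exactly for j ≥ k + 1. This turns the algebraic space V⁺ into the
condition of vanishing to order k + 1 at [e₁]. -/
lemma form_mem_Vplus_iff (c : Coef k) :
    form k c ∈ Vplus k ↔ ∀ i : Fin (2 * k + 1), (i : ℕ) < k + 1 → c i = 0 := by
  constructor
  · intro h
    let S : Submodule ℂ (Coef k) :=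
      { carrier := {c | ∀ i : Fin (2 * k + 1), (i : ℕ) < k + 1 → c i = 0}
        add_mem' := fun {a b} ha hb i hi => by simp [ha i hi, hb i hi]
        zero_mem' := fun _ _ => rfl
        smul_mem' := fun a c hc i hi => by simp [hc i hi] }
    have hle : Vplus k ≤ S.map (form k) := by
      refine Submodule.span_le.2 ?_
      rintro q ⟨hq, m, hm, hE⟩
      obtain ⟨d, rfl⟩ := exists_form_eq hq
      refine ⟨d, fun i hi => ?_, rfl⟩
      rw [infinitesimalAction_charElement, ← map_smul] at hE
      have h1 := congrFun (form_injective hE) i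
      simp only [Pi.smul_apply, smul_eq_mul] at h1
      have h2 : (((i : ℕ) : ℂ) - k - m) * d i = 0 := by linear_combination h1
      rcases mul_eq_zero.1 h2 with h3 | h3
      · exfalso
        have h4 : ((i : ℕ) : ℂ) = ((k + m : ℕ) : ℂ) := by push_cast; linear_combination h3
        have h5 := Nat.cast_injective h4
        omega
      · exact h3
    obtain ⟨d, hd, hdc⟩ := hle h
    exact form_injective hdc ▸ hd
  · intro h
    have hc : c = ∑ i, c i • (Pi.single i 1 : Coef k) := by
      funext j
      simp [Finset.sum_apply, Pi.single_apply]
    rw [hc, map_sum]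
    refine Submodule.sum_mem _ fun i _ => ?_
    rw [map_smul]
    by_cases hi : (i : ℕ) < k + 1
    · rw [h i hi, zero_smul]
      exact Submodule.zero_mem _
    · refine Submodule.smul_mem _ _ (Submodule.subset_span ⟨form_mem _, (i : ℕ) - k, by omega, ?_⟩)
      rw [infinitesimalAction_charElement, ← map_smul]
      congr 1
      funext j
      rw [Nat.cast_sub (by omega), Pi.smul_apply, smul_eq_mul]
      by_cases hj : j = i
      · subst hj; rfl
      · simp [Pi.single_eq_of_ne hj]

end CRGeom

end

noncomputable section

namespace CRGeom

open Filter Topology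

variable {k : ℕ}

/-! ### The model CR structure on a vector space -/

/-- The values of a complex vector field in the coframe `(dz, dz̄, dc)`. -/
abbrev ModelFibre (k : ℕ) : Type := ℂ × ℂ × Coef k

/-- Complex conjugation of the values of complex vector fields. -/
def conjFibre (k : ℕ) : ModelFibre k →L[ℝ] ModelFibre k :=
  LinearMap.toContinuousLinearMap
    { toFun := fun ξ => (starRingEnd ℂ ξ.2.1, starRingEnd ℂ ξ.1, tau ξ.2.2)
      map_add' := fun ξ η => by simp [tau_add]
      map_smul' := fun a ξ => by
        have h : tau (a • ξ.2.2) = a • tau ξ.2.2 := by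
          have := tau_smul (a : ℂ) ξ.2.2
          rw [Complex.conj_ofReal] at this
          exact this
        simp [h] }

lemma conjFibre_apply (ξ : ModelFibre k) :
    conjFibre k ξ = (starRingEnd ℂ ξ.2.1, starRingEnd ℂ ξ.1, tau ξ.2.2) := rfl

lemma conjFibre_conjFibre (ξ : ModelFibre k) : conjFibre k (conjFibre k ξ) = ξ := by
  simp [conjFibre_apply, tau_tau]

lemma conjFibre_smul (a : ℂ) (ξ : ModelFibre k) :
    conjFibre k (a • ξ) = starRingEnd ℂ a • conjFibre k ξ := by
  simp [conjFibre_apply, tau_smul]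

/-- The iterated Levi kernels of the model. The zeroth one is the model CR structure. -/
def modelKernel (k j : ℕ) (ζ : ℂ) : Submodule ℂ (ModelFibre k) where
  carrier := {ξ | ξ.1 = 0 ∧ (1 ≤ j → ξ.2.1 = 0) ∧ ∀ i < k + j + 1, taylorCoef i ζ ξ.2.2 = 0}
  add_mem' {ξ η} hξ hη := by
    refine ⟨by simp [hξ.1, hη.1], fun hj => by simp [hξ.2.1 hj, hη.2.1 hj], fun i hi => ?_⟩
    rw [Prod.snd_add, Prod.snd_add, map_add, hξ.2.2 i hi, hη.2.2 i hi, add_zero]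
  zero_mem' := ⟨rfl, fun _ => rfl, fun i _ => map_zero _⟩
  smul_mem' a ξ hξ := by
    refine ⟨by simp [hξ.1], fun hj => by simp [hξ.2.1 hj], fun i hi => ?_⟩
    rw [Prod.smul_snd, Prod.smul_snd, map_smul, hξ.2.2 i hi, smul_zero]

lemma mem_modelKernel {j : ℕ} {ζ : ℂ} {ξ : ModelFibre k} : ξ ∈ modelKernel k j ζ ↔
    ξ.1 = 0 ∧ (1 ≤ j → ξ.2.1 = 0) ∧ ∀ i < k + j + 1, taylorCoef i ζ ξ.2.2 = 0 := Iff.rfl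

lemma modelKernel_succ_le (j : ℕ) (ζ : ℂ) : modelKernel k (j + 1) ζ ≤ modelKernel k j ζ :=
  fun _ h => ⟨h.1, fun _ => h.2.1 (by omega), fun i hi => h.2.2 i (by omega)⟩

/-- Vanishing to order 2k + 1 exceeds the degree. The assumption on k activates the clause that
removes the dz̄ component. -/
lemma modelKernel_self_eq_bot (hk : 1 ≤ k) (ζ : ℂ) : modelKernel k k ζ = ⊥ := by
  refine (Submodule.eq_bot_iff _).2 fun ξ h => ?_
  exact Prod.ext h.1 (Prod.ext (h.2.1 hk) (eq_zero_of_taylorCoef fun i hi => h.2.2 i (by omega)))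

/-- A form lying in the model together with its conjugate has zeros of order k + 1 at ζ and at its
antipode, two more in total than the degree 2k. -/
lemma eq_zero_of_mem_of_conj_mem {ζ : ℂ} {ξ : ModelFibre k} (h : ξ ∈ modelKernel k 0 ζ)
    (h' : conjFibre k ξ ∈ modelKernel k 0 ζ) : ξ = 0 := by
  refine Prod.ext h.1 (Prod.ext ?_ ?_)
  · simpa [conjFibre_apply] using h'.1
  · exact eq_zero_of_taylorCoef_tau (fun i hi => h.2.2 i (by omega)) fun i hi => h'.2.2 i hi

/-- The form `(w - ζ z)^j z^(2k-j)`, whose only nonzero Taylor coefficient at `ζ` is the `j`-th. -/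
def shifted (j : Fin (2 * k + 1)) (ζ : ℂ) : Coef k := subst (lower (-ζ)) (Pi.single j 1)

lemma taylorCoef_shifted (i : ℕ) (j : Fin (2 * k + 1)) (ζ : ℂ) :
    taylorCoef i ζ (shifted j ζ) = if i = j then 1 else 0 := by
  by_cases hi : i < 2 * k + 1
  · have h := taylorCoef_subst_lower_neg ζ (Pi.single j 1 : Coef k) ⟨i, hi⟩
    rw [shifted]
    refine h.trans ?_
    simp [Pi.single_apply, Fin.ext_iff]
  · rw [taylorCoef_eq_zero_of_lt (by omega), if_neg (by omega)]

lemma contDiff_shifted (j : Fin (2 * k + 1)) : ContDiff ℝ ∞ (shifted j : ℂ → Coef k) := by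
  refine contDiff_pi.2 fun i => ?_
  simp only [shifted, subst_lower, taylorCoef_apply]
  fun_prop

/-- A frame of the model CR structure. -/
def modelFrame (k : ℕ) (i : Fin (k + 1)) (ζ : ℂ) : ModelFibre k :=
  Fin.cases (0, 1, 0) (fun i : Fin k => (0, 0, shifted ⟨k + 1 + i, by omega⟩ ζ)) i

lemma modelFrame_zero (ζ : ℂ) : modelFrame k 0 ζ = (0, 1, 0) := rfl

lemma modelFrame_succ (i : Fin k) (ζ : ℂ) :
    modelFrame k i.succ ζ = (0, 0, shifted ⟨k + 1 + i, by omega⟩ ζ) := rfl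

lemma contDiff_modelFrame (i : Fin (k + 1)) : ContDiff ℝ ∞ (modelFrame k i) := by
  refine Fin.cases ?_ (fun i => ?_) i
  · exact contDiff_const
  · exact contDiff_const.prodMk (contDiff_const.prodMk (contDiff_shifted _))

/-- The i-th vertical frame field vanishes to order exactly k + 1 + i, so it survives in the kernels
up to the i-th. The last one will witness that the (k-1)-st kernel is not zero. -/
lemma modelFrame_succ_mem {j : ℕ} (i : Fin k) (hj : j ≤ i) (ζ : ℂ) :
    modelFrame k i.succ ζ ∈ modelKernel k j ζ := by
  refine ⟨rfl, fun _ => rfl, fun l hl => ?_⟩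
  rw [modelFrame_succ, taylorCoef_shifted, if_neg]
  simp only
  omega

lemma modelFrame_mem (i : Fin (k + 1)) (ζ : ℂ) : modelFrame k i ζ ∈ modelKernel k 0 ζ := by
  refine Fin.cases ?_ (fun i => modelFrame_succ_mem i (Nat.zero_le _) ζ) i
  exact ⟨rfl, fun h => absurd h (by omega), fun i _ => map_zero _⟩

lemma sum_modelFrame (a : Fin (k + 1) → ℂ) (ζ : ℂ) : ∑ i, a i • modelFrame k i ζ =
    (0, a 0, ∑ i : Fin k, a i.succ • shifted ⟨k + 1 + i, by omega⟩ ζ) := by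
  rw [Fin.sum_univ_succ]
  simp only [modelFrame_zero, modelFrame_succ]
  refine Prod.ext ?_ (Prod.ext ?_ ?_)
  · simp [Prod.fst_sum]
  · simp [Prod.fst_sum, Prod.snd_sum]
  · simp [Prod.snd_sum]

lemma taylorCoef_sum_shifted (a : Fin k → ℂ) (l : ℕ) (ζ : ℂ) :
    taylorCoef l ζ (∑ i : Fin k, a i • (shifted ⟨k + 1 + i, by omega⟩ ζ : Coef k)) =
      ∑ i : Fin k, if l = k + 1 + i then a i else 0 := by
  rw [map_sum]
  refine Finset.sum_congr rfl fun i _ => ?_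
  rw [map_smul, taylorCoef_shifted]
  simp

lemma linearIndependent_modelFrame (ζ : ℂ) :
    LinearIndependent ℂ fun i => modelFrame k i ζ := by
  refine Fintype.linearIndependent_iff.2 fun a ha => ?_
  rw [sum_modelFrame] at ha
  have h0 : a 0 = 0 := congrArg (fun ξ : ModelFibre k => ξ.2.1) ha
  have h1 := congrArg (fun ξ : ModelFibre k => ξ.2.2) ha
  refine fun i => Fin.cases h0 (fun i => ?_) i
  have h2 := congrArg (taylorCoef (k + 1 + i) ζ) h1
  simp only [taylorCoef_sum_shifted] at h2
  rw [Finset.sum_eq_single i (fun j _ hj => if_neg fun h => hj (Fin.ext (by omega)))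
    (fun h => absurd (Finset.mem_univ _) h)] at h2
  simpa using h2

lemma span_modelFrame (ζ : ℂ) :
    Submodule.span ℂ (Set.range fun i => modelFrame k i ζ) = modelKernel k 0 ζ := by
  refine le_antisymm (Submodule.span_le.2 (Set.range_subset_iff.2 fun i => modelFrame_mem i ζ))
    fun ξ hξ => ?_
  -- The coordinates in the frame are the Taylor coefficients of order k + 1 and higher; the
  -- difference of both sides has no Taylor coefficient left.
  have h : ξ = ∑ i, (Fin.cases ξ.2.1 (fun i : Fin k => taylorCoef (k + 1 + i) ζ ξ.2.2) i : ℂ) •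
      modelFrame k i ζ := by
    rw [sum_modelFrame]
    refine Prod.ext hξ.1 (Prod.ext rfl ?_)
    rw [← sub_eq_zero]
    refine eq_zero_of_taylorCoef (ζ := ζ) fun l hl => ?_
    simp only [Fin.cases_succ]
    rw [map_sub, taylorCoef_sum_shifted]
    by_cases hlk : l < k + 1
    · rw [hξ.2.2 l hlk, Finset.sum_eq_zero, sub_zero]
      intro i _
      rw [if_neg (by omega)]
    · rw [Finset.sum_eq_single ⟨l - (k + 1), by omega⟩
        (fun j _ hj => if_neg fun h => hj (Fin.ext (by simp only; omega)))
        (fun h => absurd (Finset.mem_univ _) h)]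
      have hl2 : k + 1 + (l - (k + 1)) = l := by omega
      simp only [hl2, if_true, sub_self]
  rw [h]
  exact Submodule.sum_mem _ fun i _ =>
    Submodule.smul_mem _ _ (Submodule.subset_span ⟨i, rfl⟩)

lemma finrank_modelKernel (ζ : ℂ) : Module.finrank ℂ (modelKernel k 0 ζ) = k + 1 := by
  rw [← span_modelFrame, finrank_span_eq_card (linearIndependent_modelFrame ζ), Fintype.card_fin]

/-! ### Calculus in a complex coframe -/

section Calculus

variable {E : Type*} [NormedAddCommGroup E] [NormedSpace ℝ E]

/-- A real coframe with constant coefficients which identifies the complexification of a vector space with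
`ModelFibre k`, together with the real structures. -/
structure ModelCoframe (k : ℕ) (E : Type*) [NormedAddCommGroup E] [NormedSpace ℝ E] where
  /-- the underlying linear map -/
  map : E →L[ℝ] ModelFibre k
  bijective : Function.Bijective fun ab : E × E => map ab.1 + Complex.I • map ab.2
  conj_map : ∀ v, conjFibre k (map v) = map v

namespace ModelCoframe

variable (Θ : ModelCoframe k E)

lemma finiteDimensional (Θ : ModelCoframe k E) : FiniteDimensional ℝ E := by
  refine FiniteDimensional.of_injective Θ.map.toLinearMap fun a b h => ?_
  have h1 : (a, (0 : E)) = (b, 0) := Θ.bijective.1 (by simpa using h)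
  exact congrArg Prod.fst h1

/-- A complex vector as a real and an imaginary part. -/
def equiv : (E × E) ≃ₗ[ℝ] ModelFibre k :=
  LinearEquiv.ofBijective
    { toFun := fun ab : E × E => Θ.map ab.1 + Complex.I • Θ.map ab.2
      map_add' := fun a b => by
        simp only [Prod.fst_add, Prod.snd_add, map_add, smul_add]; abel
      map_smul' := fun r a => by
        simp only [Prod.smul_fst, Prod.smul_snd, map_smul, smul_add, RingHom.id_apply]
        rw [smul_comm] } Θ.bijective

/-- The real and the imaginary part. -/
def parts : ModelFibre k →L[ℝ] E × E := LinearMap.toContinuousLinearMap Θ.equiv.symm.toLinearMap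

lemma map_parts (ξ : ModelFibre k) :
    Θ.map (Θ.parts ξ).1 + Complex.I • Θ.map (Θ.parts ξ).2 = ξ :=
  Θ.equiv.apply_symm_apply ξ

lemma parts_map (a b : E) : Θ.parts (Θ.map a + Complex.I • Θ.map b) = (a, b) :=
  Θ.bijective.1 (Θ.map_parts _)

lemma parts_conj (ξ : ModelFibre k) :
    Θ.parts (conjFibre k ξ) = ((Θ.parts ξ).1, -(Θ.parts ξ).2) := by
  conv_lhs => rw [← Θ.map_parts ξ, map_add, conjFibre_smul, Θ.conj_map, Θ.conj_map]
  rw [← Θ.parts_map]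
  simp

variable {F : Type*} [NormedAddCommGroup F] [NormedSpace ℂ F]

/-- The complex directional derivative. -/
def deriv (f : E → F) (x : E) (ξ : ModelFibre k) : F :=
  fderiv ℝ f x (Θ.parts ξ).1 + Complex.I • fderiv ℝ f x (Θ.parts ξ).2

/-- In a bracket [X, Ȳ] this rewrites D_X Ȳ as the conjugate of D_X̄ Y, so the stability results for
sections of the distribution itself can be applied. -/
lemma deriv_conjFibre {f : E → ModelFibre k} {x : E} (hf : DifferentiableAt ℝ f x)
    (ξ : ModelFibre k) : Θ.deriv (fun y => conjFibre k (f y)) x ξ =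
      conjFibre k (Θ.deriv f x (conjFibre k ξ)) := by
  have h : fderiv ℝ (fun y => conjFibre k (f y)) x = (conjFibre k).comp (fderiv ℝ f x) :=
    ((conjFibre k).hasFDerivAt.comp x hf.hasFDerivAt).fderiv
  simp [deriv, h, parts_conj, conjFibre_smul]

lemma contDiffOn_deriv {f : E → F} {ξ : E → ModelFibre k} {U : Set E} (hU : IsOpen U)
    (hf : ContDiffOn ℝ ∞ f U) (hξ : ContDiffOn ℝ ∞ ξ U) :
    ContDiffOn ℝ ∞ (fun x => Θ.deriv f x (ξ x)) U := by
  have h := hf.fderiv_of_isOpen hU (m := ∞) (by simp)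
  have hp : ContDiffOn ℝ ∞ (fun x => Θ.parts (ξ x)) U := Θ.parts.contDiff.comp_contDiffOn hξ
  exact (h.clm_apply hp.fst).add ((h.clm_apply hp.snd).const_smul Complex.I)

lemma deriv_const (c : F) (x : E) (ξ : ModelFibre k) : Θ.deriv (fun _ => c) x ξ = 0 := by
  simp [deriv]

/-- The complex derivative of the Taylor coefficients of a section at the point given by the first
coordinate. -/
lemma taylorCoef_deriv {f : E → ModelFibre k} {x : E} (hf : DifferentiableAt ℝ f x) {i : ℕ}
    (h0 : ∀ᶠ y in 𝓝 x, taylorCoef i (Θ.map y).1 (f y).2.2 = 0) (ξ : ModelFibre k) :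
    taylorCoef i (Θ.map x).1 (Θ.deriv f x ξ).2.2 =
      -((i + 1) * ξ.1 * taylorCoef (i + 1) (Θ.map x).1 (f x).2.2) := by
  -- Differentiate the identity T_i(f) = 0 along the line x + t v: both the form and its base point
  -- ζ move, and the second motion produces T_{i+1}.
  have key : ∀ v : E, taylorCoef i (Θ.map x).1 (fderiv ℝ f x v).2.2 +
      (i + 1) * (Θ.map v).1 * taylorCoef (i + 1) (Θ.map x).1 (f x).2.2 = 0 := by
    intro v
    have hl : HasDerivAt (fun t : ℝ => x + t • v) v 0 := by
      simpa using ((hasDerivAt_id (0 : ℝ)).smul_const v).const_add x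
    have hx : x + (0 : ℝ) • v = x := by simp
    have hf1 : HasDerivAt (fun t : ℝ => f (x + t • v)) (fderiv ℝ f x v) 0 :=
      (hf.hasFDerivAt.comp_hasDerivAt_of_eq 0 hl hx.symm)
    have hz : HasDerivAt (fun t : ℝ => (Θ.map (x + t • v)).1) (Θ.map v).1 0 :=
      ((ContinuousLinearMap.fst ℝ ℂ (ℂ × Coef k)).comp Θ.map).hasFDerivAt.comp_hasDerivAt 0 hl
    have hfj : ∀ j, HasDerivAt (fun t : ℝ => (f (x + t • v)).2.2 j) ((fderiv ℝ f x v).2.2 j) 0 :=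
      fun j => hasDerivAt_pi.1 hf1.snd.snd j
    have hG : HasDerivAt (fun t : ℝ => taylorCoef i (Θ.map (x + t • v)).1 (f (x + t • v)).2.2)
        (taylorCoef i (Θ.map x).1 (fderiv ℝ f x v).2.2 +
          (i + 1) * (Θ.map v).1 * taylorCoef (i + 1) (Θ.map x).1 (f x).2.2) 0 := by
      -- Expanding by linearity in the coefficients separates the two dependencies on t, so that the
      -- product rule applies term by term.
      have e : ∀ (i : ℕ) (ζ : ℂ) (c : Coef k), taylorCoef i ζ c =
          ∑ j, c j * taylorCoef i ζ (fun l => if j = l then 1 else 0) := fun i ζ c =>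
        LinearMap.pi_apply_eq_sum_univ _ _
      rw [e i (Θ.map x).1 (fderiv ℝ f x v).2.2, e (i + 1) (Θ.map x).1 (f x).2.2, Finset.mul_sum,
        ← Finset.sum_add_distrib]
      have e' : (fun t : ℝ => taylorCoef i (Θ.map (x + t • v)).1 (f (x + t • v)).2.2) =
          fun t : ℝ => ∑ j, (f (x + t • v)).2.2 j *
            taylorCoef i (Θ.map (x + t • v)).1 (fun l => if j = l then 1 else 0) :=
        funext fun t => e _ _ _
      rw [e']
      refine HasDerivAt.fun_sum fun j _ => ?_
      have h2 := (hasDerivAt_taylorCoef i (Θ.map (x + (0 : ℝ) • v)).1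
        (fun l : Fin (2 * k + 1) => if j = l then (1 : ℂ) else 0)).comp 0 hz
      refine ((hfj j).mul h2).congr_deriv ?_
      simp only [Function.comp, hx]
      ring
    have ht : Tendsto (fun t : ℝ => x + t • v) (𝓝 0) (𝓝 x) := by
      simpa using hl.continuousAt.tendsto
    have hG0 : HasDerivAt (fun t : ℝ => taylorCoef i (Θ.map (x + t • v)).1 (f (x + t • v)).2.2)
        0 0 :=
      (hasDerivAt_const (0 : ℝ) (0 : ℂ)).congr_of_eventuallyEq (ht.eventually h0)
    exact hG.unique hG0
  have h1 := key (Θ.parts ξ).1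
  have h2 := key (Θ.parts ξ).2
  have h3 : ξ.1 = (Θ.map (Θ.parts ξ).1).1 + Complex.I * (Θ.map (Θ.parts ξ).2).1 := by
    conv_lhs => rw [← Θ.map_parts ξ]
    rfl
  have h4 : (Θ.deriv f x ξ).2.2 =
      (fderiv ℝ f x (Θ.parts ξ).1).2.2 + Complex.I • (fderiv ℝ f x (Θ.parts ξ).2).2.2 := rfl
  rw [h4, map_add, map_smul, smul_eq_mul, h3]
  linear_combination h1 + Complex.I * h2

lemma deriv_clm_eq_zero {f : E → ModelFibre k} {x : E} (hf : DifferentiableAt ℝ f x)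
    (ℓ : ModelFibre k →L[ℂ] ℂ) (h0 : ∀ᶠ y in 𝓝 x, ℓ (f y) = 0) (ξ : ModelFibre k) :
    ℓ (Θ.deriv f x ξ) = 0 := by
  have h : ∀ v, ℓ (fderiv ℝ f x v) = 0 := by
    intro v
    have h1 : HasFDerivAt (fun y => ℓ (f y)) ((ℓ.restrictScalars ℝ).comp (fderiv ℝ f x)) x :=
      (ℓ.restrictScalars ℝ).hasFDerivAt.comp x hf.hasFDerivAt
    have h2 : HasFDerivAt (fun y => ℓ (f y)) (0 : E →L[ℝ] ℂ) x :=
      (hasFDerivAt_const (0 : ℂ) x).congr_of_eventuallyEq h0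
    exact DFunLike.congr_fun (h1.unique h2) v
  rw [deriv, map_add, map_smul, h, h, smul_zero, add_zero]

/-- When dz(ξ) = 0 the correction term of `taylorCoef_deriv` disappears. This gives integrability,
and it also controls the conjugate part of the brackets with vertical fields. -/
lemma deriv_mem {f : E → ModelFibre k} {x : E} (hf : DifferentiableAt ℝ f x) {j : ℕ}
    (h : ∀ᶠ y in 𝓝 x, f y ∈ modelKernel k j (Θ.map y).1) {ξ : ModelFibre k} (hξ : ξ.1 = 0) :
    Θ.deriv f x ξ ∈ modelKernel k j (Θ.map x).1 := by
  refine ⟨?_, fun hj => ?_, fun i hi => ?_⟩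
  · exact Θ.deriv_clm_eq_zero hf (ContinuousLinearMap.fst ℂ ℂ (ℂ × Coef k))
      (h.mono fun y hy => hy.1) ξ
  · exact Θ.deriv_clm_eq_zero hf ((ContinuousLinearMap.fst ℂ ℂ (Coef k)).comp
      (ContinuousLinearMap.snd ℂ ℂ (ℂ × Coef k))) (h.mono fun y hy => hy.2.1 hj) ξ
  · rw [Θ.taylorCoef_deriv hf (h.mono fun y hy => hy.2.2 i hi), hξ]
    ring

/-- An arbitrary direction involves the Taylor coefficient one order higher, so differentiation
costs at most one step in the filtration. -/
lemma deriv_mem_pred {f : E → ModelFibre k} {x : E} (hf : DifferentiableAt ℝ f x) {j : ℕ}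
    (h : ∀ᶠ y in 𝓝 x, f y ∈ modelKernel k (j + 1) (Θ.map y).1) (ξ : ModelFibre k) :
    Θ.deriv f x ξ ∈ modelKernel k j (Θ.map x).1 := by
  refine ⟨?_, fun _ => ?_, fun i hi => ?_⟩
  · exact Θ.deriv_clm_eq_zero hf (ContinuousLinearMap.fst ℂ ℂ (ℂ × Coef k))
      (h.mono fun y hy => hy.1) ξ
  · exact Θ.deriv_clm_eq_zero hf ((ContinuousLinearMap.fst ℂ ℂ (Coef k)).comp
      (ContinuousLinearMap.snd ℂ ℂ (ℂ × Coef k))) (h.mono fun y hy => hy.2.1 (by omega)) ξ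
  · rw [Θ.taylorCoef_deriv hf (h.mono fun y hy => hy.2.2 i (by omega)),
      h.self_of_nhds.2.2 (i + 1) (by omega)]
    ring

/-- A section of the `j`-th kernel whose bracket with the conjugate of the frame vector field
`∂/∂z̄` is trivial modulo the `j`-th kernel and the conjugate distribution vanishes to higher order. -/
lemma taylorCoef_succ_eq_zero {f : E → ModelFibre k} {x : E} (hf : DifferentiableAt ℝ f x)
    {j : ℕ} (h : ∀ᶠ y in 𝓝 x, f y ∈ modelKernel k j (Θ.map y).1) {ξ η : ModelFibre k}
    (hξ : ξ ∈ modelKernel k j (Θ.map x).1) (hη : η ∈ modelKernel k 0 (Θ.map x).1)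
    (hb : -Θ.deriv f x (1, 0, 0) = ξ + conjFibre k η) :
    taylorCoef (k + j + 1) (Θ.map x).1 (f x).2.2 = 0 := by
  have ht : ∀ i < k + j + 1, taylorCoef i (Θ.map x).1 (Θ.deriv f x (1, 0, 0)).2.2 =
      -((i + 1) * taylorCoef (i + 1) (Θ.map x).1 (f x).2.2) := by
    intro i hi
    rw [Θ.taylorCoef_deriv hf (h.mono fun y hy => hy.2.2 i hi)]
    ring
  have hc : tau η.2.2 = -(Θ.deriv f x (1, 0, 0)).2.2 - ξ.2.2 := by
    have := congrArg (fun v : ModelFibre k => v.2.2) hb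
    simp only [Prod.snd_neg, Prod.snd_add, conjFibre_apply] at this
    rw [this]
    abel
  -- The bracket equation makes `tau η.2.2` vanish to order k at ζ, while membership of η gives
  -- order k + 1 at the antipode. Hence the conjugate summand is zero on forms and cannot hide the
  -- (k+j)-th coefficient.
  have hz : tau η.2.2 = 0 := by
    refine eq_zero_of_taylorCoef_tau (ζ := (Θ.map x).1) (fun i hi => ?_) fun i hi => ?_
    · rw [hc, map_sub, map_neg, ht i (by omega), hξ.2.2 i (by omega),
        h.self_of_nhds.2.2 (i + 1) (by omega)]
      ring
    · rw [tau_tau]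
      exact hη.2.2 i hi
  have h1 : taylorCoef (k + j) (Θ.map x).1 (tau η.2.2) = 0 := by rw [hz, map_zero]
  rw [hc, map_sub, map_neg, ht (k + j) (by omega), hξ.2.2 (k + j) (by omega)] at h1
  have h2 : ((k + j : ℕ) : ℂ) + 1 ≠ 0 := Nat.cast_add_one_ne_zero _
  have h3 : (((k + j : ℕ) : ℂ) + 1) * taylorCoef (k + j + 1) (Θ.map x).1 (f x).2.2 = 0 := by
    linear_combination h1
  exact (mul_eq_zero.1 h3).resolve_left h2

/-- A section of the model CR structure whose bracket with the conjugate of the first vertical frame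
vector field is trivial is vertical. -/
lemma vertical_of_bracket (hk : 1 ≤ k) {f : E → ModelFibre k} {x : E}
    (hf : DifferentiableAt ℝ f x)
    (h : ∀ᶠ y in 𝓝 x, f y ∈ modelKernel k 0 (Θ.map y).1) {ξ η : ModelFibre k}
    (hξ : ξ ∈ modelKernel k 0 (Θ.map x).1) (hη : η ∈ modelKernel k 0 (Θ.map x).1)
    (hb : Θ.deriv (fun y => conjFibre k (modelFrame k (Fin.succ ⟨0, hk⟩) (Θ.map y).1)) x (f x) -
      Θ.deriv f x (conjFibre k (modelFrame k (Fin.succ ⟨0, hk⟩) (Θ.map x).1)) =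
        ξ + conjFibre k η) :
    (f x).2.1 = 0 := by
  set e : E → ModelFibre k := fun y => modelFrame k (Fin.succ ⟨0, hk⟩) (Θ.map y).1 with he
  have hed : DifferentiableAt ℝ e x := by
    have hz : ContDiff ℝ ∞ fun y => (Θ.map y).1 := Θ.map.contDiff.fst
    exact ((contDiff_modelFrame _).comp hz).differentiable (by simp) x
  have hem : ∀ y, e y ∈ modelKernel k 0 (Θ.map y).1 := fun y => modelFrame_mem _ _
  -- The test field is vertical, so its conjugate has no dz component and the second derivative
  -- stays inside the model distribution.
  have hg := Θ.deriv_mem hf h (ξ := conjFibre k (e x)) (by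
    rw [conjFibre_apply, he]; simp only [modelFrame_succ, map_zero])
  rw [Θ.deriv_conjFibre hed] at hb
  set w := Θ.deriv e x (conjFibre k (f x)) with hw
  have ht : ∀ i < k + 1, taylorCoef i (Θ.map x).1 w.2.2 =
      -((i + 1) * starRingEnd ℂ (f x).2.1 * taylorCoef (i + 1) (Θ.map x).1 (e x).2.2) := by
    intro i hi
    exact Θ.taylorCoef_deriv hed (Eventually.of_forall fun y => (hem y).2.2 i (by omega)) _
  set g := Θ.deriv f x (conjFibre k (e x)) with hgdef
  have hc : tau (g.2.2 + ξ.2.2) = w.2.2 - η.2.2 := by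
    have h1 := congrArg (fun θ : ModelFibre k => (conjFibre k θ).2.2) hb
    simp only [map_sub, map_add, conjFibre_conjFibre, Prod.snd_sub, Prod.snd_add] at h1
    have h2 : (conjFibre k g).2.2 = tau g.2.2 := rfl
    have h3 : (conjFibre k ξ).2.2 = tau ξ.2.2 := rfl
    rw [h2, h3] at h1
    rw [tau_add, eq_sub_iff_add_eq, add_assoc, ← h1]
    abel
  -- The same count of zeros: order k at ζ from the right side of `hc`, and order k + 1 for the
  -- conjugate form `g.2.2 + ξ.2.2`.
  have hz : tau (g.2.2 + ξ.2.2) = 0 := by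
    refine eq_zero_of_taylorCoef_tau (ζ := (Θ.map x).1) (fun i hi => ?_) fun i hi => ?_
    · rw [hc, map_sub, ht i (by omega), (hem x).2.2 (i + 1) (by omega), hη.2.2 i (by omega)]
      ring
    · rw [tau_tau, map_add, hg.2.2 i hi, hξ.2.2 i hi, add_zero]
  have h1 : taylorCoef k (Θ.map x).1 (tau (g.2.2 + ξ.2.2)) = 0 := by rw [hz, map_zero]
  rw [hc, map_sub, ht k (by omega), hη.2.2 k (by omega)] at h1
  -- The test field vanishes to order exactly k + 1, with leading coefficient 1, so the k-th
  -- coefficient of its derivative isolates the dz̄ component of f.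
  have h2 : taylorCoef (k + 1) (Θ.map x).1 (e x).2.2 = 1 := by
    rw [he]
    simp only [modelFrame_succ, taylorCoef_shifted]
    simp
  rw [h2] at h1
  have h3 : ((k : ℂ) + 1) ≠ 0 := Nat.cast_add_one_ne_zero _
  have h4 : ((k : ℂ) + 1) * starRingEnd ℂ (f x).2.1 = 0 := by linear_combination -h1
  simpa using (mul_eq_zero.1 h4).resolve_left h3

end ModelCoframe

end Calculus

end CRGeom

end

noncomputable section

namespace CRGeom

open Filter Topology

/-! ### CR structures which are given by the model in charts -/

section Charts

variable {k : ℕ} {E H : Type*} [NormedAddCommGroup E] [NormedSpace ℝ E] [TopologicalSpace H]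
  {I : ModelWithCorners ℝ E H} {M : Type*} [TopologicalSpace M] [ChartedSpace H M]

lemma exists_eq_tmul {m : M} (w : CTangent I m) : ∃ a b : TangentSpace I m,
    w = (1 : ℂ) ⊗ₜ[ℝ] a + Complex.I ⊗ₜ[ℝ] b := by
  induction w using TensorProduct.induction_on with
  | zero => exact ⟨0, 0, by simp⟩
  | tmul z v =>
    refine ⟨z.re • v, z.im • v, ?_⟩
    rw [← TensorProduct.smul_tmul, ← TensorProduct.smul_tmul, ← TensorProduct.add_tmul]
    congr 1
    simpa [mul_comm] using (Complex.re_add_im z).symm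
  | add x y hx hy =>
    obtain ⟨a, b, rfl⟩ := hx
    obtain ⟨c, d, rfl⟩ := hy
    exact ⟨a + c, b + d, by simp only [TensorProduct.tmul_add]; abel⟩

lemma CVectorField.eval_conj (X : CVectorField I M) (m : M) :
    X.conj.eval m = conjTangent I m (X.eval m) := by
  simp [CVectorField.eval, CVectorField.conj, conjTangent, TensorProduct.tmul_neg,
    TensorProduct.neg_tmul]

/-- The derivative of the chart at `m₀`. -/
def chartDeriv (I : ModelWithCorners ℝ E H) (m₀ m : M) : TangentSpace I m →L[ℝ] E :=
  mfderiv I 𝓘(ℝ, E) (extChartAt I m₀) m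

/-- A vector field in the chart at `m₀`. -/
def chartField (m₀ : M) (V : ∀ m : M, TangentSpace I m) (x : E) : E :=
  chartDeriv I m₀ ((extChartAt I m₀).symm x) (V ((extChartAt I m₀).symm x))

/-- The vector field with a given expression in the chart at `m₀`. -/
def ofChartField (I : ModelWithCorners ℝ E H) (m₀ : M) (v : E → E) (m : M) : TangentSpace I m :=
  (chartDeriv I m₀ m).inverse (v (extChartAt I m₀ m))

section Smooth

variable [IsManifold I ∞ M]

lemma chartDeriv_isInvertible {m₀ m : M} (hm : m ∈ (extChartAt I m₀).source) :
    (chartDeriv I m₀ m).IsInvertible :=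
  have : IsManifold I 1 M := .of_le (n := ∞) (by simp)
  isInvertible_mfderiv_extChartAt hm

lemma chartDeriv_ofChartField {m₀ m : M} (hm : m ∈ (extChartAt I m₀).source) (v : E → E) :
    chartDeriv I m₀ m (ofChartField I m₀ v m) = v (extChartAt I m₀ m) := by
  obtain ⟨e, he⟩ := chartDeriv_isInvertible hm
  rw [ofChartField, ← he, ContinuousLinearMap.inverse_equiv]
  exact e.apply_symm_apply _

lemma contMDiffOn_ofChartField [CompleteSpace E] {m₀ : M} {v : E → E} {W : Set E}
    (hv : ContDiffOn ℝ ∞ v W) : ContMDiffOn I I.tangent ∞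
      (fun m => (⟨m, ofChartField I m₀ v m⟩ : TangentBundle I M))
      ((extChartAt I m₀).source ∩ extChartAt I m₀ ⁻¹' W) := by
  have : IsManifold I 1 M := .of_le (n := ∞) (by simp)
  intro m hm
  have h1 : ContMDiffOn 𝓘(ℝ, E) 𝓘(ℝ, E).tangent ∞
      (fun x => (⟨x, v x⟩ : TangentBundle 𝓘(ℝ, E) E)) W :=
    contMDiffOn_vectorSpace_iff_contDiffOn.2 hv
  have h2 : ContMDiffAt I 𝓘(ℝ, E) ∞ (extChartAt I m₀) m :=
    contMDiffAt_extChartAt' (by rw [← extChartAt_source I]; exact hm.1)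
  exact (ContMDiffWithinAt.mpullback_vectorField_preimage (h1 _ hm.2) h2
    (isInvertible_mfderiv_extChartAt hm.1) (by simp)).mono Set.inter_subset_right

variable [I.Boundaryless]

/-- Absence of boundary turns derivatives within the range of the model into ordinary ones. Pulling
back by the inverse chart is then the same as pushing forward by the chart. -/
lemma mfderiv_extChartAt_symm {m₀ : M} {x : E} (hx : x ∈ (extChartAt I m₀).target) :
    (mfderiv 𝓘(ℝ, E) I (extChartAt I m₀).symm x).IsInvertible ∧
    (mfderiv 𝓘(ℝ, E) I (extChartAt I m₀).symm x).inverse =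
      chartDeriv I m₀ ((extChartAt I m₀).symm x) := by
  have : IsManifold I 1 M := .of_le (n := ∞) (by simp)
  have h1 := mfderiv_extChartAt_comp_mfderivWithin_extChartAt_symm (I := I) hx
  have h2 := isInvertible_mfderivWithin_extChartAt_symm (I := I) hx
  rw [I.range_eq_univ, mfderivWithin_univ] at h1 h2
  refine ⟨h2, ?_⟩
  obtain ⟨e, he⟩ := h2
  rw [← he] at h1 ⊢
  rw [ContinuousLinearMap.inverse_equiv]
  ext v
  have h3 := DFunLike.congr_fun h1 (e.symm v)
  have h4 : (e : _ →L[ℝ] TangentSpace I ((extChartAt I m₀).symm x)) (e.symm v) = v :=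
    e.apply_symm_apply v
  rw [ContinuousLinearMap.comp_apply, h4] at h3
  exact h3.symm

lemma contMDiffAt_extChartAt_symm {m₀ : M} {x : E} (hx : x ∈ (extChartAt I m₀).target) :
    ContMDiffAt 𝓘(ℝ, E) I ∞ (extChartAt I m₀).symm x :=
  (contMDiffOn_extChartAt_symm m₀).contMDiffAt ((isOpen_extChartAt_target m₀).mem_nhds hx)

lemma mpullback_eq_chartField {m₀ : M} {x : E} (hx : x ∈ (extChartAt I m₀).target)
    (V : ∀ m : M, TangentSpace I m) :
    VectorField.mpullback 𝓘(ℝ, E) I (extChartAt I m₀).symm V x = chartField m₀ V x := by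
  rw [VectorField.mpullback_apply, (mfderiv_extChartAt_symm hx).2]
  rfl

omit [I.Boundaryless] [IsManifold I ∞ M] [ChartedSpace H M] [TopologicalSpace M]
  [TopologicalSpace H] in
lemma mlieBracket_eq_lieBracket (V W : ∀ x : E, TangentSpace 𝓘(ℝ, E) x) (x : E) :
    VectorField.mlieBracket 𝓘(ℝ, E) V W x = VectorField.lieBracket ℝ V W x := by
  rw [← VectorField.mlieBracketWithin_univ, VectorField.mlieBracketWithin_eq_lieBracketWithin]
  exact congrFun (VectorField.lieBracketWithin_univ (𝕜 := ℝ) (E := E)) x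

/-- The part of the chart at `m₀` which belongs to `U`. -/
def chartSet (I : ModelWithCorners ℝ E H) (m₀ : M) (U : Set M) : Set E :=
  (extChartAt I m₀).target ∩ (extChartAt I m₀).symm ⁻¹' U

omit [IsManifold I ∞ M] in
lemma isOpen_chartSet (m₀ : M) {U : Set M} (hU : IsOpen U) : IsOpen (chartSet I m₀ U) :=
  (continuousOn_extChartAt_symm m₀).isOpen_inter_preimage (isOpen_extChartAt_target m₀) hU

lemma contDiffOn_chartField [CompleteSpace E] (m₀ : M) {V : ∀ m : M, TangentSpace I m} {U : Set M}
    (hV : ContMDiffOn I I.tangent ∞ (fun m => (⟨m, V m⟩ : TangentBundle I M)) U) :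
    ContDiffOn ℝ ∞ (chartField m₀ V) (chartSet I m₀ U) := by
  have : IsManifold I 1 M := .of_le (n := ∞) (by simp)
  have h : ContMDiffOn 𝓘(ℝ, E) 𝓘(ℝ, E).tangent ∞
      (fun x => (⟨x, VectorField.mpullback 𝓘(ℝ, E) I (extChartAt I m₀).symm V x⟩ :
        TangentBundle 𝓘(ℝ, E) E)) (chartSet I m₀ U) := fun x hx =>
    (ContMDiffWithinAt.mpullback_vectorField_preimage (hV _ hx.2)
      (contMDiffAt_extChartAt_symm hx.1) (mfderiv_extChartAt_symm hx.1).1 (by simp)).mono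
        Set.inter_subset_right
  exact (contMDiffOn_vectorSpace_iff_contDiffOn.1 h).congr fun x hx =>
    (mpullback_eq_chartField hx.1 V).symm

/-- The bracket is natural under the pullback by the inverse chart, and on a vector space it is the
difference of directional derivatives. -/
lemma chartField_mlieBracket [CompleteSpace E] (m₀ : M) {V W : ∀ m : M, TangentSpace I m}
    {U : Set M} (hU : IsOpen U)
    (hV : ContMDiffOn I I.tangent ∞ (fun m => (⟨m, V m⟩ : TangentBundle I M)) U)
    (hW : ContMDiffOn I I.tangent ∞ (fun m => (⟨m, W m⟩ : TangentBundle I M)) U)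
    {x : E} (hx : x ∈ chartSet I m₀ U) :
    chartField m₀ (VectorField.mlieBracket I V W) x =
      fderiv ℝ (chartField m₀ W) x (chartField m₀ V x) -
        fderiv ℝ (chartField m₀ V) x (chartField m₀ W x) := by
  have h2 : minSmoothness ℝ 2 ≤ (∞ : WithTop ℕ∞) := by
    rw [minSmoothness_of_isRCLikeNormedField]
    exact WithTop.coe_le_coe.2 le_top
  have : IsManifold I (minSmoothness ℝ 2) M := .of_le h2
  have hUn : U ∈ 𝓝 ((extChartAt I m₀).symm x) := hU.mem_nhds hx.2
  have h1 := VectorField.mpullback_mlieBracket (I := 𝓘(ℝ, E)) (I' := I) (n := ∞)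
    (f := (extChartAt I m₀).symm)
    ((hV.contMDiffAt hUn).mdifferentiableAt (by simp))
    ((hW.contMDiffAt hUn).mdifferentiableAt (by simp)) (contMDiffAt_extChartAt_symm hx.1)
    h2
  rw [mpullback_eq_chartField hx.1] at h1
  have hev : ∀ V' : ∀ m : M, TangentSpace I m,
      VectorField.mpullback 𝓘(ℝ, E) I (extChartAt I m₀).symm V' =ᶠ[𝓝 x] chartField m₀ V' :=
    fun V' => ((isOpen_extChartAt_target m₀).eventually_mem hx.1).mono fun y hy =>
      mpullback_eq_chartField hy V'
  rw [Filter.EventuallyEq.mlieBracket_vectorField_eq (hev V) (hev W)] at h1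
  exact h1.trans (mlieBracket_eq_lieBracket (chartField m₀ V) (chartField m₀ W) x)

end Smooth

end Charts

end CRGeom

end

noncomputable section

namespace CRGeom

open Filter Topology

/-! ### Complex vector fields and Levi kernels in a coframe constant in a chart -/

section Modelled

variable {k : ℕ} {E H : Type*} [NormedAddCommGroup E] [NormedSpace ℝ E] [TopologicalSpace H]
  {I : ModelWithCorners ℝ E H} {M : Type*} [TopologicalSpace M] [ChartedSpace H M]

lemma CVectorField.SmoothOn.mono [IsManifold I ∞ M] {X : CVectorField I M} {U W : Set M}
    (hX : X.SmoothOn U) (h : W ⊆ U) : X.SmoothOn W := ⟨hX.1.mono h, hX.2.mono h⟩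

lemma CVectorField.SmoothOn.conj [IsManifold I ∞ M] {X : CVectorField I M} {U : Set M}
    (hX : X.SmoothOn U) : X.conj.SmoothOn U :=
  have : IsManifold I 1 M := .of_le (n := ∞) (by simp)
  ⟨hX.1, hX.2.neg_section⟩

namespace ModelCoframe

variable (Θ : ModelCoframe k E)

/-- The coordinates of complexified tangent vectors with respect to a coframe which is constant in
a chart. -/
def coord (Θ : ModelCoframe k E) (m₀ m : M) : CTangent I m →ₗ[ℂ] ModelFibre k :=
  LinearMap.liftBaseChange ℂ (Θ.map.toLinearMap ∘ₗ (chartDeriv I m₀ m).toLinearMap)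

lemma coord_add_tmul (m₀ m : M) (a b : TangentSpace I m) :
    Θ.coord m₀ m ((1 : ℂ) ⊗ₜ[ℝ] a + Complex.I ⊗ₜ[ℝ] b) =
      Θ.map (chartDeriv I m₀ m a) + Complex.I • Θ.map (chartDeriv I m₀ m b) := by
  simp [coord]

lemma coord_conj (m₀ m : M) (w : CTangent I m) :
    Θ.coord m₀ m (conjTangent I m w) = conjFibre k (Θ.coord m₀ m w) := by
  obtain ⟨a, b, rfl⟩ := exists_eq_tmul w
  have h : conjTangent I m ((1 : ℂ) ⊗ₜ[ℝ] a + Complex.I ⊗ₜ[ℝ] b) =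
      (1 : ℂ) ⊗ₜ[ℝ] a + Complex.I ⊗ₜ[ℝ] (-b) := by
    simp [conjTangent, TensorProduct.tmul_neg, TensorProduct.neg_tmul]
  rw [h, coord_add_tmul, coord_add_tmul, map_add, conjFibre_smul, Θ.conj_map, Θ.conj_map]
  simp

/-- A complex vector field in a chart, in terms of a constant coframe. -/
def rep (m₀ : M) (X : CVectorField I M) (x : E) : ModelFibre k :=
  Θ.coord m₀ ((extChartAt I m₀).symm x) (X.eval ((extChartAt I m₀).symm x))

lemma rep_eq (m₀ : M) (X : CVectorField I M) (x : E) :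
    Θ.rep m₀ X x = Θ.map (chartField m₀ X.re x) + Complex.I • Θ.map (chartField m₀ X.im x) :=
  Θ.coord_add_tmul _ _ _ _

lemma parts_rep (m₀ : M) (X : CVectorField I M) (x : E) :
    Θ.parts (Θ.rep m₀ X x) = (chartField m₀ X.re x, chartField m₀ X.im x) := by
  rw [rep_eq, parts_map]

lemma rep_conj (m₀ : M) (X : CVectorField I M) (x : E) :
    Θ.rep m₀ X.conj x = conjFibre k (Θ.rep m₀ X x) := by
  rw [rep, CVectorField.eval_conj, coord_conj]
  rfl

/-- The complex vector field with given components in a chart. -/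
def field (I : ModelWithCorners ℝ E H) (m₀ : M) (ξ : E → ModelFibre k) : CVectorField I M where
  re := ofChartField I m₀ fun x => (Θ.parts (ξ x)).1
  im := ofChartField I m₀ fun x => (Θ.parts (ξ x)).2

section Smooth

variable [IsManifold I ∞ M]

lemma coord_bijective {m₀ m : M} (hm : m ∈ (extChartAt I m₀).source) :
    Function.Bijective (Θ.coord m₀ m : CTangent I m →ₗ[ℂ] ModelFibre k) := by
  obtain ⟨e, he⟩ := chartDeriv_isInvertible (I := I) hm
  constructor
  · rw [← LinearMap.ker_eq_bot, LinearMap.ker_eq_bot']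
    intro w hw
    obtain ⟨a, b, rfl⟩ := exists_eq_tmul w
    rw [coord_add_tmul, ← he] at hw
    have h := Θ.parts_map (e a) (e b)
    have hw' : Θ.map (e a) + Complex.I • Θ.map (e b) = 0 := hw
    rw [hw', map_zero] at h
    have ha : a = 0 := e.injective (by rw [map_zero]; exact (congrArg Prod.fst h).symm)
    have hb : b = 0 := e.injective (by rw [map_zero]; exact (congrArg Prod.snd h).symm)
    rw [ha, hb]
    simp
  · intro ξ
    refine ⟨(1 : ℂ) ⊗ₜ[ℝ] e.symm (Θ.parts ξ).1 + Complex.I ⊗ₜ[ℝ] e.symm (Θ.parts ξ).2, ?_⟩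
    rw [coord_add_tmul, ← he]
    have h1 : ∀ v, (e : TangentSpace I m →L[ℝ] _) (e.symm v) = v := fun v => e.apply_symm_apply v
    rw [h1, h1]
    exact Θ.map_parts ξ

lemma coord_field {m₀ m : M} (hm : m ∈ (extChartAt I m₀).source) (ξ : E → ModelFibre k) :
    Θ.coord m₀ m ((Θ.field I m₀ ξ).eval m) = ξ (extChartAt I m₀ m) := by
  refine (Θ.coord_add_tmul _ _ _ _).trans ?_
  rw [field, chartDeriv_ofChartField hm, chartDeriv_ofChartField hm]
  exact Θ.map_parts _

lemma rep_field {m₀ : M} {x : E} (hx : x ∈ (extChartAt I m₀).target) (ξ : E → ModelFibre k) :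
    Θ.rep m₀ (Θ.field I m₀ ξ) x = ξ x := by
  rw [rep, coord_field Θ ((extChartAt I m₀).map_target hx), (extChartAt I m₀).right_inv hx]

lemma smoothOn_field {m₀ : M} {ξ : E → ModelFibre k} {W : Set E} (hξ : ContDiffOn ℝ ∞ ξ W)
    {U : Set M} (hU : U ⊆ (extChartAt I m₀).source ∩ extChartAt I m₀ ⁻¹' W) :
    (Θ.field I m₀ ξ).SmoothOn U := by
  have := Θ.finiteDimensional
  have : CompleteSpace E := FiniteDimensional.complete ℝ E
  have hp : ContDiffOn ℝ ∞ (fun x => Θ.parts (ξ x)) W := Θ.parts.contDiff.comp_contDiffOn hξ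
  exact ⟨(contMDiffOn_ofChartField hp.fst).mono hU, (contMDiffOn_ofChartField hp.snd).mono hU⟩

variable [I.Boundaryless]

lemma contDiffOn_rep (m₀ : M) {X : CVectorField I M} {U : Set M} (hX : X.SmoothOn U) :
    ContDiffOn ℝ ∞ (Θ.rep m₀ X) (chartSet I m₀ U) := by
  have := Θ.finiteDimensional
  have : CompleteSpace E := FiniteDimensional.complete ℝ E
  have h1 := Θ.map.contDiff.comp_contDiffOn (contDiffOn_chartField m₀ hX.1)
  have h2 := Θ.map.contDiff.comp_contDiffOn (contDiffOn_chartField m₀ hX.2)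
  exact (h1.add (h2.const_smul Complex.I)).congr fun x _ => Θ.rep_eq m₀ X x

lemma differentiableAt_rep (m₀ : M) {X : CVectorField I M} {U : Set M} (hU : IsOpen U)
    (hX : X.SmoothOn U) {x : E} (hx : x ∈ chartSet I m₀ U) :
    DifferentiableAt ℝ (Θ.rep m₀ X) x :=
  ((Θ.contDiffOn_rep m₀ hX).contDiffAt ((isOpen_chartSet m₀ hU).mem_nhds hx)).differentiableAt
    (by simp)

/-- Because the coframe has constant coefficients in the chart, no structure functions appear: the
bracket is the flat one, extended complex bilinearly. -/
lemma rep_bracket (m₀ : M) {X Y : CVectorField I M} {U : Set M} (hU : IsOpen U)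
    (hX : X.SmoothOn U) (hY : Y.SmoothOn U) {x : E} (hx : x ∈ chartSet I m₀ U) :
    Θ.rep m₀ (X.bracket Y) x =
      Θ.deriv (Θ.rep m₀ Y) x (Θ.rep m₀ X x) - Θ.deriv (Θ.rep m₀ X) x (Θ.rep m₀ Y x) := by
  have := Θ.finiteDimensional
  have : CompleteSpace E := FiniteDimensional.complete ℝ E
  have hd : ∀ Z : CVectorField I M, Z.SmoothOn U → ∀ v, fderiv ℝ (Θ.rep m₀ Z) x v =
      Θ.map (fderiv ℝ (chartField m₀ Z.re) x v) +
        Complex.I • Θ.map (fderiv ℝ (chartField m₀ Z.im) x v) := by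
    intro Z hZ v
    have hn := (isOpen_chartSet m₀ hU).mem_nhds hx
    have h1 := (((contDiffOn_chartField m₀ hZ.1).contDiffAt hn).differentiableAt
      (by simp)).hasFDerivAt
    have h2 := (((contDiffOn_chartField m₀ hZ.2).contDiffAt hn).differentiableAt
      (by simp)).hasFDerivAt
    have h3 := (Θ.map.hasFDerivAt.comp x h1).add
      ((Θ.map.hasFDerivAt.comp x h2).const_smul Complex.I)
    have h4 : Θ.rep m₀ Z = fun y => Θ.map (chartField m₀ Z.re y) +
        Complex.I • Θ.map (chartField m₀ Z.im y) := funext fun y => Θ.rep_eq m₀ Z y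
    rw [h4]
    exact DFunLike.congr_fun h3.fderiv v
  have hsub : ∀ V W : ∀ m : M, TangentSpace I m, chartField m₀ (fun m => V m - W m) x =
      chartField m₀ V x - chartField m₀ W x := fun V W => map_sub _ _ _
  have hadd : ∀ V W : ∀ m : M, TangentSpace I m, chartField m₀ (fun m => V m + W m) x =
      chartField m₀ V x + chartField m₀ W x := fun V W => map_add _ _ _
  rw [rep_eq]
  simp only [CVectorField.bracket, hsub, hadd]
  rw [chartField_mlieBracket m₀ hU hX.1 hY.1 hx, chartField_mlieBracket m₀ hU hX.2 hY.2 hx,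
    chartField_mlieBracket m₀ hU hX.1 hY.2 hx, chartField_mlieBracket m₀ hU hX.2 hY.1 hx]
  simp only [deriv, parts_rep, hd X hX, hd Y hY, map_sub, map_add, smul_add, smul_sub, smul_smul,
    Complex.I_mul_I, neg_smul, one_smul]
  abel

omit [IsManifold I ∞ M] [I.Boundaryless] [ChartedSpace H M] [TopologicalSpace M]
  [TopologicalSpace H] in
lemma deriv_congr {F : Type*} [NormedAddCommGroup F] [NormedSpace ℂ F] {f g : E → F} {x : E}
    (h : f =ᶠ[𝓝 x] g) (ξ : ModelFibre k) : Θ.deriv f x ξ = Θ.deriv g x ξ := by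
  rw [deriv, deriv, h.fderiv_eq]

/-! A distribution which in the chart at `m₀` is the model CR structure. -/

section InChart

variable {D : ∀ m : M, Submodule ℂ (CTangent I m)} {m₀ : M}
  (hD : ∀ m ∈ (extChartAt I m₀).source, ∀ w, w ∈ D m ↔
    Θ.coord m₀ m w ∈ modelKernel k 0 (Θ.map (extChartAt I m₀ m)).1)

include hD

omit [I.Boundaryless] in
lemma rep_mem {U : Set M} {X : CVectorField I M} (hX : IsSection D U X) {x : E}
    (hx : x ∈ chartSet I m₀ U) : Θ.rep m₀ X x ∈ modelKernel k 0 (Θ.map x).1 := by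
  have h := (hD _ ((extChartAt I m₀).map_target hx.1) _).1 (hX.2 _ hx.2)
  rwa [(extChartAt I m₀).right_inv hx.1] at h

omit [I.Boundaryless] in
lemma isSection_field {ξ : E → ModelFibre k} {W : Set E} (hξ : ContDiffOn ℝ ∞ ξ W)
    (hmem : ∀ x ∈ W, ξ x ∈ modelKernel k 0 (Θ.map x).1) {U : Set M}
    (hU : U ⊆ (extChartAt I m₀).source ∩ extChartAt I m₀ ⁻¹' W) :
    IsSection D U (Θ.field I m₀ ξ) := by
  refine ⟨Θ.smoothOn_field hξ hU, fun m hm => ?_⟩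
  rw [hD m (hU hm).1, Θ.coord_field (hU hm).1]
  exact hmem _ (hU hm).2

omit [IsManifold I ∞ M] [I.Boundaryless] hD in
lemma isSection_of_isKernelSection [IsManifold I ∞ M] {j : ℕ} {U : Set M} {X : CVectorField I M}
    (h : IsKernelSection D j U X) : IsSection D U X := by
  induction j with
  | zero => exact h
  | succ j ih => exact ih h.1

omit [IsManifold I ∞ M] [I.Boundaryless] hD in
lemma mem_chartSet_inter {U : Set M} {x : E} (hx : x ∈ chartSet I m₀ U) :
    x ∈ chartSet I m₀ (U ∩ (extChartAt I m₀).source) :=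
  ⟨hx.1, hx.2, (extChartAt I m₀).map_target hx.1⟩

/-- The iterated Levi kernels are contained in those of the model. -/
lemma rep_mem_of_isKernelSection (hk : 1 ≤ k) (j : ℕ) : ∀ (U : Set M) (X : CVectorField I M),
    IsOpen U → IsKernelSection D j U X → ∀ x ∈ chartSet I m₀ U,
      Θ.rep m₀ X x ∈ modelKernel k j (Θ.map x).1 := by
  induction j with
  | zero => exact fun U X _ hX x hx => Θ.rep_mem hD hX hx
  | succ j ih =>
    rintro U X hU ⟨hX, hXY⟩ x hx
    have hXs := isSection_of_isKernelSection hX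
    set W : Set M := U ∩ (extChartAt I m₀).source with hW
    have hWo : IsOpen W := hU.inter (isOpen_extChartAt_source m₀)
    have hxW : x ∈ chartSet I m₀ W := mem_chartSet_inter hx
    have hXd := Θ.differentiableAt_rep m₀ hU hXs.1 hx
    have hXm : ∀ᶠ y in 𝓝 x, Θ.rep m₀ X y ∈ modelKernel k j (Θ.map y).1 :=
      ((isOpen_chartSet m₀ hU).eventually_mem hx).mono fun y hy => ih U X hU hX y hy
    -- The defining property of the next kernel, evaluated at x against the i-th frame field. The
    -- frame exists only over the chart domain, which is why U was cut down to W.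
    have test : ∀ i : Fin (k + 1), ∃ ξ ∈ modelKernel k j (Θ.map x).1,
        ∃ η ∈ modelKernel k 0 (Θ.map x).1,
        Θ.deriv (fun y => conjFibre k (modelFrame k i (Θ.map y).1)) x (Θ.rep m₀ X x) -
          Θ.deriv (Θ.rep m₀ X) x (conjFibre k (modelFrame k i (Θ.map x).1)) =
            ξ + conjFibre k η := by
      intro i
      have hzc : ContDiff ℝ ∞ fun y => (Θ.map y).1 := Θ.map.contDiff.fst
      have hY : IsSection D W (Θ.field I m₀ fun y => modelFrame k i (Θ.map y).1) :=
        Θ.isSection_field hD (W := Set.univ) ((contDiff_modelFrame i).comp hzc).contDiffOn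
          (fun y _ => modelFrame_mem i _) (fun m hm => ⟨hm.2, trivial⟩)
      obtain ⟨X', Z, hX', hZ, hb⟩ := hXY W hWo Set.inter_subset_left _ hY
      refine ⟨_, ih W X' hWo hX' x hxW, _, Θ.rep_mem hD hZ hxW, ?_⟩
      have h1 := congrArg (Θ.coord m₀ _) (hb _ hxW.2)
      rw [map_add] at h1
      have h2 := Θ.rep_bracket m₀ hWo (hXs.1.mono Set.inter_subset_left) hY.1.conj hxW
      have h3 : Θ.rep m₀ (Θ.field I m₀ fun y => modelFrame k i (Θ.map y).1).conj =ᶠ[𝓝 x]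
          fun y => conjFibre k (modelFrame k i (Θ.map y).1) :=
        ((isOpen_extChartAt_target m₀).eventually_mem hx.1).mono fun y hy => by
          rw [rep_conj, Θ.rep_field hy]
      rw [Θ.deriv_congr h3, h3.self_of_nhds] at h2
      rw [← h2, ← rep_conj]
      exact h1
    -- The conjugate of the frame field of index 0 is the constant field ∂/∂z, whose bracket detects
    -- the next Taylor coefficient.
    have hord : taylorCoef (k + j + 1) (Θ.map x).1 (Θ.rep m₀ X x).2.2 = 0 := by
      obtain ⟨ξ, hξ, η, hη, hb⟩ := test 0
      refine Θ.taylorCoef_succ_eq_zero hXd hXm hξ hη ?_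
      rw [← hb]
      simp [modelFrame_zero, deriv_const, conjFibre_apply, tau_zero]
    have hmem := hXm.self_of_nhds
    refine ⟨hmem.1, fun _ => ?_, fun i hi => ?_⟩
    -- The dz̄ component has to be excluded only in the passage from the zeroth kernel to the first;
    -- afterwards verticality is inherited.
    · rcases Nat.eq_zero_or_pos j with rfl | hj
      · obtain ⟨ξ, hξ, η, hη, hb⟩ := test (Fin.succ ⟨0, hk⟩)
        exact Θ.vertical_of_bracket hk hXd hXm hξ hη hb
      · exact hmem.2.1 hj
    · rcases Nat.lt_succ_iff_lt_or_eq.1 hi with h | h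
      · exact hmem.2.2 i h
      · rw [h]; exact hord

/-- The iterated Levi kernels contain those of the model. -/
lemma isKernelSection_of_rep_mem (j : ℕ) : ∀ (U : Set M) (X : CVectorField I M),
    IsOpen U → U ⊆ (extChartAt I m₀).source → X.SmoothOn U →
    (∀ x ∈ chartSet I m₀ U, Θ.rep m₀ X x ∈ modelKernel k j (Θ.map x).1) →
      IsKernelSection D j U X := by
  have hmc : ∀ {U : Set M}, U ⊆ (extChartAt I m₀).source → ∀ m ∈ U,
      extChartAt I m₀ m ∈ chartSet I m₀ U := fun hU m hm =>
    ⟨(extChartAt I m₀).map_source (hU hm), by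
      rw [Set.mem_preimage, (extChartAt I m₀).left_inv (hU hm)]; exact hm⟩
  have hrep : ∀ {U : Set M}, U ⊆ (extChartAt I m₀).source → ∀ m ∈ U, ∀ X : CVectorField I M,
      Θ.rep m₀ X (extChartAt I m₀ m) = Θ.coord m₀ m (X.eval m) := fun hU m hm X => by
    rw [rep, (extChartAt I m₀).left_inv (hU hm)]
  induction j with
  | zero =>
    intro U X hU hUs hX hm
    refine ⟨hX, fun m hmU => (hD m (hUs hmU) _).2 ?_⟩
    rw [← hrep hUs m hmU]
    exact hm _ (hmc hUs m hmU)
  | succ j ih =>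
    intro U X hU hUs hX hm
    refine ⟨ih U X hU hUs hX fun x hx => modelKernel_succ_le j _ (hm x hx), ?_⟩
    intro W hW hWU Y hY
    have hWs : W ⊆ (extChartAt I m₀).source := hWU.trans hUs
    have hXW := hX.mono hWU
    have hWo := isOpen_chartSet (I := I) m₀ hW
    have hsub : W ⊆ (extChartAt I m₀).source ∩ extChartAt I m₀ ⁻¹' chartSet I m₀ W :=
      fun m hm => ⟨hWs hm, hmc hWs m hm⟩
    have hXr := Θ.contDiffOn_rep m₀ hXW
    have hYr := Θ.contDiffOn_rep m₀ hY.1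
    have hXc : ContDiffOn ℝ ∞ (fun x => conjFibre k (Θ.rep m₀ X x)) (chartSet I m₀ W) :=
      (conjFibre k).contDiff.comp_contDiffOn hXr
    have hYc : ContDiffOn ℝ ∞ (fun x => conjFibre k (Θ.rep m₀ Y x)) (chartSet I m₀ W) :=
      (conjFibre k).contDiff.comp_contDiffOn hYr
    have hXm : ∀ x ∈ chartSet I m₀ W, Θ.rep m₀ X x ∈ modelKernel k (j + 1) (Θ.map x).1 :=
      fun x hx => hm x ⟨hx.1, hWU hx.2⟩
    have hc1 := (Θ.contDiffOn_deriv hWo hXr hYc).neg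
    have hc2 := Θ.contDiffOn_deriv hWo hYr hXc
    -- The required decomposition is the bracket formula itself: -D_Ȳ X loses one order and lies in
    -- the j-th kernel, while D_X Ȳ is the conjugate of D_X̄ Y.
    refine ⟨Θ.field I m₀ fun x => -Θ.deriv (Θ.rep m₀ X) x (conjFibre k (Θ.rep m₀ Y x)),
      Θ.field I m₀ fun x => Θ.deriv (Θ.rep m₀ Y) x (conjFibre k (Θ.rep m₀ X x)), ?_, ?_, ?_⟩
    · refine ih W _ hW hWs (Θ.smoothOn_field hc1 hsub) fun x hx => ?_
      rw [Θ.rep_field hx.1]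
      exact Submodule.neg_mem _ (Θ.deriv_mem_pred (Θ.differentiableAt_rep m₀ hW hXW hx)
        ((hWo.eventually_mem hx).mono hXm) _)
    · refine Θ.isSection_field hD hc2 (fun x hx => ?_) hsub
      refine Θ.deriv_mem (Θ.differentiableAt_rep m₀ hW hY.1 hx)
        ((hWo.eventually_mem hx).mono fun y hy => Θ.rep_mem hD hY hy) ?_
      rw [conjFibre_apply]
      -- X is vertical, so X̄ has no dz component; this is what keeps D_X̄ Y in the distribution.
      simp only [(hXm x hx).2.1 (by omega), map_zero]
    · intro m hmW
      apply (Θ.coord_bijective (hWs hmW)).1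
      have hx := hmc hWs m hmW
      rw [map_add, CVectorField.eval_conj, coord_conj, Θ.coord_field (hWs hmW),
        Θ.coord_field (hWs hmW), ← hrep hWs m hmW, Θ.rep_bracket m₀ hW hXW hY.1.conj hx]
      have h1 : Θ.rep m₀ Y.conj = fun x => conjFibre k (Θ.rep m₀ Y x) :=
        funext fun x => Θ.rep_conj m₀ Y x
      rw [h1, Θ.deriv_conjFibre (Θ.differentiableAt_rep m₀ hW hY.1 hx)]
      abel

end InChart

end Smooth

end ModelCoframe

/-! ### CR structure and nondegeneracy for distributions equal to the model in charts -/

section Theorems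

variable [IsManifold I ∞ M] [I.Boundaryless] {D : ∀ m : M, Submodule ℂ (CTangent I m)}

/-- In every chart, the distribution `D` is the model CR structure with respect to a constant
coframe. -/
def IsModelled (k : ℕ) (D : ∀ m : M, Submodule ℂ (CTangent I m)) : Prop :=
  ∀ m₀ : M, ∃ Θ : ModelCoframe k E, ∀ m ∈ (extChartAt I m₀).source, ∀ w, w ∈ D m ↔
    Θ.coord m₀ m w ∈ modelKernel k 0 (Θ.map (extChartAt I m₀ m)).1

theorem isCRStructure_of_isModelled (hD : IsModelled k D) : IsCRStructure D (k + 1) 1 := by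
  have hconj : ∀ m : M, D m ⊓ conjSubmodule I m (D m) = ⊥ := by
    intro m
    obtain ⟨Θ, hΘ⟩ := hD m
    have hs := mem_extChartAt_source (I := I) m
    refine (Submodule.eq_bot_iff _).2 fun w hw => ?_
    have h1 := (hΘ m hs w).1 hw.1
    have h2 := (hΘ m hs _).1 hw.2
    rw [Θ.coord_conj] at h2
    exact (Θ.coord_bijective hs).1 (by rw [eq_zero_of_mem_of_conj_mem h1 h2, map_zero])
  refine ⟨fun m => ?_, hconj, fun m => ?_, ?_⟩
  · obtain ⟨Θ, hΘ⟩ := hD m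
    have hzc : ContDiff ℝ ∞ fun y => (Θ.map y).1 := Θ.map.contDiff.fst
    refine ⟨(extChartAt I m).source, isOpen_extChartAt_source m, mem_extChartAt_source m,
      fun i => Θ.field I m fun y => modelFrame k i (Θ.map y).1, fun i => ?_, fun x hx => ?_⟩
    · exact Θ.isSection_field hΘ (W := Set.univ) ((contDiff_modelFrame i).comp hzc).contDiffOn
          (fun y _ => modelFrame_mem i _) (fun m hm => ⟨hm, trivial⟩)
    · have h1 : (Θ.coord m x : CTangent I x →ₗ[ℂ] ModelFibre k) ∘ (fun i => (Θ.field I m fun y =>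
          modelFrame k i (Θ.map y).1).eval x) =
          fun i => modelFrame k i (Θ.map (extChartAt I m x)).1 :=
        funext fun i => Θ.coord_field hx _
      refine ⟨LinearIndependent.of_comp (Θ.coord m x) ?_, ?_⟩
      · rw [h1]
        exact linearIndependent_modelFrame _
      · apply Submodule.map_injective_of_injective (Θ.coord_bijective hx).1
        rw [Submodule.map_span, ← Set.range_comp, h1, span_modelFrame]
        have h2 : D x = (modelKernel k 0 (Θ.map (extChartAt I m x)).1).comap (Θ.coord m x) :=
          Submodule.ext fun w => hΘ x hx w
        rw [h2, Submodule.map_comap_eq_of_surjective (Θ.coord_bijective hx).2]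
  · obtain ⟨Θ, hΘ⟩ := hD m
    have hs := mem_extChartAt_source (I := I) m
    let e : CTangent I m ≃ₗ[ℂ] ModelFibre k := LinearEquiv.ofBijective _ (Θ.coord_bijective hs)
    have hfin : FiniteDimensional ℂ (CTangent I m) := e.symm.finiteDimensional
    have h1 : Module.finrank ℂ (CTangent I m) = 2 * k + 3 := by
      rw [e.finrank_eq]
      simp
      omega
    have h2 : Module.finrank ℂ (D m) = k + 1 := by
      have h : D m = (modelKernel k 0 (Θ.map (extChartAt I m m)).1).map e.symm.toLinearMap := by
        rw [Submodule.map_equiv_eq_comap_symm]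
        exact Submodule.ext fun w => hΘ m hs w
      rw [h, LinearEquiv.finrank_map_eq e.symm, finrank_modelKernel]
    have h3 : Module.finrank ℂ (conjSubmodule I m (D m)) = k + 1 := by
      have hcc : ∀ w, conjTangent I m (conjTangent I m w) = w := fun w => by
        apply (Θ.coord_bijective hs).1
        rw [Θ.coord_conj, Θ.coord_conj, conjFibre_conjFibre]
      let c : conjSubmodule I m (D m) ≃ₗ[ℝ] D m :=
        { toFun := fun w => ⟨conjTangent I m w.1, w.2⟩
          invFun := fun w => ⟨conjTangent I m w.1, by
            change conjTangent I m (conjTangent I m w.1) ∈ D m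
            rw [hcc]
            exact w.2⟩
          left_inv := fun w => Subtype.ext (hcc w.1)
          right_inv := fun w => Subtype.ext (hcc w.1)
          map_add' := fun a b => Subtype.ext (map_add _ _ _)
          map_smul' := fun r a => Subtype.ext (map_smul (conjTangent I m) r a.1) }
      -- Conjugation is antilinear, so the two complex dimensions are compared through their real
      -- doubles.
      have h4 := c.finrank_eq
      rw [← Module.finrank_mul_finrank ℝ ℂ (D m), h2,
        ← Module.finrank_mul_finrank ℝ ℂ (conjSubmodule I m (D m)),
        Complex.finrank_real_complex] at h4
      omega
    have h5 := Submodule.finrank_sup_add_finrank_inf_eq (D m) (conjSubmodule I m (D m))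
    rw [hconj m, finrank_bot, h2, h3] at h5
    have h6 := Submodule.finrank_quotient_add_finrank (D m ⊔ conjSubmodule I m (D m))
    omega
  · intro U hU X Y hX hY m hm
    obtain ⟨Θ, hΘ⟩ := hD m
    have hs := mem_extChartAt_source (I := I) m
    have hx : extChartAt I m m ∈ chartSet I m U :=
      ⟨mem_extChartAt_target m, by rw [Set.mem_preimage, extChartAt_to_inv]; exact hm⟩
    rw [hΘ m hs]
    have h1 := Θ.rep_bracket m hU hX.1 hY.1 hx
    have hev := (isOpen_chartSet (I := I) m hU).eventually_mem hx
    rw [ModelCoframe.rep, extChartAt_to_inv] at h1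
    rw [h1]
    exact Submodule.sub_mem _
      (Θ.deriv_mem (Θ.differentiableAt_rep m hU hY.1 hx)
        (hev.mono fun y hy => Θ.rep_mem hΘ hY hy) (Θ.rep_mem hΘ hX hx).1)
      (Θ.deriv_mem (Θ.differentiableAt_rep m hU hX.1 hx)
        (hev.mono fun y hy => Θ.rep_mem hΘ hX hy) (Θ.rep_mem hΘ hY hx).1)

theorem isNondegenerateAt_of_isModelled (hk : 1 ≤ k) (hD : IsModelled k D) (m : M) :
    IsNondegenerateAt D k m := by
  obtain ⟨Θ, hΘ⟩ := hD m
  have hs := mem_extChartAt_source (I := I) m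
  have hmem : ∀ (j : ℕ) (ξ : E → ModelFibre k), ContDiff ℝ ∞ ξ →
      (∀ x, ξ x ∈ modelKernel k j (Θ.map x).1) →
      (Θ.field I m ξ).eval m ∈ leviKernel D j m := by
    intro j ξ hξ h
    refine ⟨_, isOpen_extChartAt_source m, hs, Θ.field I m ξ, ?_, rfl⟩
    refine Θ.isKernelSection_of_rep_mem hΘ j _ _ (isOpen_extChartAt_source m) subset_rfl
      (Θ.smoothOn_field (W := Set.univ) hξ.contDiffOn fun x hx => ⟨hx, trivial⟩) fun x hx => ?_
    rw [Θ.rep_field hx.1]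
    exact h x
  have hz : ∀ j, (0 : CTangent I m) ∈ leviKernel D j m := by
    intro j
    have h := hmem j (fun _ => 0) contDiff_const fun x => Submodule.zero_mem _
    have h0 : (Θ.field I m fun _ => 0).eval m = 0 :=
      (Θ.coord_bijective hs).1 (by rw [Θ.coord_field hs, map_zero])
    rwa [h0] at h
  have hk0 : leviKernel D k m = {0} := by
    refine Set.Subset.antisymm ?_ (Set.singleton_subset_iff.2 (hz k))
    rintro w ⟨U, hU, hm, X, hX, rfl⟩
    have h := Θ.rep_mem_of_isKernelSection hΘ hk k U X hU hX (extChartAt I m m)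
      ⟨mem_extChartAt_target m, by rw [Set.mem_preimage, extChartAt_to_inv]; exact hm⟩
    rw [modelKernel_self_eq_bot hk, Submodule.mem_bot, ModelCoframe.rep, extChartAt_to_inv] at h
    exact (Θ.coord_bijective hs).1 (by rw [h, map_zero])
  refine ⟨hk, ?_, hk0⟩
  rw [hk0]
  refine ⟨Set.singleton_subset_iff.2 (hz _), fun hle => ?_⟩
  have hzc : ContDiff ℝ ∞ fun y => (Θ.map y).1 := Θ.map.contDiff.fst
  -- The last frame field, of index k - 1 among the vertical ones, is (w - ζz)^(2k). It lies in the
  -- (k-1)-st kernel and vanishes nowhere as a section.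
  have hc : ContDiff ℝ ∞ fun x =>
      modelFrame k (Fin.succ ⟨k - 1, Nat.sub_one_lt_of_lt hk⟩) (Θ.map x).1 :=
    (contDiff_modelFrame (k := k) (Fin.succ ⟨k - 1, Nat.sub_one_lt_of_lt hk⟩)).comp hzc
  have h := hle (hmem (k - 1) _ hc fun x => modelFrame_succ_mem _ le_rfl _)
  have h1 := congrArg (Θ.coord m m) (Set.mem_singleton_iff.1 h)
  rw [Θ.coord_field hs, map_zero] at h1
  exact (linearIndependent_modelFrame (Θ.map (extChartAt I m m)).1).ne_zero _ h1

end Theorems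

end Modelled

end CRGeom

end

noncomputable section

namespace CRGeom

/-! ### Dimension and irreducibility of the real form -/

section Irreducible

variable {k : ℕ}

instance : FiniteDimensional ℝ (Vtau k) :=
  FiniteDimensional.of_injective (coef k) coef_injective

/-- Applying `tau` to the equation conjugates i and fixes the real elements; half the sum and half
the difference separate the two parts. -/
lemma coef_add_I_smul_injective {p q p' q' : Vtau k}
    (h : coef k p + Complex.I • coef k q = coef k p' + Complex.I • coef k q') :
    p = p' ∧ q = q' := by
  have h' := congrArg tau h
  simp only [tau_add, tau_smul, tau_coef, Complex.conj_I] at h'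
  constructor
  · apply coef_injective
    funext j
    have h1 := congrFun h j
    have h2 := congrFun h' j
    simp only [Pi.add_apply, Pi.smul_apply, smul_eq_mul] at h1 h2
    linear_combination (1 / 2) * h1 + (1 / 2) * h2
  · apply coef_injective
    funext j
    have h1 := congrFun h j
    have h2 := congrFun h' j
    simp only [Pi.add_apply, Pi.smul_apply, smul_eq_mul] at h1 h2
    linear_combination (-Complex.I / 2) * h1 + (Complex.I / 2) * h2 +
      (coef k q j - coef k q' j) * Complex.I_sq

/-- The space of binary forms is the complexification of the real form. -/
def complexification (k : ℕ) : (Vtau k × Vtau k) ≃ₗ[ℝ] Coef k :=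
  LinearEquiv.ofBijective
    { toFun := fun p => coef k p.1 + Complex.I • coef k p.2
      map_add' := fun p q => by
        simp only [Prod.fst_add, Prod.snd_add, map_add, smul_add]; abel
      map_smul' := fun r p => by
        simp only [Prod.smul_fst, Prod.smul_snd, map_smul, smul_add, RingHom.id_apply]
        rw [smul_comm] }
    ⟨fun _ _ h => Prod.ext (coef_add_I_smul_injective h).1 (coef_add_I_smul_injective h).2,
      fun c => by
        obtain ⟨p, q, h⟩ := exists_real_imag c
        exact ⟨(p, q), h⟩⟩

theorem finrank_Vtau (k : ℕ) : Module.finrank ℝ (Vtau k) = 2 * k + 1 := by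
  have h := (complexification k).finrank_eq
  rw [Module.finrank_prod, Module.finrank_pi_fintype] at h
  simp only [Complex.finrank_real_complex, Finset.sum_const, Finset.card_univ, Fintype.card_fin,
    smul_eq_mul] at h
  omega

/-- The diagonal element with entries `e^{is}`, `e^{-is}` of `SU(2)`. -/
def diagonalElement (s : ℝ) : SU2 :=
  ⟨!![Complex.exp (s * Complex.I), 0; 0, Complex.exp (-(s * Complex.I))], by
    refine ⟨Matrix.mem_unitaryGroup_iff'.2 ?_, ?_⟩
    · ext i j
      fin_cases i <;> fin_cases j <;>
        simp [Matrix.mul_apply, Fin.sum_univ_two, Matrix.star_eq_conjTranspose,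
          ← Complex.exp_conj, ← Complex.exp_add]
    · simp [Matrix.det_fin_two, ← Complex.exp_add]⟩

lemma subst_diagonalElement (s : ℝ) (c : Coef k) : subst (diagonalElement s).1 c =
    fun j : Fin (2 * k + 1) => Complex.exp (2 * k * (s * Complex.I)) * Complex.exp (-(2 * (s * Complex.I))) ^ (j : ℕ)
      * c j := by
  apply form_injective
  funext x
  rw [form_subst, form_apply, form_apply]
  refine Finset.sum_congr rfl fun j _ => ?_
  have h0 : ((diagonalElement s).1 *ᵥ x) 0 = Complex.exp (s * Complex.I) * x 0 := by
    simp [diagonalElement, Matrix.mulVec, dotProduct, Fin.sum_univ_two]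
  have h1 : ((diagonalElement s).1 *ᵥ x) 1 = Complex.exp (-(s * Complex.I)) * x 1 := by
    simp [diagonalElement, Matrix.mulVec, dotProduct, Fin.sum_univ_two]
  have h2 : Complex.exp (s * Complex.I) ^ (2 * k - (j : ℕ)) *
      Complex.exp (-(s * Complex.I)) ^ (j : ℕ) =
      Complex.exp (2 * k * (s * Complex.I)) * Complex.exp (-(2 * (s * Complex.I))) ^ (j : ℕ) := by
    rw [← Complex.exp_nat_mul, ← Complex.exp_nat_mul, ← Complex.exp_nat_mul, ← Complex.exp_add,
      ← Complex.exp_add, Nat.cast_sub (by omega)]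
    congr 1
    push_cast
    ring
  rw [h0, h1, mul_pow, mul_pow, ← h2]
  ring

/-- A complex subspace which is invariant under the torus contains the monomials of its elements. -/
lemma single_mem_of_torus_invariant {U : Submodule ℂ (Coef k)}
    (hU : ∀ s : ℝ, ∀ c ∈ U, subst (diagonalElement s).1 c ∈ U) {c : Coef k} (hc : c ∈ U)
    {j : Fin (2 * k + 1)} (hj : c j ≠ 0) : (Pi.single j 1 : Coef k) ∈ U := by
  have hN : (2 * k + 1 : ℕ) ≠ 0 := by omega
  set w : ℂ := Complex.exp (2 * Real.pi * Complex.I / (2 * k + 1 : ℕ)) with hw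
  have hprim : IsPrimitiveRoot w (2 * k + 1) := Complex.isPrimitiveRoot_exp _ hN
  have hD : ∀ r : ℕ, (fun i : Fin (2 * k + 1) => (w ^ (i : ℕ)) ^ r * c i) ∈ U := by
    intro r
    -- With this angle the torus acts on the j-th coefficient by w^(rj), up to a common nonzero
    -- factor `a` that is divided out.
    have h := hU (-(r * Real.pi / (2 * k + 1 : ℕ))) c hc
    rw [subst_diagonalElement] at h
    set a : ℂ := Complex.exp (2 * k * (((-(r * Real.pi / (2 * k + 1 : ℕ)) : ℝ) : ℂ) * Complex.I))
    have hb : Complex.exp (-(2 * (((-(r * Real.pi / (2 * k + 1 : ℕ)) : ℝ) : ℂ) * Complex.I))) =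
        w ^ r := by
      rw [hw, ← Complex.exp_nat_mul]
      congr 1
      push_cast
      ring
    rw [hb] at h
    have h2 := U.smul_mem a⁻¹ h
    convert h2 using 1
    funext i
    have ha : a ≠ 0 := Complex.exp_ne_zero _
    simp only [Pi.smul_apply, smul_eq_mul]
    rw [← pow_mul, ← pow_mul, mul_comm r]
    field_simp
  -- Discrete Fourier inversion over the (2k+1)-st roots of unity: distinct indices have distinct
  -- characters, so only the j-th coefficient survives.
  have hsum : (∑ r ∈ Finset.range (2 * k + 1), (w⁻¹ ^ (j : ℕ)) ^ r •
      fun i : Fin (2 * k + 1) => (w ^ (i : ℕ)) ^ r * c i) ∈ U :=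
    Submodule.sum_mem _ fun r _ => U.smul_mem _ (hD r)
  have heq : (∑ r ∈ Finset.range (2 * k + 1), (w⁻¹ ^ (j : ℕ)) ^ r •
      fun i : Fin (2 * k + 1) => (w ^ (i : ℕ)) ^ r * c i) =
      (((2 * k + 1 : ℕ) : ℂ) * c j) • (Pi.single j 1 : Coef k) := by
    funext i
    have hw0 : w ≠ 0 := Complex.exp_ne_zero _
    simp only [Finset.sum_apply, Pi.smul_apply, smul_eq_mul, ← mul_assoc, ← Finset.sum_mul,
      ← mul_pow]
    by_cases hij : i = j
    · subst hij
      have h1 : w⁻¹ ^ (i : ℕ) * w ^ (i : ℕ) = 1 := by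
        rw [← mul_pow, inv_mul_cancel₀ hw0, one_pow]
      simp only [h1, one_pow, Finset.sum_const, Finset.card_range, nsmul_eq_mul, mul_one,
        Pi.single_eq_same]
    · rw [Pi.single_eq_of_ne hij, mul_zero]
      have hne : w⁻¹ ^ (j : ℕ) * w ^ (i : ℕ) ≠ 1 := by
        intro h
        apply hij
        have h1 : w ^ (i : ℕ) = w ^ (j : ℕ) := by
          rw [inv_pow] at h
          field_simp at h
          exact h
        exact Fin.ext (hprim.pow_inj i.2 j.2 h1)
      have hg := mul_geom_sum (w⁻¹ ^ (j : ℕ) * w ^ (i : ℕ)) (2 * k + 1)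
      have hp : (w⁻¹ ^ (j : ℕ) * w ^ (i : ℕ)) ^ (2 * k + 1) = 1 := by
        rw [mul_pow, ← pow_mul, ← pow_mul, mul_comm (j : ℕ), mul_comm (i : ℕ), pow_mul, pow_mul,
          inv_pow, hprim.pow_eq_one]
        simp
      rw [hp, sub_self] at hg
      rw [(mul_eq_zero.1 hg).resolve_left (sub_ne_zero.2 hne), zero_mul]
  rw [heq] at hsum
  have hne : (((2 * k + 1 : ℕ) : ℂ) * c j) ≠ 0 := mul_ne_zero (by exact_mod_cast hN) hj
  exact (Submodule.smul_mem_iff _ hne).1 hsum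

lemma form_single (j : Fin (2 * k + 1)) (x : Fin 2 → ℂ) :
    form k (Pi.single j 1) x = x 0 ^ (2 * k - (j : ℕ)) * x 1 ^ (j : ℕ) := by
  rw [form_apply, Finset.sum_eq_single j]
  · simp
  · intro i _ hi
    simp [Pi.single_eq_of_ne hi]
  · simp

/-- The space of binary forms is an irreducible complex representation of `SU(2)`. -/
lemma eq_top_of_invariant {U : Submodule ℂ (Coef k)}
    (hU : ∀ g : SU2, ∀ c ∈ U, subst g.1 c ∈ U) (h0 : U ≠ ⊥) : U = ⊤ := by
  have hmono : ∀ c ∈ U, ∀ j, c j ≠ 0 → (Pi.single j 1 : Coef k) ∈ U := fun c hc j hj =>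
    single_mem_of_torus_invariant (fun s => hU _) hc hj
  obtain ⟨c, hc, hc0⟩ := (Submodule.ne_bot_iff U).1 h0
  obtain ⟨j, hj⟩ := Function.ne_iff.1 hc0
  -- the rotation with all entries different from zero
  set g : SU2 := unitaryOf 1 with hg
  set s : ℂ := ((Real.sqrt (1 + Complex.normSq 1))⁻¹ : ℂ) with hs
  have hs0 : s ≠ 0 := by
    rw [hs]
    have : Real.sqrt (1 + Complex.normSq 1) ≠ 0 := by
      rw [map_one]
      positivity
    exact inv_ne_zero (by exact_mod_cast this)
  have hgx : ∀ t : ℂ, g.1 *ᵥ ![1, t] = ![s * (1 - t), s * (1 + t)] := by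
    intro t
    rw [hg, unitaryOf_apply]
    funext i
    fin_cases i <;> simp [Matrix.mulVec, dotProduct, Fin.sum_univ_two, hs] <;> ring
  -- The coefficient of index 0 is the value at t = 0. There the rotated monomial is a power of s
  -- and not zero, so the first monomial is reached from any other.
  have hz : (Pi.single 0 1 : Coef k) ∈ U := by
    refine hmono _ (hU g _ (hmono c hc j hj)) 0 ?_
    have h1 := poly_coeff (subst g.1 (Pi.single j 1 : Coef k)) 0
    rw [Fin.val_zero, Polynomial.coeff_zero_eq_eval_zero, poly_eval, form_subst, hgx,
      form_single] at h1
    rw [← h1]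
    simp [hs0]
  have hall : ∀ i, (Pi.single i 1 : Coef k) ∈ U := by
    intro i
    refine hmono _ (hU g _ hz) i ?_
    -- The rotated first monomial is (s(1 - t))^(2k), and no binomial coefficient vanishes, so every
    -- monomial is reached from it.
    have h1 : subst g.1 (Pi.single 0 1 : Coef k) = fun i : Fin (2 * k + 1) =>
        s ^ (2 * k) * ((-1) ^ (i : ℕ) * ((2 * k).choose i : ℂ)) := by
      refine eq_of_form_line fun t => ?_
      rw [form_subst, hgx, form_single, form_apply]
      simp only [Matrix.cons_val_zero, Matrix.cons_val_one, Fin.val_zero, pow_zero, mul_one,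
        Nat.sub_zero, one_pow, one_mul]
      rw [Fin.sum_univ_eq_sum_range (fun i : ℕ => s ^ (2 * k) * ((-1) ^ i *
        ((2 * k).choose i : ℂ)) * t ^ i) (2 * k + 1), mul_pow, sub_eq_neg_add, add_pow,
        Finset.mul_sum]
      refine Finset.sum_congr rfl fun i _ => ?_
      rw [neg_pow t, one_pow]
      ring
    rw [h1]
    refine mul_ne_zero (pow_ne_zero _ hs0) (mul_ne_zero (pow_ne_zero _ (by norm_num)) ?_)
    exact_mod_cast (Nat.choose_pos (by omega)).ne'
  refine (Submodule.eq_top_iff').2 fun d => ?_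
  have hd : d = ∑ i, d i • (Pi.single i 1 : Coef k) := by
    funext j
    simp [Finset.sum_apply, Pi.single_apply]
  rw [hd]
  exact Submodule.sum_mem _ fun i _ => U.smul_mem _ (hall i)

/-- W + iW is an invariant complex subspace of V, hence all of V if W is not zero. Uniqueness of
real parts brings this back to W. -/
theorem rho_irreducible (W : Submodule ℝ (Vtau k))
    (hW : ∀ g : SU2, ∀ v ∈ W, rho k g v ∈ W) : W = ⊥ ∨ W = ⊤ := by
  by_cases h0 : W = ⊥
  · exact Or.inl h0
  right
  let U : Submodule ℂ (Coef k) :=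
    { carrier := {c | ∃ p ∈ W, ∃ q ∈ W, coef k p + Complex.I • coef k q = c}
      add_mem' := by
        rintro _ _ ⟨p, hp, q, hq, rfl⟩ ⟨p', hp', q', hq', rfl⟩
        refine ⟨p + p', W.add_mem hp hp', q + q', W.add_mem hq hq', ?_⟩
        simp only [map_add, smul_add]
        abel
      zero_mem' := ⟨0, W.zero_mem, 0, W.zero_mem, by simp⟩
      smul_mem' := by
        rintro z _ ⟨p, hp, q, hq, rfl⟩
        refine ⟨z.re • p - z.im • q, W.sub_mem (W.smul_mem _ hp) (W.smul_mem _ hq),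
          z.im • p + z.re • q, W.add_mem (W.smul_mem _ hp) (W.smul_mem _ hq), ?_⟩
        simp only [map_sub, map_add, map_smul]
        funext j
        simp only [Pi.add_apply, Pi.sub_apply, Pi.smul_apply, smul_eq_mul, Complex.real_smul]
        conv_rhs => rw [← Complex.re_add_im z]
        linear_combination -(z.im * coef k q j) * Complex.I_sq }
  have hUinv : ∀ g : SU2, ∀ c ∈ U, subst g.1 c ∈ U := by
    rintro g _ ⟨p, hp, q, hq, rfl⟩
    refine ⟨rho k g⁻¹ p, hW _ _ hp, rho k g⁻¹ q, hW _ _ hq, ?_⟩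
    rw [coef_rho, coef_rho, inv_inv, map_add, map_smul]
  obtain ⟨v, hv, hv0⟩ := (Submodule.ne_bot_iff W).1 h0
  have hU0 : U ≠ ⊥ := by
    refine (Submodule.ne_bot_iff U).2 ⟨coef k v, ⟨v, hv, 0, W.zero_mem, by simp⟩, fun h => ?_⟩
    exact hv0 (coef_injective (by rw [h, map_zero]))
  have hUt := eq_top_of_invariant hUinv hU0
  refine (Submodule.eq_top_iff').2 fun v => ?_
  have hvU : coef k v ∈ U := hUt ▸ Submodule.mem_top
  obtain ⟨p, hp, q, hq, h⟩ := hvU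
  have h2 : coef k p + Complex.I • coef k q = coef k v + Complex.I • coef k 0 := by
    rw [h]; simp
  rw [← (coef_add_I_smul_injective h2).1]
  exact hp

end Irreducible

end CRGeom

end

noncomputable section

namespace CRGeom

open Topology

/-! ### Transfer of smooth structures along homeomorphisms -/

section Transfer

variable {E H : Type*} [NormedAddCommGroup E] [NormedSpace ℝ E] [TopologicalSpace H]
  (I : ModelWithCorners ℝ E H) {M N : Type*} [TopologicalSpace M] [TopologicalSpace N]
  [ChartedSpace H N]

/-- The charts of `N`, composed with a homeomorphism from `M` to `N`. -/
abbrev transferCharts (H : Type*) [TopologicalSpace H] {M N : Type*} [TopologicalSpace M]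
    [TopologicalSpace N] [ChartedSpace H N] (f : M ≃ₜ N) : ChartedSpace H M where
  atlas := {e | ∃ e' ∈ atlas H N, e = f.toOpenPartialHomeomorph ≫ₕ e'}
  chartAt m := f.toOpenPartialHomeomorph ≫ₕ chartAt H (f m)
  mem_chart_source m := by simp
  chart_mem_atlas m := ⟨_, chart_mem_atlas H (f m), rfl⟩

lemma isManifold_transfer (f : M ≃ₜ N) [IsManifold I ∞ N] :
    letI := transferCharts H f
    IsManifold I ∞ M := by
  let _ := transferCharts H f
  have hg : HasGroupoid M (contDiffGroupoid ∞ I) := by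
    refine ⟨?_⟩
    rintro _ _ ⟨e, he, rfl⟩ ⟨e', he', rfl⟩
    -- The homeomorphism cancels in a change of charts, so the transition maps are those of N.
    have h : (f.toOpenPartialHomeomorph ≫ₕ e).symm ≫ₕ f.toOpenPartialHomeomorph ≫ₕ e' =
        e.symm ≫ₕ e' := by
      refine OpenPartialHomeomorph.ext _ _ (fun x => by simp) (fun x => by simp) ?_
      ext x
      simp
    rw [h]
    exact HasGroupoid.compatible he he'
  exact IsManifold.mk' I ∞ M

lemma contMDiff_transfer (f : M ≃ₜ N) [IsManifold I ∞ N] :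
    letI := transferCharts H f
    ContMDiff I I ∞ f ∧ ContMDiff I I ∞ f.symm := by
  let _ := transferCharts H f
  have := isManifold_transfer I f
  have hsymm : ∀ m : M, ∀ x, (chartAt H m).symm x = f.symm ((chartAt H (f m)).symm x) :=
    fun m x => rfl
  have happ : ∀ m : M, ∀ x, chartAt H m x = chartAt H (f m) (f x) := fun m x => rfl
  constructor
  · intro m
    have h1 : ContMDiffAt I I ∞ (chartAt H m) m :=
      contMDiffAt_of_mem_maximalAtlas (IsManifold.chart_mem_maximalAtlas m) (mem_chart_source H m)
    have h2 : ContMDiffAt I I ∞ (chartAt H (f m)).symm (chartAt H m m) :=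
      contMDiffAt_symm_of_mem_maximalAtlas (IsManifold.chart_mem_maximalAtlas (f m))
        (by rw [happ]; exact mem_chart_target H (f m))
    refine (h2.comp m h1).congr_of_eventuallyEq ?_
    filter_upwards [(chartAt H m).open_source.eventually_mem (mem_chart_source H m)] with x hx
    rw [Function.comp_apply, happ, (chartAt H (f m)).left_inv]
    have hx' : x ∈ (f.toOpenPartialHomeomorph ≫ₕ chartAt H (f m)).source := hx
    simpa using hx'
  · intro n
    obtain ⟨m, rfl⟩ := f.surjective n
    have h1 : ContMDiffAt I I ∞ (chartAt H (f m)) (f m) :=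
      contMDiffAt_of_mem_maximalAtlas (IsManifold.chart_mem_maximalAtlas _) (mem_chart_source H _)
    have h2 : ContMDiffAt I I ∞ (chartAt H m).symm (chartAt H (f m) (f m)) :=
      contMDiffAt_symm_of_mem_maximalAtlas (IsManifold.chart_mem_maximalAtlas m)
        (by rw [← happ]; exact mem_chart_target H m)
    refine (h2.comp (f m) h1).congr_of_eventuallyEq ?_
    filter_upwards [(chartAt H (f m)).open_source.eventually_mem (mem_chart_source H (f m))]
      with x hx
    rw [Function.comp_apply, hsymm, (chartAt H (f m)).left_inv hx]

end Transfer

/-! ### The smooth structure of `SU(2)` -/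

lemma SU2.apply_one_one (g : SU2) : g.1 1 1 = starRingEnd ℂ (g.1 0 0) := by
  have h := congrFun (SU2.mulVec_quatJ g ![1, 0]) 1
  simpa [quatJ, Matrix.mulVec, dotProduct, Fin.sum_univ_two] using h

lemma SU2.apply_zero_one (g : SU2) : g.1 0 1 = -starRingEnd ℂ (g.1 1 0) := by
  have h := congrFun (SU2.mulVec_quatJ g ![1, 0]) 0
  simpa [quatJ, Matrix.mulVec, dotProduct, Fin.sum_univ_two] using h

lemma SU2.normSq_add (g : SU2) : Complex.normSq (g.1 0 0) + Complex.normSq (g.1 1 0) = 1 := by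
  have h : g.1.det = 1 := g.2.2
  rw [Matrix.det_fin_two, g.apply_one_one, g.apply_zero_one] at h
  have h2 : ((Complex.normSq (g.1 0 0) + Complex.normSq (g.1 1 0) : ℝ) : ℂ) = 1 := by
    push_cast
    rw [← Complex.mul_conj, ← Complex.mul_conj]
    linear_combination h
  exact_mod_cast h2

/-- The element of `SU(2)` with a given first column. -/
def SU2.ofCol (a b : ℂ) (h : Complex.normSq a + Complex.normSq b = 1) : SU2 :=
  ⟨!![a, -starRingEnd ℂ b; b, starRingEnd ℂ a], by
    have h2 : a * starRingEnd ℂ a + b * starRingEnd ℂ b = 1 := by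
      rw [Complex.mul_conj, Complex.mul_conj]
      exact_mod_cast h
    refine ⟨Matrix.mem_unitaryGroup_iff'.2 ?_, ?_⟩
    · ext i j
      fin_cases i <;> fin_cases j <;>
        simp [Matrix.mul_apply, Fin.sum_univ_two, Matrix.star_eq_conjTranspose]
      · linear_combination h2
      · ring
      · ring
      · linear_combination h2
    · simp [Matrix.det_fin_two]
      linear_combination h2⟩

lemma SU2.ext_col {g h : SU2} (h0 : g.1 0 0 = h.1 0 0) (h1 : g.1 1 0 = h.1 1 0) : g = h := by
  apply Subtype.ext
  ext i j
  fin_cases i <;> fin_cases j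
  · exact h0
  · exact (g.apply_zero_one).trans ((congrArg _ (congrArg _ h1)).trans h.apply_zero_one.symm)
  · exact h1
  · exact (g.apply_one_one).trans ((congrArg _ h0).trans h.apply_one_one.symm)

instance : Fact (Module.finrank ℝ (EuclideanSpace ℝ (Fin 4)) = 3 + 1) := ⟨by simp⟩

/-- The three-dimensional sphere. -/
abbrev Sphere3 : Type := Metric.sphere (0 : EuclideanSpace ℝ (Fin 4)) 1

/-- Pairs of complex numbers as vectors in `ℝ⁴`. -/
def toR4 : ℂ × ℂ →L[ℝ] EuclideanSpace ℝ (Fin 4) :=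
  LinearMap.toContinuousLinearMap
    { toFun := fun p => !₂[p.1.re, p.1.im, p.2.re, p.2.im]
      map_add' := fun p q => by ext i; fin_cases i <;> simp
      map_smul' := fun r p => by ext i; fin_cases i <;> simp }

lemma toR4_apply (p : ℂ × ℂ) : toR4 p = !₂[p.1.re, p.1.im, p.2.re, p.2.im] := rfl

lemma toR4_mem_sphere {a b : ℂ} (h : Complex.normSq a + Complex.normSq b = 1) :
    toR4 (a, b) ∈ Metric.sphere (0 : EuclideanSpace ℝ (Fin 4)) 1 := by
  rw [mem_sphere_zero_iff_norm, EuclideanSpace.norm_eq, Real.sqrt_eq_one]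
  rw [Complex.normSq_apply, Complex.normSq_apply] at h
  simp [toR4_apply, Fin.sum_univ_four]
  linarith

/-- `SU(2)` is a three-dimensional sphere. -/
def SU2.homeoSphere : SU2 ≃ₜ Sphere3 where
  toFun g := ⟨toR4 (g.1 0 0, g.1 1 0), toR4_mem_sphere g.normSq_add⟩
  invFun x := SU2.ofCol ⟨x.1 0, x.1 1⟩ ⟨x.1 2, x.1 3⟩ (by
    have h := mem_sphere_zero_iff_norm.1 x.2
    rw [EuclideanSpace.norm_eq, Real.sqrt_eq_one] at h
    simp [Fin.sum_univ_four] at h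
    rw [Complex.normSq_apply, Complex.normSq_apply]
    simp only
    linarith)
  left_inv g := SU2.ext_col rfl rfl
  right_inv x := by
    apply Subtype.ext
    ext i
    fin_cases i <;> simp [toR4_apply, SU2.ofCol]
  continuous_toFun := by
    refine Continuous.subtype_mk (toR4.continuous.comp ?_) _
    exact (continuous_subtype_val.matrix_elem 0 0).prodMk (continuous_subtype_val.matrix_elem 1 0)
  continuous_invFun := by
    have hc : ∀ i, Continuous fun x : Sphere3 => x.1 i := fun i =>
      (EuclideanSpace.proj (𝕜 := ℝ) i).continuous.comp continuous_subtype_val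
    have hm : ∀ i j, Continuous fun x : Sphere3 => (⟨x.1 i, x.1 j⟩ : ℂ) := fun i j => by
      have : (fun x : Sphere3 => (⟨x.1 i, x.1 j⟩ : ℂ)) =
          fun x => (x.1 i : ℂ) + (x.1 j : ℂ) * Complex.I := by
        funext x
        exact (Complex.re_add_im (⟨x.1 i, x.1 j⟩ : ℂ)).symm
      rw [this]
      exact (Complex.continuous_ofReal.comp (hc i)).add
        ((Complex.continuous_ofReal.comp (hc j)).mul continuous_const)
    refine Continuous.subtype_mk (continuous_matrix fun i j => ?_) _
    fin_cases i <;> fin_cases j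
    · exact hm 0 1
    · exact (Complex.continuous_conj.comp (hm 2 3)).neg
    · exact hm 2 3
    · exact Complex.continuous_conj.comp (hm 0 1)

instance : ChartedSpace (EuclideanSpace ℝ (Fin 3)) SU2 := transferCharts _ SU2.homeoSphere

instance : IsManifold (𝓡 3) ∞ SU2 := isManifold_transfer _ SU2.homeoSphere

lemma SU2.contMDiff_apply (i j : Fin 2) :
    ContMDiff (𝓡 3) 𝓘(ℝ, ℂ) ∞ fun g : SU2 => g.1 i j := by
  have h0 : ContMDiff (𝓡 3) 𝓘(ℝ, EuclideanSpace ℝ (Fin 4)) ∞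
      fun g : SU2 => (SU2.homeoSphere g : EuclideanSpace ℝ (Fin 4)) :=
    (contMDiff_coe_sphere (n := 3)).comp (contMDiff_transfer (𝓡 3) SU2.homeoSphere).1
  have hc : ∀ i, ContMDiff (𝓡 3) 𝓘(ℝ, ℝ) ∞ fun g : SU2 =>
      (SU2.homeoSphere g : EuclideanSpace ℝ (Fin 4)) i := fun i =>
    (EuclideanSpace.proj (𝕜 := ℝ) i).contMDiff.comp h0
  have hl : ContDiff ℝ ∞ fun p : ℝ × ℝ => (p.1 : ℂ) + (p.2 : ℂ) * Complex.I :=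
    (Complex.ofRealCLM.contDiff.comp contDiff_fst).add
      ((Complex.ofRealCLM.contDiff.comp contDiff_snd).mul contDiff_const)
  have ha : ContMDiff (𝓡 3) 𝓘(ℝ, ℂ) ∞ fun g : SU2 => g.1 0 0 :=
    (hl.contMDiff.comp ((hc 0).prodMk_space (hc 1))).congr fun g =>
      (Complex.re_add_im (g.1 0 0)).symm
  have hb : ContMDiff (𝓡 3) 𝓘(ℝ, ℂ) ∞ fun g : SU2 => g.1 1 0 :=
    (hl.contMDiff.comp ((hc 2).prodMk_space (hc 3))).congr fun g =>
      (Complex.re_add_im (g.1 1 0)).symm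
  have hconj : ContMDiff 𝓘(ℝ, ℂ) 𝓘(ℝ, ℂ) ∞ (starRingEnd ℂ) := Complex.conjCLE.contDiff.contMDiff
  fin_cases i <;> fin_cases j
  · exact ha
  · have hneg : ContMDiff 𝓘(ℝ, ℂ) 𝓘(ℝ, ℂ) ∞ fun z => -starRingEnd ℂ z :=
      Complex.conjCLE.contDiff.neg.contMDiff
    exact (hneg.comp hb).congr fun g => g.apply_zero_one
  · exact hb
  · exact (hconj.comp ha).congr fun g => g.apply_one_one

section IntoSU2

variable {E H : Type*} [NormedAddCommGroup E] [NormedSpace ℝ E] [TopologicalSpace H]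
  {I : ModelWithCorners ℝ E H} {M : Type*} [TopologicalSpace M] [ChartedSpace H M]
  [IsManifold I ∞ M]

/-- The first column embeds SU(2) as the unit sphere of ℂ², and maps into the sphere are smooth as
soon as they are smooth into ℝ⁴. -/
lemma SU2.contMDiff_of_col {f : M → SU2} (h0 : ContMDiff I 𝓘(ℝ, ℂ) ∞ fun x => (f x).1 0 0)
    (h1 : ContMDiff I 𝓘(ℝ, ℂ) ∞ fun x => (f x).1 1 0) : ContMDiff I (𝓡 3) ∞ f := by
  have h2 : ContMDiff I 𝓘(ℝ, EuclideanSpace ℝ (Fin 4)) ∞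
      fun x => toR4 ((f x).1 0 0, (f x).1 1 0) :=
    toR4.contMDiff.comp (h0.prodMk_space h1)
  have h3 := ContMDiff.codRestrict_sphere (n := 3) h2 fun x => toR4_mem_sphere (f x).normSq_add
  exact ((contMDiff_transfer (𝓡 3) SU2.homeoSphere).2.comp h3).congr fun x =>
    (SU2.homeoSphere.symm_apply_apply (f x)).symm

lemma SU2.contMDiff_mul {f g : M → SU2} (hf : ContMDiff I (𝓡 3) ∞ f)
    (hg : ContMDiff I (𝓡 3) ∞ g) : ContMDiff I (𝓡 3) ∞ fun x => f x * g x := by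
  have h : ∀ i j, ContMDiff I 𝓘(ℝ, ℂ) ∞ fun x => (f x * g x).1 i j := fun i j => by
    have e : (fun x => (f x * g x).1 i j) =
        fun x => (f x).1 i 0 * (g x).1 0 j + (f x).1 i 1 * (g x).1 1 j := by
      funext x
      rw [Submonoid.coe_mul, Matrix.mul_apply, Fin.sum_univ_two]
    rw [e]
    have hp : ContDiff ℝ ∞ fun p : (ℂ × ℂ) × (ℂ × ℂ) => p.1.1 * p.1.2 + p.2.1 * p.2.2 := by
      fun_prop
    exact hp.contMDiff.comp ((((SU2.contMDiff_apply i 0).comp hf).prodMk_space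
      ((SU2.contMDiff_apply 0 j).comp hg)).prodMk_space
      (((SU2.contMDiff_apply i 1).comp hf).prodMk_space ((SU2.contMDiff_apply 1 j).comp hg)))
  exact SU2.contMDiff_of_col (h 0 0) (h 1 0)

lemma SU2.contMDiff_inv {f : M → SU2} (hf : ContMDiff I (𝓡 3) ∞ f) :
    ContMDiff I (𝓡 3) ∞ fun x => (f x)⁻¹ := by
  have hconj : ContMDiff 𝓘(ℝ, ℂ) 𝓘(ℝ, ℂ) ∞ (starRingEnd ℂ) := Complex.conjCLE.contDiff.contMDiff
  exact SU2.contMDiff_of_col (hconj.comp ((SU2.contMDiff_apply 0 0).comp hf))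
    (hconj.comp ((SU2.contMDiff_apply 0 1).comp hf))

end IntoSU2

end CRGeom

end

noncomputable section

namespace CRGeom

open Topology

/-! ### The smooth structure of the complex projective line -/

/-- `ℂ` as the Euclidean plane. -/
def toE2 : ℂ ≃L[ℝ] EuclideanSpace ℝ (Fin 2) :=
  Complex.orthonormalBasisOneI.repr.toContinuousLinearEquiv

lemma contDiffAt_div {a b : ℂ} (hb : b ≠ 0) :
    ContDiffAt ℝ ∞ (fun p : ℂ × ℂ => p.1 / p.2) (a, b) := by
  simp only [div_eq_mul_inv]
  exact contDiffAt_fst.mul (contDiffAt_snd.inv hb)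

namespace CP1

/-- The point of the projective line with given homogeneous coordinates. -/
def mk (v : Fin 2 → ℂ) (hv : v ≠ 0) : CP1 := Projectivization.mk ℂ v hv

lemma mk_eq_mk {v w : Fin 2 → ℂ} {hv : v ≠ 0} {hw : w ≠ 0} {a : ℂ} (h : v = a • w) :
    mk v hv = mk w hw :=
  (Projectivization.mk_eq_mk_iff' ℂ v w hv hw).2 ⟨a, h.symm⟩

lemma ind {P : CP1 → Prop} (h : ∀ v hv, P (mk v hv)) (p : CP1) : P p :=
  Projectivization.ind h p

lemma isQuotientMap_mk :
    IsQuotientMap fun v : {v : Fin 2 → ℂ // v ≠ 0} => mk v.1 v.2 :=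
  isQuotientMap_quot_mk

/-- The coordinates of `v` in the unitary basis given by the columns of `h`. -/
def coord (h : SU2) (v : Fin 2 → ℂ) : Fin 2 → ℂ := (h⁻¹ : SU2).1 *ᵥ v

lemma coord_smul (h : SU2) (a : ℂ) (v : Fin 2 → ℂ) : coord h (a • v) = a • coord h v :=
  Matrix.mulVec_smul _ _ _

lemma continuous_coord (h : SU2) (i : Fin 2) : Continuous fun v => coord h v i :=
  (continuous_apply i).comp (Continuous.matrix_mulVec continuous_const continuous_id)

lemma coord_mulVec (h g : SU2) (v : Fin 2 → ℂ) : coord h (g.1 *ᵥ v) = (h⁻¹ * g).1 *ᵥ v := by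
  rw [coord, Matrix.mulVec_mulVec]
  rfl

lemma mulVec_coord (h : SU2) (v : Fin 2 → ℂ) : h.1 *ᵥ coord h v = v := by
  rw [coord, Matrix.mulVec_mulVec]
  change (h * h⁻¹ : SU2).1 *ᵥ v = v
  rw [mul_inv_cancel]
  exact Matrix.one_mulVec v

lemma smul_of_eq {v w : {v : Fin 2 → ℂ // v ≠ 0}} {t : ℂ} (hvw : (v : Fin 2 → ℂ) = t • w.1) :
    t ≠ 0 := by
  rintro rfl
  exact v.2 (by rw [hvw, zero_smul])

/-- The affine chart domain centred at `h · [e₁]`. -/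
def affine (h : SU2) : Set CP1 :=
  {p | Projectivization.lift (fun v => coord h v.1 0 ≠ 0) (fun v w t hvw => by
    have ht := smul_of_eq hvw
    simp only [hvw, coord_smul, Pi.smul_apply, smul_eq_mul, ne_eq, mul_eq_zero, ht, false_or]) p}

lemma mk_mem_affine {h : SU2} {v : Fin 2 → ℂ} {hv : v ≠ 0} :
    mk v hv ∈ affine h ↔ coord h v 0 ≠ 0 := Iff.rfl

/-- The affine coordinate centred at `h · [e₁]`. -/
def ratio (h : SU2) (p : CP1) : ℂ :=
  Projectivization.lift (fun v => coord h v.1 1 / coord h v.1 0) (fun v w t hvw => by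
    have ht := smul_of_eq hvw
    simp only [hvw, coord_smul, Pi.smul_apply, smul_eq_mul]
    exact mul_div_mul_left _ _ ht) p

lemma ratio_mk (h : SU2) (v : Fin 2 → ℂ) (hv : v ≠ 0) :
    ratio h (mk v hv) = coord h v 1 / coord h v 0 := rfl

lemma isOpen_affine (h : SU2) : IsOpen (affine h) := by
  rw [← isQuotientMap_mk.isOpen_preimage]
  exact isOpen_ne_fun ((continuous_coord h 0).comp continuous_subtype_val) continuous_const

lemma continuousOn_ratio (h : SU2) : ContinuousOn (ratio h) (affine h) := by
  refine (isQuotientMap_mk.continuousOn_isOpen_iff (g := ratio h) (isOpen_affine h)).2 ?_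
  change ContinuousOn (fun v : {v : Fin 2 → ℂ // v ≠ 0} => coord h v.1 1 / coord h v.1 0) _
  have hc : ∀ i, Continuous fun v : {v : Fin 2 → ℂ // v ≠ 0} => coord h v.1 i := fun i =>
    (continuous_coord h i).comp continuous_subtype_val
  exact (hc 1).continuousOn.div (hc 0).continuousOn fun v hv => hv

lemma mulVec_affine_ne_zero (h : SU2) (ζ : ℂ) : h.1 *ᵥ ![1, ζ] ≠ 0 := by
  intro h0
  have h1 := congrArg (coord h) h0
  rw [coord_mulVec, inv_mul_cancel] at h1
  simpa [coord] using congrFun h1 0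

/-- The point with affine coordinate `ζ`. -/
def ofRatio (h : SU2) (ζ : ℂ) : CP1 := mk (h.1 *ᵥ ![1, ζ]) (mulVec_affine_ne_zero h ζ)

lemma coord_affine (h h' : SU2) (ζ : ℂ) (i : Fin 2) :
    coord h' (h.1 *ᵥ ![1, ζ]) i = (h'⁻¹ * h).1 i 0 + (h'⁻¹ * h).1 i 1 * ζ := by
  rw [coord_mulVec]
  simp [Matrix.mulVec, dotProduct, Fin.sum_univ_two]

lemma ofRatio_mem_affine {h h' : SU2} {ζ : ℂ} : ofRatio h ζ ∈ affine h' ↔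
    (h'⁻¹ * h).1 0 0 + (h'⁻¹ * h).1 0 1 * ζ ≠ 0 := by
  rw [ofRatio, mk_mem_affine, coord_affine]

lemma ratio_ofRatio_of (h h' : SU2) (ζ : ℂ) : ratio h' (ofRatio h ζ) =
    ((h'⁻¹ * h).1 1 0 + (h'⁻¹ * h).1 1 1 * ζ) / ((h'⁻¹ * h).1 0 0 + (h'⁻¹ * h).1 0 1 * ζ) := by
  rw [ofRatio, ratio_mk, coord_affine, coord_affine]

lemma ofRatio_mem (h : SU2) (ζ : ℂ) : ofRatio h ζ ∈ affine h := by
  rw [ofRatio_mem_affine, inv_mul_cancel]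
  simp

lemma ratio_ofRatio (h : SU2) (ζ : ℂ) : ratio h (ofRatio h ζ) = ζ := by
  rw [ratio_ofRatio_of, inv_mul_cancel]
  simp

lemma ofRatio_ratio {h : SU2} {p : CP1} (hp : p ∈ affine h) : ofRatio h (ratio h p) = p := by
  induction p using ind with
  | h v hv =>
    rw [mk_mem_affine] at hp
    refine mk_eq_mk (a := (coord h v 0)⁻¹) ?_
    have h1 : ![1, ratio h (mk v hv)] = (coord h v 0)⁻¹ • coord h v := by
      funext i
      fin_cases i
      · simp [hp]
      · simp [ratio_mk, div_eq_inv_mul]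
    rw [h1, Matrix.mulVec_smul, mulVec_coord]

lemma continuous_ofRatio (h : SU2) : Continuous (ofRatio h) := by
  refine isQuotientMap_mk.continuous.comp (f := fun ζ : ℂ =>
    (⟨h.1 *ᵥ ![1, ζ], mulVec_affine_ne_zero h ζ⟩ : {v : Fin 2 → ℂ // v ≠ 0})) ?_
  refine Continuous.subtype_mk (Continuous.matrix_mulVec continuous_const ?_) _
  refine continuous_pi fun i => ?_
  fin_cases i
  · exact continuous_const
  · exact continuous_id

/-- The affine chart centred at `h · [e₁]`. -/
def chart (h : SU2) : OpenPartialHomeomorph CP1 (EuclideanSpace ℝ (Fin 2)) where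
  toFun p := toE2 (ratio h p)
  invFun x := ofRatio h (toE2.symm x)
  source := affine h
  target := Set.univ
  map_source' _ _ := Set.mem_univ _
  map_target' _ _ := ofRatio_mem _ _
  left_inv' p hp := by
    rw [toE2.symm_apply_apply, ofRatio_ratio hp]
  right_inv' x _ := by
    rw [ratio_ofRatio, toE2.apply_symm_apply]
  open_source := isOpen_affine h
  open_target := isOpen_univ
  continuousOn_toFun := toE2.continuous.comp_continuousOn (continuousOn_ratio h)
  continuousOn_invFun := ((continuous_ofRatio h).comp toE2.symm.continuous).continuousOn

lemma line_eq_ofRatio (h : SU2) : h.line = ofRatio h 0 := rfl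

lemma mem_affine_of_line_eq {h : SU2} {p : CP1} (hp : h.line = p) : p ∈ affine h :=
  hp ▸ ofRatio_mem h 0

lemma line_mem_affine_iff {g h : SU2} : g.line ∈ affine h ↔ (h⁻¹ * g).1 0 0 ≠ 0 := by
  rw [line_eq_ofRatio, ofRatio_mem_affine, mul_zero, add_zero]

lemma ratio_line (g h : SU2) : ratio h g.line = (h⁻¹ * g).1 1 0 / (h⁻¹ * g).1 0 0 := by
  rw [line_eq_ofRatio, ratio_ofRatio_of, mul_zero, mul_zero, add_zero, add_zero]

lemma line_surjective : Function.Surjective SU2.line := by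
  intro p
  induction p using ind with
  | h v hv =>
    have hs : 0 < Complex.normSq (v 0) + Complex.normSq (v 1) := by
      by_contra hle
      have h0 := Complex.normSq_nonneg (v 0)
      have h1 := Complex.normSq_nonneg (v 1)
      have e0 : Complex.normSq (v 0) = 0 := by linarith
      have e1 : Complex.normSq (v 1) = 0 := by linarith
      refine hv (funext fun i => ?_)
      fin_cases i
      · exact Complex.normSq_eq_zero.1 e0
      · exact Complex.normSq_eq_zero.1 e1
    set r := Real.sqrt (Complex.normSq (v 0) + Complex.normSq (v 1)) with hr
    have hr0 : r ≠ 0 := (Real.sqrt_pos.2 hs).ne'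
    have hrr : r * r = Complex.normSq (v 0) + Complex.normSq (v 1) := Real.mul_self_sqrt hs.le
    refine ⟨SU2.ofCol ((r : ℂ)⁻¹ * v 0) ((r : ℂ)⁻¹ * v 1) ?_, ?_⟩
    · rw [Complex.normSq_mul, Complex.normSq_mul, ← mul_add, ← hrr, Complex.normSq_inv, Complex.normSq_ofReal]
      field_simp
    · refine mk_eq_mk (a := (r : ℂ)⁻¹) ?_
      funext i
      fin_cases i <;> simp [SU2.ofCol, Matrix.mulVec, dotProduct, Fin.sum_univ_two]

/-- An element of `SU(2)` moving `[e₁]` to `p`. -/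
def frame (p : CP1) : SU2 := (line_surjective p).choose

lemma line_frame (p : CP1) : (frame p).line = p := (line_surjective p).choose_spec

lemma mem_affine_frame (p : CP1) : p ∈ affine (frame p) := mem_affine_of_line_eq (line_frame p)

instance : ChartedSpace (EuclideanSpace ℝ (Fin 2)) CP1 where
  atlas := Set.range chart
  chartAt p := chart (frame p)
  mem_chart_source p := mem_affine_frame p
  chart_mem_atlas _ := ⟨_, rfl⟩

instance : IsManifold (𝓡 2) ∞ CP1 := by
  refine isManifold_of_contDiffOn _ _ _ ?_
  rintro _ _ ⟨h, rfl⟩ ⟨h', rfl⟩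
  -- The transition between two affine charts is the Möbius map of h'⁻¹ h, smooth wherever its
  -- denominator is not zero.
  have h1 : ContDiffOn ℝ ∞ (fun x => toE2 (((h'⁻¹ * h).1 1 0 + (h'⁻¹ * h).1 1 1 * toE2.symm x) /
      ((h'⁻¹ * h).1 0 0 + (h'⁻¹ * h).1 0 1 * toE2.symm x)))
      {x | (h'⁻¹ * h).1 0 0 + (h'⁻¹ * h).1 0 1 * toE2.symm x ≠ 0} := by
    intro x hx
    refine ((toE2.contDiff.contDiffAt.comp x ?_)).contDiffWithinAt
    exact (contDiffAt_div hx).comp x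
      ((contDiff_const.add (contDiff_const.mul toE2.symm.contDiff)).prodMk
        (contDiff_const.add (contDiff_const.mul toE2.symm.contDiff))).contDiffAt
  refine (h1.mono ?_).congr ?_
  · rintro x ⟨hx, -⟩
    exact ofRatio_mem_affine.1 hx.2
  · rintro x -
    exact congrArg toE2 (ratio_ofRatio_of h h' (toE2.symm x))

lemma chart_mem_maximalAtlas (h : SU2) : chart h ∈ IsManifold.maximalAtlas (𝓡 2) ∞ CP1 :=
  IsManifold.subset_maximalAtlas ⟨h, rfl⟩

lemma contMDiffAt_ratio {h : SU2} {p : CP1} (hp : p ∈ affine h) :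
    ContMDiffAt (𝓡 2) 𝓘(ℝ, ℂ) ∞ (ratio h) p := by
  have h1 : ContMDiffAt (𝓡 2) (𝓡 2) ∞ (chart h) p :=
    contMDiffAt_of_mem_maximalAtlas (chart_mem_maximalAtlas h) hp
  refine (toE2.symm.contDiff.contMDiff.contMDiffAt.comp p h1).congr_of_eventuallyEq
    (.of_forall fun q => ?_)
  exact (toE2.symm_apply_apply _).symm

lemma contMDiff_ofRatio (h : SU2) : ContMDiff 𝓘(ℝ, ℂ) (𝓡 2) ∞ (ofRatio h) := by
  intro ζ
  have h1 : ContMDiffAt (𝓡 2) (𝓡 2) ∞ (chart h).symm (toE2 ζ) :=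
    contMDiffAt_symm_of_mem_maximalAtlas (chart_mem_maximalAtlas h) (Set.mem_univ _)
  refine (h1.comp ζ toE2.contDiff.contMDiff.contMDiffAt).congr_of_eventuallyEq
    (.of_forall fun w => ?_)
  exact (congrArg (ofRatio h) (toE2.symm_apply_apply w)).symm

lemma ext_affine {h : SU2} {p q : CP1} (hp : p ∈ affine h) (hq : q ∈ affine h)
    (hpq : ratio h p = ratio h q) : p = q := by
  rw [← ofRatio_ratio hp, hpq, ofRatio_ratio hq]

lemma continuous_line : Continuous SU2.line := by
  refine isQuotientMap_mk.continuous.comp (f := fun g : SU2 =>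
    (⟨g.1 *ᵥ ![1, 0], g.mulVec_ne_zero⟩ : {v : Fin 2 → ℂ // v ≠ 0})) ?_
  exact Continuous.subtype_mk (continuous_subtype_val.matrix_mulVec continuous_const) _

lemma contMDiff_line : ContMDiff (𝓡 3) (𝓡 2) ∞ SU2.line := by
  intro g₀
  have hm : ∀ i j, ContMDiff (𝓡 3) 𝓘(ℝ, ℂ) ∞ fun g : SU2 => (g₀⁻¹ * g).1 i j := fun i j =>
    (SU2.contMDiff_apply i j).comp (SU2.contMDiff_mul contMDiff_const contMDiff_id)
  have hd : ContDiffAt ℝ ∞ (fun p : ℂ × ℂ => p.1 / p.2) ((g₀⁻¹ * g₀).1 1 0, (g₀⁻¹ * g₀).1 0 0) :=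
    contDiffAt_div (by rw [inv_mul_cancel]; simp)
  have h1 : ContMDiffAt (𝓡 3) 𝓘(ℝ, ℂ) ∞ (fun g : SU2 => ratio g₀ g.line) g₀ :=
    (ContMDiffAt.comp (g := fun p : ℂ × ℂ => p.1 / p.2) g₀ hd.contMDiffAt ((hm 1 0).prodMk_space (hm 0 0)).contMDiffAt).congr_of_eventuallyEq
      (.of_forall fun g => ratio_line g g₀)
  refine ((contMDiff_ofRatio g₀).contMDiffAt.comp g₀ h1).congr_of_eventuallyEq ?_
  have ho : IsOpen (SU2.line ⁻¹' affine g₀) := (isOpen_affine g₀).preimage continuous_line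
  filter_upwards [ho.mem_nhds (mem_affine_of_line_eq rfl)] with g hg
  exact (ofRatio_ratio hg).symm

lemma contMDiff_unitaryOf : ContMDiff 𝓘(ℝ, ℂ) (𝓡 3) ∞ unitaryOf := by
  have hpos : ∀ ζ : ℂ, (0 : ℝ) < 1 + Complex.normSq ζ := fun ζ =>
    add_pos_of_pos_of_nonneg one_pos (Complex.normSq_nonneg ζ)
  have hn : ContDiff ℝ ∞ fun ζ : ℂ => 1 + Complex.normSq ζ := by
    have e : (fun ζ : ℂ => 1 + Complex.normSq ζ) =
        fun ζ => 1 + (Complex.reCLM ζ * Complex.reCLM ζ + Complex.imCLM ζ * Complex.imCLM ζ) :=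
      funext fun ζ => by rw [Complex.normSq_apply]; rfl
    rw [e]
    fun_prop
  have hs : ContDiff ℝ ∞ fun ζ : ℂ => (((Real.sqrt (1 + Complex.normSq ζ))⁻¹ : ℝ) : ℂ) :=
    Complex.ofRealCLM.contDiff.comp ((hn.sqrt fun ζ => (hpos ζ).ne').inv fun ζ =>
      (Real.sqrt_pos.2 (hpos ζ)).ne')
  refine SU2.contMDiff_of_col (hs.contMDiff.congr fun ζ => ?_)
    ((hs.mul contDiff_id).contMDiff.congr fun ζ => ?_)
  · rw [unitaryOf_apply]; simp
  · rw [unitaryOf_apply]; simp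

/-- The section of `g ↦ g · [e₁]` over the affine domain centred at `h · [e₁]`. -/
def lift (h : SU2) (p : CP1) : SU2 := h * unitaryOf (ratio h p)

lemma unitaryOf_ne_zero (ζ : ℂ) : (unitaryOf ζ).1 0 0 ≠ 0 := by
  intro h0
  have h := (unitaryOf ζ).normSq_add
  rw [unitaryOf_col, h0] at h
  simp at h

lemma line_lift {h : SU2} {p : CP1} (hp : p ∈ affine h) : (lift h p).line = p := by
  have hu := unitaryOf_ne_zero (ratio h p)
  have e : h⁻¹ * lift h p = unitaryOf (ratio h p) := by
    rw [lift, inv_mul_cancel_left]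
  refine ext_affine (h := h) ?_ hp ?_
  · rwa [line_mem_affine_iff, e]
  · rw [ratio_line, e, unitaryOf_col, mul_div_cancel_right₀ _ hu]

lemma unitaryOf_zero : unitaryOf 0 = 1 :=
  SU2.ext_col (by rw [unitaryOf_apply]; simp) (by rw [unitaryOf_apply]; simp)

lemma lift_line (h : SU2) : lift h h.line = h := by
  rw [lift, line_eq_ofRatio, ratio_ofRatio, unitaryOf_zero, mul_one]

lemma contMDiffAt_lift {h : SU2} {p : CP1} (hp : p ∈ affine h) :
    ContMDiffAt (𝓡 2) (𝓡 3) ∞ (lift h) p :=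
  ((SU2.contMDiff_mul (f := fun _ => h) (g := fun g : SU2 => g)
    contMDiff_const contMDiff_id).comp contMDiff_unitaryOf).contMDiffAt.comp p
    (contMDiffAt_ratio hp)

lemma line_eq_line_iff {g h : SU2} : g.line = h.line ↔ (h⁻¹ * g).1 1 0 = 0 := by
  constructor
  · intro e
    have h1 : (h⁻¹ * g).1 0 0 ≠ 0 := line_mem_affine_iff.1 (e ▸ mem_affine_of_line_eq rfl)
    have h2 := ratio_line g h
    rw [e, line_eq_ofRatio, ratio_ofRatio, eq_comm, div_eq_zero_iff] at h2
    exact h2.resolve_right h1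
  · intro e
    have h1 : (h⁻¹ * g).1 0 0 ≠ 0 := fun h0 => by
      have h := (h⁻¹ * g).normSq_add
      rw [h0, e] at h
      simp at h
    refine ext_affine (line_mem_affine_iff.2 h1) (mem_affine_of_line_eq rfl) ?_
    rw [ratio_line, e, zero_div, line_eq_ofRatio, ratio_ofRatio]

lemma mem_torus_iff (g : SU2) : g ∈ torus ↔ g.1 1 0 = 0 := by
  constructor
  · rintro ⟨t, ht⟩
    rw [ht]
    simp
  · intro h0
    have hn := g.normSq_add
    rw [h0, map_zero, add_zero, Complex.normSq_eq_norm_sq] at hn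
    obtain ⟨t, ht⟩ := (Complex.norm_eq_one_iff _).1
      ((pow_eq_one_iff_of_nonneg (norm_nonneg _) two_ne_zero).1 hn)
    refine ⟨t, ?_⟩
    have e : starRingEnd ℂ (Complex.exp (t * Complex.I)) = Complex.exp (-(t * Complex.I)) := by
      rw [← Complex.exp_conj]
      simp
    ext i j
    fin_cases i <;> fin_cases j
    · simpa using ht.symm
    · simpa [h0] using g.apply_zero_one
    · simpa using h0
    · have := g.apply_one_one
      rw [← ht, e] at this
      simpa using this

lemma line_eq_line_iff_mem_torus {g h : SU2} : g.line = h.line ↔ h⁻¹ * g ∈ torus := by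
  rw [line_eq_line_iff, mem_torus_iff]

instance : T2Space CP1 := by
  refine ⟨fun p q hpq => ?_⟩
  obtain ⟨h, rfl⟩ := line_surjective q
  have hpos : ∀ v : {v : Fin 2 → ℂ // v ≠ 0},
      Complex.normSq (coord h v.1 0) + Complex.normSq (coord h v.1 1) ≠ 0 := by
    intro v h0
    have h1 := Complex.normSq_nonneg (coord h v.1 0)
    have h2 := Complex.normSq_nonneg (coord h v.1 1)
    refine v.2 ?_
    rw [← mulVec_coord h v.1]
    have e0 : Complex.normSq (coord h v.1 0) = 0 := by linarith
    have e1 : Complex.normSq (coord h v.1 1) = 0 := by linarith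
    have h3 : coord h v.1 = 0 := by
      funext i
      fin_cases i
      · exact Complex.normSq_eq_zero.1 e0
      · exact Complex.normSq_eq_zero.1 e1
    rw [h3, Matrix.mulVec_zero]
  -- The squared sine of the angle to the line h·[e₁]: continuous on the projective line and zero
  -- only at that point, so it separates it from any other.
  let f : CP1 → ℝ := Projectivization.lift (fun v => Complex.normSq (coord h v.1 1) /
      (Complex.normSq (coord h v.1 0) + Complex.normSq (coord h v.1 1))) (fun v w t hvw => by
    have ht := smul_of_eq hvw
    simp only [hvw, coord_smul, Pi.smul_apply, smul_eq_mul, Complex.normSq_mul, ← mul_add]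
    exact mul_div_mul_left _ _ (Complex.normSq_eq_zero.not.2 ht))
  have hf : Continuous f := by
    rw [isQuotientMap_mk.continuous_iff]
    have hc : ∀ i, Continuous fun v : {v : Fin 2 → ℂ // v ≠ 0} =>
        Complex.normSq (coord h v.1 i) := fun i =>
      Complex.continuous_normSq.comp ((continuous_coord h i).comp continuous_subtype_val)
    exact (hc 1).div ((hc 0).add (hc 1)) hpos
  refine separated_by_continuous hf fun hfe => hpq ?_
  obtain ⟨g, rfl⟩ := line_surjective p
  rw [line_eq_line_iff]
  have h1 : ∀ (g : SU2) i, coord h (g.1 *ᵥ ![1, 0]) i = (h⁻¹ * g).1 i 0 := fun g i => by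
    rw [coord_affine, mul_zero, add_zero]
  have h2 : f h.line = 0 := by
    change Complex.normSq (coord h (h.1 *ᵥ ![1, 0]) 1) / _ = 0
    rw [h1, inv_mul_cancel]
    simp
  rw [h2] at hfe
  have h3 := (div_eq_zero_iff.1 hfe).resolve_right (hpos ⟨_, g.mulVec_ne_zero⟩)
  rw [← h1]
  exact Complex.normSq_eq_zero.1 h3

instance : CompactSpace SU2 := SU2.homeoSphere.symm.compactSpace

instance : CompactSpace CP1 :=
  ⟨by rw [← line_surjective.range_eq]; exact isCompact_range continuous_line⟩

instance : SecondCountableTopology CP1 :=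
  ChartedSpace.secondCountable_of_sigmaCompact (EuclideanSpace ℝ (Fin 2)) CP1

end CP1

end CRGeom

end

noncomputable section

namespace CRGeom

open Topology

/-! ### The smooth structures of `G^τ` and of the homogeneous space -/

section Submersion

variable {E H E' H' : Type*} [NormedAddCommGroup E] [NormedSpace ℝ E] [TopologicalSpace H]
  {I : ModelWithCorners ℝ E H} [NormedAddCommGroup E'] [NormedSpace ℝ E'] [TopologicalSpace H']
  {J : ModelWithCorners ℝ E' H'} {M N : Type*} [TopologicalSpace M] [ChartedSpace H M]
  [TopologicalSpace N] [ChartedSpace H' N]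

/-- By the chain rule, the differential of a local section is a right inverse. -/
lemma surjective_mfderiv_of_section {f : M → N} {s : N → M} {y : N}
    (hf : MDifferentiableAt I J f (s y)) (hs : MDifferentiableAt J I s y)
    (h : ∀ᶠ y' in 𝓝 y, f (s y') = y') : Function.Surjective (mfderiv I J f (s y)) := by
  have h1 : HasMFDerivAt J J (f ∘ s) y ((mfderiv I J f (s y)).comp (mfderiv J I s y)) :=
    hf.hasMFDerivAt.comp y hs.hasMFDerivAt
  have h2 : HasMFDerivAt J J (f ∘ s) y (ContinuousLinearMap.id ℝ (TangentSpace J y)) :=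
    (hasMFDerivAt_id y).congr_of_eventuallyEq h
  have h3 := hasMFDerivAt_unique h1 h2
  intro v
  exact ⟨mfderiv J I s y v, DFunLike.congr_fun h3 v⟩

lemma isSmoothSubmersion_of_sections {f : M → N} (hf : ContMDiff I J ∞ f)
    (h : ∀ x, ∃ s : N → M, ContMDiffAt J I ∞ s (f x) ∧ s (f x) = x ∧
      ∀ᶠ y in 𝓝 (f x), f (s y) = y) : IsSmoothSubmersion I J f := by
  refine ⟨hf, fun x => ?_⟩
  obtain ⟨s, hs, hx, hfs⟩ := h x
  have key := surjective_mfderiv_of_section (hf.mdifferentiable (by simp) (s (f x)))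
    (hs.mdifferentiableAt (by simp)) hfs
  rw [hx] at key
  exact key

end Submersion

variable {k : ℕ}

/-- The model of `V^τ`. -/
abbrev VModel (k : ℕ) : Type := EuclideanSpace ℝ (Fin (2 * k + 1))

/-- A linear isomorphism of `V^τ` with its Euclidean model. -/
@[irreducible] def kappa (k : ℕ) : Vtau k ≃L[ℝ] VModel k :=
  ContinuousLinearEquiv.ofFinrankEq (by rw [finrank_Vtau, finrank_euclideanSpace_fin])

/-- The coefficients of a vector of the model. -/
def modelCoef (k : ℕ) : VModel k →L[ℝ] Coef k :=
  LinearMap.toContinuousLinearMap (coef k ∘ₗ (kappa k).symm.toLinearMap)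

lemma modelCoef_apply (e : VModel k) : modelCoef k e = coef k ((kappa k).symm e) := rfl

lemma modelCoef_kappa (v : Vtau k) : modelCoef k (kappa k v) = coef k v := by
  rw [modelCoef_apply, (kappa k).symm_apply_apply]

/-- The values of the form with given coefficients at `(1, 0), (1, 1), (1, 2), …`. -/
def sample (k : ℕ) : VModel k →ₗ[ℝ] Coef k where
  toFun e i := ((kappa k).symm e).1 ![1, ((i : ℕ) : ℂ)]
  map_add' e e' := by
    funext i
    rw [map_add]
    rfl
  map_smul' r e := by
    funext i
    rw [map_smul]
    rfl

/-- A polynomial of degree at most 2k with 2k + 1 distinct zeros is zero. -/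
lemma sample_injective : Function.Injective (sample k) := by
  rw [injective_iff_map_eq_zero]
  intro e he
  have h0 : poly (coef k ((kappa k).symm e)) = 0 := by
    refine Polynomial.eq_zero_of_natDegree_lt_card_of_eval_eq_zero _
      (f := fun i : Fin (2 * k + 1) => ((i : ℕ) : ℂ)) ?_ ?_ ?_
    · intro i j hij
      exact Fin.ext (Nat.cast_injective hij)
    · intro i
      rw [poly_eval, form_coef]
      exact congrFun he i
    · rw [Fintype.card_fin, Nat.lt_succ_iff]
      refine Polynomial.natDegree_sum_le_of_forall_le _ _ fun j _ => ?_
      exact (Polynomial.natDegree_monomial_le _).trans (Nat.lt_succ_iff.1 j.2)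
  have h1 : coef k ((kappa k).symm e) = 0 := by
    funext i
    rw [← poly_coeff (coef k ((kappa k).symm e)), h0, Polynomial.coeff_zero, Pi.zero_apply]
  have h2 := coef_injective (h1.trans (map_zero (coef k)).symm)
  exact (kappa k).symm.map_eq_zero_iff.1 h2

section IntoV

variable {E H : Type*} [NormedAddCommGroup E] [NormedSpace ℝ E] [TopologicalSpace H]
  {I : ModelWithCorners ℝ E H} {M : Type*} [TopologicalSpace M] [ChartedSpace H M]

/-- Finitely many evaluations embed V^τ linearly, so smoothness can be tested on values of the forms
without a formula for the matrix coefficients of ρ. -/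
lemma contMDiff_of_sample {F : M → VModel k}
    (h : ∀ t : ℂ, ContMDiff I 𝓘(ℝ, ℂ) ∞ fun x => ((kappa k).symm (F x)).1 ![1, t]) :
    ContMDiff I (𝓡 (2 * k + 1)) ∞ F := by
  obtain ⟨L, hL⟩ := LinearMap.exists_leftInverse_of_injective (sample k)
    (LinearMap.ker_eq_bot.2 sample_injective)
  have h1 : ContMDiff I 𝓘(ℝ, Coef k) ∞ fun x => sample k (F x) :=
    contMDiff_pi_space.2 fun i => h _
  exact ((LinearMap.toContinuousLinearMap L).contDiff.contMDiff.comp h1).congr fun x =>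
    (DFunLike.congr_fun hL (F x)).symm

/-- The action of `SU(2)` on the model of `V^τ`. -/
def act (g : SU2) (e : VModel k) : VModel k := kappa k (rho k g ((kappa k).symm e))

lemma contDiff_form : ContDiff ℝ ∞ fun p : (ℂ × ℂ) × Coef k => form k p.2 ![p.1.1, p.1.2] := by
  simp only [form_apply]
  refine ContDiff.sum fun i _ => ?_
  simp only [Matrix.cons_val_zero, Matrix.cons_val_one]
  fun_prop

variable [IsManifold I ∞ M]

lemma contMDiff_act {f : M → SU2} {F : M → VModel k} (hf : ContMDiff I (𝓡 3) ∞ f)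
    (hF : ContMDiff I (𝓡 (2 * k + 1)) ∞ F) :
    ContMDiff I (𝓡 (2 * k + 1)) ∞ fun x => act (f x) (F x) := by
  refine contMDiff_of_sample fun t => ?_
  have hi : ∀ i j, ContMDiff I 𝓘(ℝ, ℂ) ∞ fun x => ((f x)⁻¹ : SU2).1 i j := fun i j =>
    (SU2.contMDiff_apply i j).comp (SU2.contMDiff_inv hf)
  have hr : ContDiff ℝ ∞ fun p : ℂ × ℂ => p.1 + p.2 * t := by fun_prop
  have hv : ∀ i, ContMDiff I 𝓘(ℝ, ℂ) ∞ fun x =>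
      ((f x)⁻¹ : SU2).1 i 0 + ((f x)⁻¹ : SU2).1 i 1 * t := fun i =>
    hr.contMDiff.comp ((hi i 0).prodMk_space (hi i 1))
  have hc : ContMDiff I 𝓘(ℝ, Coef k) ∞ fun x => modelCoef k (F x) :=
    (modelCoef k).contDiff.contMDiff.comp hF
  refine (contDiff_form.contMDiff.comp (((hv 0).prodMk_space (hv 1)).prodMk_space hc)).congr
    fun x => ?_
  rw [act, (kappa k).symm_apply_apply, Function.comp_apply, modelCoef_apply, form_coef]
  change ((kappa k).symm (F x)).1 (((f x)⁻¹ : SU2).1 *ᵥ ![1, t]) = _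
  refine congrArg ((kappa k).symm (F x)).1 (funext fun i => ?_)
  fin_cases i <;> simp [Matrix.mulVec, dotProduct, Fin.sum_univ_two]

end IntoV

lemma continuous_rho : Continuous fun p : SU2 × Vtau k => rho k p.1 p.2 := by
  have h1 : ContMDiff ((𝓡 3).prod (𝓡 (2 * k + 1))) (𝓡 (2 * k + 1)) ∞
      fun p : SU2 × VModel k => act p.1 p.2 := contMDiff_act contMDiff_fst contMDiff_snd
  have h2 : (fun p : SU2 × Vtau k => rho k p.1 p.2) =
      fun p => (kappa k).symm (act p.1 (kappa k p.2)) := by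
    funext p
    rw [act, (kappa k).symm_apply_apply, (kappa k).symm_apply_apply]
  have h3 : Continuous fun p : SU2 × Vtau k => (p.1, kappa k p.2) :=
    continuous_fst.prodMk ((kappa k).continuous.comp continuous_snd)
  have h4 := (kappa k).symm.continuous.comp (h1.continuous.comp h3)
  rw [h2]
  exact h4

namespace Gtau

/-- `G^τ` as a product. -/
def homeo (k : ℕ) : Gtau k ≃ₜ SU2 × VModel k where
  toFun x := (x.rot, kappa k x.trans)
  invFun y := ⟨y.1, (kappa k).symm y.2⟩
  left_inv x := by simp
  right_inv y := by simp
  continuous_toFun := by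
    have h : Continuous fun x : Gtau k => (x.rot, x.trans) := continuous_induced_dom
    exact (continuous_fst.comp h).prodMk ((kappa k).continuous.comp (continuous_snd.comp h))
  continuous_invFun := continuous_induced_rng.2
    (continuous_fst.prodMk ((kappa k).symm.continuous.comp continuous_snd))

instance : ChartedSpace (ModelProd (EuclideanSpace ℝ (Fin 3)) (VModel k)) (Gtau k) :=
  transferCharts _ (homeo k)

instance : IsManifold ((𝓡 3).prod (𝓡 (2 * k + 1))) ∞ (Gtau k) := isManifold_transfer _ (homeo k)

lemma contMDiff_rot : ContMDiff ((𝓡 3).prod (𝓡 (2 * k + 1))) (𝓡 3) ∞ (rot : Gtau k → SU2) :=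
  contMDiff_fst.comp (contMDiff_transfer _ (homeo k)).1

lemma contMDiff_trans : ContMDiff ((𝓡 3).prod (𝓡 (2 * k + 1))) (𝓡 (2 * k + 1)) ∞
    fun x : Gtau k => kappa k x.trans :=
  contMDiff_snd.comp (contMDiff_transfer _ (homeo k)).1

section IntoG

variable {E H : Type*} [NormedAddCommGroup E] [NormedSpace ℝ E] [TopologicalSpace H]
  {I : ModelWithCorners ℝ E H} {M : Type*} [TopologicalSpace M] [ChartedSpace H M]

lemma contMDiffAt_mk {f : M → SU2} {F : M → Vtau k} {x : M} (hf : ContMDiffAt I (𝓡 3) ∞ f x)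
    (hF : ContMDiffAt I (𝓡 (2 * k + 1)) ∞ (fun x => kappa k (F x)) x) :
    ContMDiffAt I ((𝓡 3).prod (𝓡 (2 * k + 1))) ∞ (fun x => (⟨f x, F x⟩ : Gtau k)) x := by
  refine ((contMDiff_transfer _ (homeo k)).2.contMDiffAt.comp x (hf.prodMk hF)).congr_of_eventuallyEq
    (.of_forall fun y => ?_)
  exact ((homeo k).symm_apply_apply (⟨f y, F y⟩ : Gtau k)).symm

end IntoG

instance : LieGroup ((𝓡 3).prod (𝓡 (2 * k + 1))) ∞ (Gtau k) where
  contMDiff_mul := by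
    intro x
    refine contMDiffAt_mk (ContMDiff.contMDiffAt (SU2.contMDiff_mul
      (contMDiff_rot.comp contMDiff_fst) (contMDiff_rot.comp contMDiff_snd)))
      (ContMDiff.contMDiffAt ?_)
    have h : ContMDiff (((𝓡 3).prod (𝓡 (2 * k + 1))).prod ((𝓡 3).prod (𝓡 (2 * k + 1))))
        (𝓡 (2 * k + 1)) ∞ fun p : Gtau k × Gtau k =>
          kappa k p.1.trans + act p.1.rot (kappa k p.2.trans) :=
      (contMDiff_trans.comp contMDiff_fst).add (contMDiff_act (contMDiff_rot.comp contMDiff_fst)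
        (contMDiff_trans.comp contMDiff_snd))
    refine h.congr fun p => ?_
    rw [map_add, act, (kappa k).symm_apply_apply]
  contMDiff_inv := by
    intro x
    refine contMDiffAt_mk (ContMDiff.contMDiffAt (SU2.contMDiff_inv contMDiff_rot))
      (ContMDiff.contMDiffAt ?_)
    have h : ContMDiff ((𝓡 3).prod (𝓡 (2 * k + 1))) (𝓡 (2 * k + 1)) ∞ fun p : Gtau k =>
        -act p.rot⁻¹ (kappa k p.trans) :=
      (contMDiff_act (SU2.contMDiff_inv contMDiff_rot) contMDiff_trans).neg
    refine h.congr fun p => ?_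
    rw [map_neg, act, (kappa k).symm_apply_apply]

lemma ofRot_mul_ofTrans (g : SU2) (v : Vtau k) : ofRot k g * ofTrans v = ⟨g, rho k g v⟩ := by
  change (⟨g * 1, 0 + rho k g v⟩ : Gtau k) = _
  rw [mul_one, zero_add]

end Gtau

/-! ### The quotient as a product, its submersions and its bundle structures -/

namespace HomSpace

/-- Right multiplication by an element of T^τ leaves the translation part alone and multiplies the
rotation by an element of the stabilizer of [e₁]. -/
lemma proj_eq_iff {g h : Gtau k} :
    proj k g = proj k h ↔ g.rot.line = h.rot.line ∧ g.trans = h.trans := by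
  have e : g⁻¹ * h = ⟨g.rot⁻¹ * h.rot, rho k g.rot⁻¹ (h.trans - g.trans)⟩ := by
    rw [Gtau.inv_def, Gtau.mul_def, map_sub, neg_add_eq_sub]
  rw [QuotientGroup.eq, e, eq_comm (a := g.rot.line), CP1.line_eq_line_iff_mem_torus]
  constructor
  · rintro ⟨t, ht, hte⟩
    have h1 : t = g.rot⁻¹ * h.rot := congrArg Gtau.rot hte
    have h2 : 0 = rho k g.rot⁻¹ (h.trans - g.trans) := congrArg Gtau.trans hte
    refine ⟨h1 ▸ ht, ?_⟩
    have h3 := congrArg (rho k g.rot) h2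
    rw [map_zero, ← Module.End.mul_apply, ← map_mul, mul_inv_cancel, map_one] at h3
    exact (sub_eq_zero.1 h3.symm).symm
  · rintro ⟨h1, h2⟩
    refine ⟨_, h1, ?_⟩
    rw [h2, sub_self, map_zero]
    rfl

/-- The homogeneous space as a product. -/
def homeo (k : ℕ) : HomSpace k ≃ₜ CP1 × VModel k where
  toFun := Quotient.lift (fun g : Gtau k => (g.rot.line, kappa k g.trans)) fun g h hgh => by
    obtain ⟨h1, h2⟩ := proj_eq_iff.1 (Quotient.sound hgh)
    exact Prod.ext h1 (congrArg (kappa k) h2)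
  invFun y := proj k ⟨CP1.frame y.1, (kappa k).symm y.2⟩
  left_inv m := by
    induction m using QuotientGroup.induction_on with
    | H g => exact proj_eq_iff.2 ⟨CP1.line_frame _, (kappa k).symm_apply_apply _⟩
  right_inv y := Prod.ext (CP1.line_frame _) ((kappa k).apply_symm_apply _)
  continuous_toFun := continuous_quot_lift _
    ((CP1.continuous_line.comp Gtau.contMDiff_rot.continuous).prodMk
      Gtau.contMDiff_trans.continuous)
  -- `CP1.frame` is an arbitrary choice and need not be continuous. Near p it is replaced by the
  -- local section `CP1.lift`, which gives the same class.
  continuous_invFun := by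
    rw [continuous_iff_continuousAt]
    rintro ⟨p, e⟩
    have h1 : ContinuousAt (fun y : CP1 × VModel k =>
        proj k ((Gtau.homeo k).symm (CP1.lift (CP1.frame p) y.1, y.2))) (p, e) := by
      refine continuous_quot_mk.continuousAt.comp
        ((Gtau.homeo k).symm.continuous.continuousAt.comp ?_)
      exact ContinuousAt.prodMk (ContinuousAt.comp (f := Prod.fst) (g := CP1.lift (CP1.frame p))
        (CP1.contMDiffAt_lift (CP1.mem_affine_frame p)).continuousAt continuousAt_fst)
        continuousAt_snd
    refine h1.congr ?_
    have ho : IsOpen (Prod.fst ⁻¹' CP1.affine (CP1.frame p) : Set (CP1 × VModel k)) :=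
      (CP1.isOpen_affine _).preimage continuous_fst
    filter_upwards [ho.mem_nhds (CP1.mem_affine_frame p)] with y hy
    exact proj_eq_iff.2 ⟨(CP1.line_lift hy).trans (CP1.line_frame _).symm, rfl⟩

lemma homeo_proj (g : Gtau k) : homeo k (proj k g) = (g.rot.line, kappa k g.trans) := rfl

lemma homeo_symm_apply (g : SU2) (e : VModel k) :
    (homeo k).symm (g.line, e) = proj k ⟨g, (kappa k).symm e⟩ := by
  rw [Homeomorph.symm_apply_eq, homeo_proj, (kappa k).apply_symm_apply]

instance : ChartedSpace (ModelM k) (HomSpace k) := transferCharts _ (homeo k)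

instance : IsManifold ((𝓡 2).prod (𝓡 (2 * k + 1))) ∞ (HomSpace k) :=
  isManifold_transfer _ (homeo k)

instance : T2Space (HomSpace k) := (homeo k).symm.t2Space

instance : SecondCountableTopology (HomSpace k) := (homeo k).secondCountableTopology

/-- The projection to the projective line. -/
def base (k : ℕ) (m : HomSpace k) : CP1 := (homeo k m).1

/-- The fibre coordinate. -/
def fibre (k : ℕ) (m : HomSpace k) : VModel k := (homeo k m).2

lemma contMDiff_homeo : ContMDiff ((𝓡 2).prod (𝓡 (2 * k + 1))) ((𝓡 2).prod (𝓡 (2 * k + 1))) ∞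
    (homeo k) := (contMDiff_transfer _ (homeo k)).1

lemma contMDiff_homeo_symm : ContMDiff ((𝓡 2).prod (𝓡 (2 * k + 1)))
    ((𝓡 2).prod (𝓡 (2 * k + 1))) ∞ (homeo k).symm := (contMDiff_transfer _ (homeo k)).2

lemma contMDiff_base : ContMDiff ((𝓡 2).prod (𝓡 (2 * k + 1))) (𝓡 2) ∞ (base k) :=
  contMDiff_fst.comp contMDiff_homeo

lemma contMDiff_fibre : ContMDiff ((𝓡 2).prod (𝓡 (2 * k + 1))) (𝓡 (2 * k + 1)) ∞ (fibre k) :=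
  contMDiff_snd.comp contMDiff_homeo

lemma contMDiff_proj : ContMDiff ((𝓡 3).prod (𝓡 (2 * k + 1))) ((𝓡 2).prod (𝓡 (2 * k + 1))) ∞
    (proj k) := by
  have h := contMDiff_homeo_symm.comp ((CP1.contMDiff_line.comp Gtau.contMDiff_rot).prodMk
    (Gtau.contMDiff_trans (k := k)))
  exact h.congr fun g => ((homeo k).symm_apply_apply (proj k g)).symm

lemma eventually_base_mem (h : SU2) {m : HomSpace k} (hm : base k m ∈ CP1.affine h) :
    ∀ᶠ y in 𝓝 m, base k y ∈ CP1.affine h :=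
  ((CP1.isOpen_affine h).preimage contMDiff_base.continuous).mem_nhds hm

lemma contMDiffAt_lift_base {h : SU2} {m : HomSpace k} (hm : base k m ∈ CP1.affine h) :
    ContMDiffAt ((𝓡 2).prod (𝓡 (2 * k + 1))) (𝓡 3) ∞ (fun y => CP1.lift h (base k y)) m :=
  (CP1.contMDiffAt_lift hm).comp m contMDiff_base.contMDiffAt

lemma exists_section (g : Gtau k) : ∃ s : HomSpace k → Gtau k,
    ContMDiffAt ((𝓡 2).prod (𝓡 (2 * k + 1))) ((𝓡 3).prod (𝓡 (2 * k + 1))) ∞ s (proj k g) ∧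
    s (proj k g) = g ∧ ∀ᶠ m in 𝓝 (proj k g), proj k (s m) = m := by
  have hg : base k (proj k g) ∈ CP1.affine g.rot := CP1.mem_affine_of_line_eq rfl
  refine ⟨fun m => ⟨CP1.lift g.rot (base k m), (kappa k).symm (fibre k m)⟩,
    Gtau.contMDiffAt_mk (contMDiffAt_lift_base hg) ?_, ?_, ?_⟩
  · simp only [(kappa k).apply_symm_apply]
    exact contMDiff_fibre.contMDiffAt
  · exact Gtau.ext (CP1.lift_line g.rot) ((kappa k).symm_apply_apply g.trans)
  · filter_upwards [eventually_base_mem g.rot hg] with m hm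
    rw [← homeo_symm_apply, CP1.line_lift hm]
    exact (homeo k).symm_apply_apply m

lemma isSmoothSubmersion_proj : IsSmoothSubmersion ((𝓡 3).prod (𝓡 (2 * k + 1)))
    ((𝓡 2).prod (𝓡 (2 * k + 1))) (proj k) :=
  isSmoothSubmersion_of_sections contMDiff_proj exists_section

lemma isSmoothSubmersion_line : IsSmoothSubmersion ((𝓡 3).prod (𝓡 (2 * k + 1))) (𝓡 2)
    fun g : Gtau k => g.rot.line := by
  refine isSmoothSubmersion_of_sections (CP1.contMDiff_line.comp Gtau.contMDiff_rot) fun g => ?_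
  have hg : g.rot.line ∈ CP1.affine g.rot := CP1.mem_affine_of_line_eq rfl
  refine ⟨fun p => ⟨CP1.lift g.rot p, g.trans⟩,
    Gtau.contMDiffAt_mk (CP1.contMDiffAt_lift hg) contMDiffAt_const, ?_, ?_⟩
  · exact Gtau.ext (CP1.lift_line g.rot) rfl
  · filter_upwards [(CP1.isOpen_affine g.rot).mem_nhds hg] with p hp
    exact CP1.line_lift hp

/-- The homogeneous space as an associated bundle. -/
def assoc (k : ℕ) : AssocBundle k ≃ₜ HomSpace k where
  -- The translation part is ρ(g)v, which is constant on the classes because ρ is a representation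
  -- of all of SU(2), not only of the circle.
  toFun := Quot.lift (fun a : SU2 × Vtau k => proj k ⟨a.1, rho k a.1 a.2⟩) (by
    rintro _ _ ⟨g, t, ht, v, rfl, rfl⟩
    refine proj_eq_iff.2 ⟨?_, ?_⟩
    · rw [CP1.line_eq_line_iff_mem_torus, inv_mul_cancel_left]
      exact ht
    · change rho k (g * t) v = rho k g (rho k t v)
      rw [map_mul]
      rfl)
  invFun := Quotient.lift (fun g : Gtau k => Quot.mk _ (g.rot, rho k g.rot⁻¹ g.trans)) (by
    intro g h hgh
    obtain ⟨h1, h2⟩ := proj_eq_iff.1 (Quotient.sound hgh)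
    refine (Quot.sound ⟨g.rot, g.rot⁻¹ * h.rot, CP1.line_eq_line_iff_mem_torus.1 h1.symm,
      rho k h.rot⁻¹ h.trans, ?_, ?_⟩).symm
    · rw [mul_inv_cancel_left]
    · rw [← Module.End.mul_apply, ← map_mul, mul_inv_cancel_right, h2])
  left_inv a := by
    induction a using Quot.ind with
    | mk a =>
      change Quot.mk _ (a.1, rho k a.1⁻¹ (rho k a.1 a.2)) = _
      rw [← Module.End.mul_apply, ← map_mul, inv_mul_cancel, map_one]
      rfl
  right_inv m := by
    induction m using QuotientGroup.induction_on with
    | H g =>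
      change proj k ⟨g.rot, rho k g.rot (rho k g.rot⁻¹ g.trans)⟩ = _
      rw [← Module.End.mul_apply, ← map_mul, mul_inv_cancel, map_one]
      rfl
  continuous_toFun := by
    refine continuous_quot_lift _ (continuous_quot_mk.comp (continuous_induced_rng.2 ?_))
    exact continuous_fst.prodMk continuous_rho
  continuous_invFun := by
    refine continuous_quot_lift _ (continuous_quot_mk.comp ?_)
    have h : Continuous fun x : Gtau k => (x.rot, x.trans) := continuous_induced_dom
    have h1 : Continuous fun x : Gtau k => (x.rot⁻¹, x.trans) :=
      (SU2.contMDiff_inv Gtau.contMDiff_rot).continuous.prodMk (continuous_snd.comp h)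
    have h2 := continuous_rho.comp h1
    have h3 : Continuous fun x : Gtau k => rho k x.rot⁻¹ x.trans := h2
    exact (continuous_fst.comp h).prodMk h3

lemma assoc_mk (g : SU2) (v : Vtau k) : assoc k (Quot.mk _ (g, v)) =
    proj k (Gtau.ofRot k g * Gtau.ofTrans v) := by
  rw [Gtau.ofRot_mul_ofTrans]
  rfl

/-- This makes the homeomorphism compatible with the smooth structures: SU(2) × V^τ also submerses
onto M through the associated bundle. -/
lemma isSmoothSubmersion_assoc : IsSmoothSubmersion ((𝓡 3).prod (𝓡 (2 * k + 1)))
    ((𝓡 2).prod (𝓡 (2 * k + 1)))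
    fun x : Gtau k => assoc k (Quot.mk _ (x.rot, x.trans)) := by
  have hm : ContMDiff ((𝓡 3).prod (𝓡 (2 * k + 1))) ((𝓡 2).prod (𝓡 (2 * k + 1))) ∞
      fun x : Gtau k => assoc k (Quot.mk _ (x.rot, x.trans)) := by
    refine contMDiff_proj.comp (f := fun x : Gtau k => (⟨x.rot, rho k x.rot x.trans⟩ : Gtau k)) ?_
    intro x
    refine Gtau.contMDiffAt_mk Gtau.contMDiff_rot.contMDiffAt (ContMDiff.contMDiffAt ?_)
    refine (contMDiff_act Gtau.contMDiff_rot Gtau.contMDiff_trans).congr fun y => ?_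
    rw [act, (kappa k).symm_apply_apply]
  refine isSmoothSubmersion_of_sections hm fun g => ?_
  have hg : base k (proj k ⟨g.rot, rho k g.rot g.trans⟩) ∈ CP1.affine g.rot :=
    CP1.mem_affine_of_line_eq rfl
  have hl := contMDiffAt_lift_base hg
  have ha : ContMDiff ((𝓡 3).prod (𝓡 (2 * k + 1))) (𝓡 (2 * k + 1)) ∞
      fun p : SU2 × VModel k => act p.1⁻¹ p.2 :=
    contMDiff_act (SU2.contMDiff_inv contMDiff_fst) contMDiff_snd
  have hs := ContMDiffAt.comp (g := fun p : SU2 × VModel k => act p.1⁻¹ p.2)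
    (proj k ⟨g.rot, rho k g.rot g.trans⟩) ha.contMDiffAt (hl.prodMk contMDiff_fibre.contMDiffAt)
  refine ⟨fun m => ⟨CP1.lift g.rot (base k m),
      rho k (CP1.lift g.rot (base k m))⁻¹ ((kappa k).symm (fibre k m))⟩,
    Gtau.contMDiffAt_mk hl hs, ?_, ?_⟩
  · refine Gtau.ext (CP1.lift_line g.rot) ?_
    change rho k (CP1.lift g.rot g.rot.line)⁻¹
      ((kappa k).symm (kappa k (rho k g.rot g.trans))) = g.trans
    rw [CP1.lift_line, (kappa k).symm_apply_apply, ← Module.End.mul_apply, ← map_mul,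
      inv_mul_cancel, map_one]
    rfl
  · filter_upwards [eventually_base_mem g.rot hg] with m hm
    change proj k ⟨CP1.lift g.rot (base k m), rho k (CP1.lift g.rot (base k m))
      (rho k (CP1.lift g.rot (base k m))⁻¹ ((kappa k).symm (fibre k m)))⟩ = m
    rw [← Module.End.mul_apply, ← map_mul, mul_inv_cancel, map_one, Module.End.one_apply,
      ← homeo_symm_apply, CP1.line_lift hm]
    exact (homeo k).symm_apply_apply m

/-- The homogeneous space as a trivial bundle over the projective line. -/
def trivialization (k : ℕ) : Bundle.Trivialization (VModel k) (base k) where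
  toOpenPartialHomeomorph := (homeo k).toOpenPartialHomeomorph
  baseSet := Set.univ
  open_baseSet := isOpen_univ
  source_eq := rfl
  target_eq := Set.univ_prod_univ.symm
  proj_toFun _ _ := rfl

lemma isSmoothFibreBundle_base : IsSmoothFibreBundle ((𝓡 2).prod (𝓡 (2 * k + 1))) (𝓡 2)
    (VModel k) (base k) := fun b =>
  ⟨trivialization k, Set.mem_univ b, contMDiff_homeo.contMDiffOn,
    contMDiff_homeo_symm.contMDiffOn⟩

end HomSpace

end CRGeom

end

noncomputable section

namespace CRGeom

open Topology

/-! ### Velocities of curves in the homogeneous space -/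

section Exponential

attribute [local instance] Matrix.linftyOpNormedRing Matrix.linftyOpNormedAlgebra

lemma hasDerivAt_exp_apply (A : Matrix (Fin 2) (Fin 2) ℂ) (i j : Fin 2) :
    HasDerivAt (fun t : ℝ => NormedSpace.exp (t • A) i j) (A i j) 0 := by
  have h := hasDerivAt_exp_smul_const (𝕂 := ℝ) A 0
  rw [zero_smul, NormedSpace.exp_zero, one_mul] at h
  exact hasDerivAt_pi.1 (hasDerivAt_pi.1 h i) j

lemma contDiff_exp_apply (A : Matrix (Fin 2) (Fin 2) ℂ) (i j : Fin 2) :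
    ContDiff ℝ ∞ fun t : ℝ => NormedSpace.exp (t • A) i j := by
  have h1 : ContDiff ℝ ∞ fun t : ℝ => NormedSpace.exp (t • A) := by
    refine ContDiff.comp (g := (NormedSpace.exp : Matrix (Fin 2) (Fin 2) ℂ → _)) ?_
      (contDiff_id.smul contDiff_const)
    exact contDiff_iff_contDiffAt.2 fun x => (NormedSpace.exp_analytic (𝕂 := ℝ) x).contDiffAt
  exact (LinearMap.toContinuousLinearMap (Matrix.entryLinearMap ℝ ℂ i j)).contDiff.comp h1

end Exponential

lemma contMDiff_expSU2 (A : su2) : ContMDiff 𝓘(ℝ, ℝ) (𝓡 3) ∞ fun t : ℝ => expSU2 (t • A) :=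
  SU2.contMDiff_of_col (contDiff_exp_apply A.1 0 0).contMDiff
    (contDiff_exp_apply A.1 1 0).contMDiff

lemma expSU2_zero_smul (A : su2) : expSU2 ((0 : ℝ) • A) = 1 := by
  rw [zero_smul]
  exact Subtype.ext NormedSpace.exp_zero

/-- The derivative of a Möbius map of determinant 1 at the origin is the inverse square of its
denominator. Only the lower left entry of A matters, so upper triangular directions do not move the
affine coordinate. -/
lemma hasDerivAt_ratio (g : SU2) (A : Matrix (Fin 2) (Fin 2) ℂ) (hg : g.1 0 0 ≠ 0)
    {E : ℝ → Matrix (Fin 2) (Fin 2) ℂ} (h0 : E 0 = 1)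
    (hE : ∀ i j, HasDerivAt (fun t => E t i j) (A i j) 0) :
    HasDerivAt (fun t => (g.1 * E t) 1 0 / (g.1 * E t) 0 0) (A 1 0 / g.1 0 0 ^ 2) 0 := by
  have hm : ∀ i, HasDerivAt (fun t => (g.1 * E t) i 0) (g.1 i 0 * A 0 0 + g.1 i 1 * A 1 0) 0 := by
    intro i
    simp only [Matrix.mul_apply, Fin.sum_univ_two]
    exact ((hE 0 0).const_mul _).add ((hE 1 0).const_mul _)
  have hz : (g.1 * E 0) 0 0 ≠ 0 := by rwa [h0, mul_one]
  have hdet : g.1 0 0 * g.1 1 1 - g.1 0 1 * g.1 1 0 = 1 := by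
    rw [← Matrix.det_fin_two]
    exact g.2.2
  refine ((hm 1).fun_div (hm 0) hz).congr_deriv ?_
  rw [h0, mul_one]
  congr 1
  linear_combination A 1 0 * hdet

section Velocity

variable {E H : Type*} [NormedAddCommGroup E] [NormedSpace ℝ E] [TopologicalSpace H]
  {I : ModelWithCorners ℝ E H} {M : Type*} [TopologicalSpace M] [ChartedSpace H M]

lemma chartDeriv_velocity [IsManifold I ∞ M] {m₀ m : M} {γ : ℝ → M} (h0 : γ 0 = m)
    (hγ : MDifferentiableAt 𝓘(ℝ, ℝ) I γ 0) (hm : m ∈ (extChartAt I m₀).source) {v : E}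
    (hv : HasDerivAt (fun t => extChartAt I m₀ (γ t)) v 0) :
    chartDeriv I m₀ m (mfderiv 𝓘(ℝ, ℝ) I γ 0 (1 : ℝ)) = v := by
  subst h0
  have : IsManifold I 1 M := .of_le (n := ∞) (by simp)
  have h1 : HasMFDerivAt I 𝓘(ℝ, E) (extChartAt I m₀) (γ 0) (chartDeriv I m₀ (γ 0)) :=
    (mdifferentiableAt_extChartAt (by simpa using hm)).hasMFDerivAt
  have h2 := h1.comp 0 hγ.hasMFDerivAt
  have h3 : HasMFDerivAt 𝓘(ℝ, ℝ) 𝓘(ℝ, E) (extChartAt I m₀ ∘ γ) 0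
      (ContinuousLinearMap.toSpanSingleton ℝ v) := hv.hasFDerivAt.hasMFDerivAt
  have h4 := DFunLike.congr_fun (hasMFDerivAt_unique h2 h3) (1 : ℝ)
  refine h4.trans ?_
  exact one_smul ℝ v

lemma mfderiv_velocity {m : M} {γ : ℝ → M} {f : M → M} (h0 : γ 0 = m)
    (hγ : MDifferentiableAt 𝓘(ℝ, ℝ) I γ 0) (hf : MDifferentiableAt I I f m) :
    mfderiv I I f m (mfderiv 𝓘(ℝ, ℝ) I γ 0 (1 : ℝ)) =
      mfderiv 𝓘(ℝ, ℝ) I (fun t => f (γ t)) 0 (1 : ℝ) := by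
  subst h0
  exact (DFunLike.congr_fun (mfderiv_comp (I' := I) 0 hf hγ) (1 : ℝ)).symm

end Velocity

variable {k : ℕ}

namespace HomSpace

/-- The curve in the homogeneous space with velocity `tangentOf k g A p`. -/
def curve (g : Gtau k) (A : su2) (p : Vtau k) (t : ℝ) : HomSpace k :=
  proj k (g * (Gtau.ofTrans (t • p) * Gtau.ofRot k (expSU2 (t • A))))

lemma curve_eq (g : Gtau k) (A : su2) (p : Vtau k) (t : ℝ) :
    curve g A p t = proj k ⟨g.rot * expSU2 (t • A), g.trans + t • rho k g.rot p⟩ := by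
  have h : Gtau.ofTrans (t • p) * Gtau.ofRot k (expSU2 (t • A)) = ⟨expSU2 (t • A), t • p⟩ := by
    change (⟨1 * expSU2 (t • A), t • p + rho k 1 0⟩ : Gtau k) = _
    rw [one_mul, map_zero, add_zero]
  rw [curve, h, Gtau.mul_def, map_smul]

lemma curve_zero (g : Gtau k) (A : su2) (p : Vtau k) : curve g A p 0 = proj k g := by
  rw [curve_eq, expSU2_zero_smul, mul_one, zero_smul, add_zero]

lemma contMDiff_curve (g : Gtau k) (A : su2) (p : Vtau k) :
    ContMDiff 𝓘(ℝ, ℝ) ((𝓡 2).prod (𝓡 (2 * k + 1))) ∞ (curve g A p) := by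
  have h1 : ContMDiff 𝓘(ℝ, ℝ) ((𝓡 3).prod (𝓡 (2 * k + 1))) ∞
      fun t : ℝ => (⟨g.rot * expSU2 (t • A), g.trans + t • rho k g.rot p⟩ : Gtau k) := by
    intro t
    refine Gtau.contMDiffAt_mk (SU2.contMDiff_mul contMDiff_const (contMDiff_expSU2 A)).contMDiffAt
      (ContMDiff.contMDiffAt ?_)
    have h2 : ContDiff ℝ ∞ fun t : ℝ => kappa k g.trans + t • kappa k (rho k g.rot p) :=
      contDiff_const.add (contDiff_id.smul contDiff_const)
    exact h2.contMDiff.congr fun t => by rw [map_add, map_smul]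
  exact (contMDiff_proj.comp h1).congr (curve_eq g A p)

/-- The element of `SU(2)` at which the chart at `m₀` is centred. -/
def center (m₀ : HomSpace k) : SU2 := CP1.frame (base k m₀)

lemma extChartAt_apply (m₀ m : HomSpace k) :
    extChartAt ((𝓡 2).prod (𝓡 (2 * k + 1))) m₀ m =
      (toE2 (CP1.ratio (center m₀) (base k m)), fibre k m) := rfl

lemma mem_extChartAt_source_iff {m₀ m : HomSpace k} :
    m ∈ (extChartAt ((𝓡 2).prod (𝓡 (2 * k + 1))) m₀).source ↔
      base k m ∈ CP1.affine (center m₀) := by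
  rw [extChartAt_source]
  change True ∧ (base k m ∈ CP1.affine (center m₀) ∧ True) ↔ _
  simp

lemma chartDeriv_tangentOf {m₀ : HomSpace k} {g : Gtau k}
    (hg : proj k g ∈ (extChartAt ((𝓡 2).prod (𝓡 (2 * k + 1))) m₀).source) (A : su2) (p : Vtau k) :
    chartDeriv ((𝓡 2).prod (𝓡 (2 * k + 1))) m₀ (proj k g) (tangentOf k g A p) =
      (toE2 (A.1 1 0 / ((center m₀)⁻¹ * g.rot).1 0 0 ^ 2), kappa k (rho k g.rot p)) := by
  refine chartDeriv_velocity (curve_zero g A p)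
    ((contMDiff_curve g A p).mdifferentiable (by simp) 0) hg ?_
  have ha : ((center m₀)⁻¹ * g.rot).1 0 0 ≠ 0 :=
    CP1.line_mem_affine_iff.1 (mem_extChartAt_source_iff.1 hg)
  have h1 := hasDerivAt_ratio _ A.1 ha (E := fun t : ℝ => NormedSpace.exp (t • A.1))
    (by simp only [zero_smul, NormedSpace.exp_zero]) (hasDerivAt_exp_apply A.1)
  have h2 : HasDerivAt (fun t : ℝ => kappa k g.trans + t • kappa k (rho k g.rot p))
      (kappa k (rho k g.rot p)) 0 := by
    simpa using ((hasDerivAt_id (0 : ℝ)).smul_const (kappa k (rho k g.rot p))).const_add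
      (kappa k g.trans)
  have h3 : HasDerivAt (fun t : ℝ => toE2 ((((center m₀)⁻¹ * g.rot).1 * NormedSpace.exp (t • A.1)) 1 0 /
      (((center m₀)⁻¹ * g.rot).1 * NormedSpace.exp (t • A.1)) 0 0))
      (toE2 (A.1 1 0 / ((center m₀)⁻¹ * g.rot).1 0 0 ^ 2)) 0 :=
    toE2.toContinuousLinearMap.hasFDerivAt.comp_hasDerivAt 0 h1
  have h4 : (fun t => extChartAt ((𝓡 2).prod (𝓡 (2 * k + 1))) m₀ (curve g A p t)) =
      fun t : ℝ => (toE2 ((((center m₀)⁻¹ * g.rot).1 * NormedSpace.exp (t • A.1)) 1 0 /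
        (((center m₀)⁻¹ * g.rot).1 * NormedSpace.exp (t • A.1)) 0 0),
        kappa k g.trans + t • kappa k (rho k g.rot p)) := by
    funext t
    rw [extChartAt_apply, curve_eq]
    refine Prod.ext (congrArg toE2 ?_) ?_
    · refine (CP1.ratio_line _ _).trans ?_
      rw [← mul_assoc]
      rfl
    · change kappa k (g.trans + t • rho k g.rot p) = _
      rw [map_add, map_smul]
  rw [h4]
  exact h3.prodMk h2

lemma exists_tangentOf (g : Gtau k)
    (v : TangentSpace ((𝓡 2).prod (𝓡 (2 * k + 1))) (proj k g)) :
    ∃ (A : su2) (p : Vtau k), tangentOf k g A p = v := by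
  have hs := mem_extChartAt_source (I := (𝓡 2).prod (𝓡 (2 * k + 1))) (proj k g)
  have ha : ((center (proj k g))⁻¹ * g.rot).1 0 0 ≠ 0 :=
    CP1.line_mem_affine_iff.1 (mem_extChartAt_source_iff.1 hs)
  obtain ⟨e, he⟩ := chartDeriv_isInvertible hs
  set w := chartDeriv ((𝓡 2).prod (𝓡 (2 * k + 1))) (proj k g) (proj k g) v with hw
  -- The factor is the inverse of the Möbius derivative in `chartDeriv_tangentOf`; a skew-Hermitian
  -- matrix with lower left entry x then realizes the prescribed velocity.
  set x : ℂ := toE2.symm w.1 * ((center (proj k g))⁻¹ * g.rot).1 0 0 ^ 2 with hx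
  have hA : !![0, -starRingEnd ℂ x; x, 0] ∈ su2 := by
    refine ⟨?_, ?_⟩
    · ext i j
      fin_cases i <;> fin_cases j <;> simp [Matrix.conjTranspose_apply]
    · simp [Matrix.trace_fin_two]
  refine ⟨⟨_, hA⟩, rho k g.rot⁻¹ ((kappa k).symm w.2), ?_⟩
  have h1 := chartDeriv_tangentOf hs ⟨_, hA⟩ (rho k g.rot⁻¹ ((kappa k).symm w.2))
  have h2 : (toE2 (x / ((center (proj k g))⁻¹ * g.rot).1 0 0 ^ 2),
      kappa k (rho k g.rot (rho k g.rot⁻¹ ((kappa k).symm w.2)))) = w := by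
    refine Prod.ext ?_ ?_
    · change toE2 (x / _) = w.1
      rw [hx, mul_div_cancel_right₀ _ (pow_ne_zero 2 ha), toE2.apply_symm_apply]
    · change kappa k _ = w.2
      rw [← Module.End.mul_apply, ← map_mul, mul_inv_cancel, map_one, Module.End.one_apply,
        (kappa k).apply_symm_apply]
  have he' : ∀ u, e u = chartDeriv ((𝓡 2).prod (𝓡 (2 * k + 1))) (proj k g) (proj k g) u :=
    fun u => by rw [← he]; rfl
  exact e.injective ((he' _).trans ((h1.trans h2).trans (he' v).symm))

end HomSpace

/-! ### The invariant CR structure -/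

/-- The linear isomorphism underlying the coframe of the affine chart centred at `h · [e₁]`. -/
def coframeMap (k : ℕ) (h : SU2) :
    EuclideanSpace ℝ (Fin 2) × VModel k →L[ℝ] ModelFibre k :=
  LinearMap.toContinuousLinearMap
    -- Forms are rotated by h because the affine coordinate is centred at h·[e₁]. Afterwards,
    -- vanishing at the base point is vanishing at t = ζ.
    { toFun := fun v => (toE2.symm v.1, starRingEnd ℂ (toE2.symm v.1), subst h.1 (modelCoef k v.2))
      map_add' := fun v w => by simp
      map_smul' := fun r v => by simp [← Complex.coe_smul] }

lemma coframeMap_apply (h : SU2) (v : EuclideanSpace ℝ (Fin 2) × VModel k) : coframeMap k h v =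
    (toE2.symm v.1, starRingEnd ℂ (toE2.symm v.1), subst h.1 (modelCoef k v.2)) := rfl

lemma subst_inv_cancel (h : SU2) (c : Coef k) : subst h.1 (subst (h⁻¹ : SU2).1 c) = c := by
  rw [subst_subst]
  change subst (h⁻¹ * h : SU2).1 c = c
  rw [inv_mul_cancel]
  exact subst_one c

lemma subst_cancel_inv (h : SU2) (c : Coef k) : subst (h⁻¹ : SU2).1 (subst h.1 c) = c := by
  have := subst_inv_cancel h⁻¹ c
  rwa [inv_inv] at this

/-- The coframe of the affine chart centred at `h · [e₁]`. -/
def coframe (k : ℕ) (h : SU2) : ModelCoframe k (EuclideanSpace ℝ (Fin 2) × VModel k) where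
  map := coframeMap k h
  bijective := by
    constructor
    · rintro ⟨⟨a, u⟩, ⟨b, v⟩⟩ ⟨⟨a', u'⟩, ⟨b', v'⟩⟩ hab
      simp only [coframeMap_apply, Prod.smul_mk, Prod.mk_add_mk, Prod.mk.injEq] at hab
      obtain ⟨h1, h2, h3⟩ := hab
      have h4 := congrArg (starRingEnd ℂ) h2
      simp only [smul_eq_mul, map_add, map_mul, Complex.conj_conj, Complex.conj_I] at h1 h4
      have ha : toE2.symm a = toE2.symm a' := by linear_combination (h1 + h4) / 2
      have hb : toE2.symm b = toE2.symm b' := by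
        refine mul_left_cancel₀ Complex.I_ne_zero ?_
        linear_combination (h1 - h4) / 2
      rw [← map_smul (subst h.1), ← map_add (subst h.1), ← map_smul (subst h.1),
        ← map_add (subst h.1)] at h3
      have h5 := congrArg (subst (h⁻¹ : SU2).1) h3
      rw [subst_cancel_inv, subst_cancel_inv] at h5
      obtain ⟨hu, hv⟩ := coef_add_I_smul_injective h5
      rw [toE2.symm.injective ha, toE2.symm.injective hb, (kappa k).symm.injective hu,
        (kappa k).symm.injective hv]
    · rintro ⟨x, y, c⟩
      obtain ⟨p, q, hpq⟩ := exists_real_imag (subst (h⁻¹ : SU2).1 c)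
      refine ⟨⟨(toE2 ((x + starRingEnd ℂ y) / 2), kappa k p),
        (toE2 (-Complex.I * (x - starRingEnd ℂ y) / 2), kappa k q)⟩, ?_⟩
      simp only [coframeMap_apply, Prod.smul_mk, Prod.mk_add_mk, Prod.mk.injEq,
        toE2.symm_apply_apply, smul_eq_mul, modelCoef_kappa]
      refine ⟨?_, ?_, ?_⟩
      · linear_combination -(x - starRingEnd ℂ y) / 2 * Complex.I_sq
      · simp only [map_div₀, map_mul, map_neg, map_add, map_sub, Complex.conj_conj, Complex.conj_I,
          Complex.conj_ofNat]
        linear_combination (starRingEnd ℂ x - y) / 2 * Complex.I_sq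
      · rw [← map_smul, ← map_add, hpq, subst_inv_cancel]
  conj_map v := by
    rw [conjFibre_apply, coframeMap_apply]
    simp only [Complex.conj_conj]
    rw [tau_subst, modelCoef_apply, tau_coef]

namespace HomSpace

/-- The bridge between algebra and model. The matrix h⁻¹ g sends [e₁] to ζ, so undoing it turns
vanishing to order k + 1 at ζ into membership in V⁺. The condition dz = 0 becomes that of being
upper triangular. -/
lemma mem_modelKernel_iff {m₀ : HomSpace k} {g : Gtau k}
    (hg : proj k g ∈ (extChartAt ((𝓡 2).prod (𝓡 (2 * k + 1))) m₀).source) (A B : su2)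
    (p q : Vtau k) :
    (coframe k (center m₀)).coord m₀ (proj k g)
        ((1 : ℂ) ⊗ₜ[ℝ] tangentOf k g A p + Complex.I ⊗ₜ[ℝ] tangentOf k g B q) ∈
      modelKernel k 0 ((coframe k (center m₀)).map
        (extChartAt ((𝓡 2).prod (𝓡 (2 * k + 1))) m₀ (proj k g))).1 ↔
    ((A : Matrix (Fin 2) (Fin 2) ℂ) + Complex.I • (B : Matrix (Fin 2) (Fin 2) ℂ),
        (p : Fun2) + Complex.I • (q : Fun2)) ∈ crAlgebra k := by
  have ha : ((center m₀)⁻¹ * g.rot).1 0 0 ≠ 0 :=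
    CP1.line_mem_affine_iff.1 (mem_extChartAt_source_iff.1 hg)
  set h := center m₀ with hh
  set ζ := CP1.ratio h g.rot.line with hζdef
  have hζ : (h⁻¹ * g.rot).1 1 0 = ζ * (h⁻¹ * g.rot).1 0 0 := by
    rw [hζdef, CP1.ratio_line, div_mul_cancel₀ _ ha]
  have hc : ∀ v : Vtau k, subst h.1 (modelCoef k (kappa k (rho k g.rot v))) =
      subst ((h⁻¹ * g.rot)⁻¹ : SU2).1 (coef k v) := fun v => by
    rw [modelCoef_kappa, coef_rho, subst_subst, mul_inv_rev, inv_inv]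
    rfl
  have hpt : ((coframe k h).map
      (extChartAt ((𝓡 2).prod (𝓡 (2 * k + 1))) m₀ (proj k g))).1 = ζ :=
    toE2.symm_apply_apply _
  rw [ModelCoframe.coord_add_tmul, chartDeriv_tangentOf hg, chartDeriv_tangentOf hg, hpt]
  change coframeMap k h (toE2 (A.1 1 0 / (h⁻¹ * g.rot).1 0 0 ^ 2), kappa k (rho k g.rot p)) +
    Complex.I • coframeMap k h (toE2 (B.1 1 0 / (h⁻¹ * g.rot).1 0 0 ^ 2),
      kappa k (rho k g.rot q)) ∈ _ ↔ _
  rw [coframeMap_apply, coframeMap_apply, mem_modelKernel]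
  simp only [Prod.smul_mk, Prod.mk_add_mk, toE2.symm_apply_apply, hc, ← map_smul, ← map_add]
  rw [← subst_low_iff (h⁻¹ * g.rot).2.2 hζ, subst_inv_cancel, ← form_mem_Vplus_iff, map_add,
    map_smul, form_coef, form_coef]
  have htr : (A.1 + Complex.I • B.1).trace = 0 := by
    rw [Matrix.trace_add, Matrix.trace_smul, A.2.2, B.2.2, smul_zero, add_zero]
  have hA : A.1 1 0 / (h⁻¹ * g.rot).1 0 0 ^ 2 +
      Complex.I • (B.1 1 0 / (h⁻¹ * g.rot).1 0 0 ^ 2) = 0 ↔ (A.1 + Complex.I • B.1) 1 0 = 0 := by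
    rw [smul_eq_mul, ← mul_div_assoc, ← add_div, div_eq_zero_iff,
      or_iff_left (pow_ne_zero 2 ha)]
    rfl
  constructor
  · rintro ⟨h1, -, h2⟩
    exact ⟨⟨htr, hA.1 h1⟩, h2⟩
  · rintro ⟨⟨-, h1⟩, h2⟩
    exact ⟨hA.2 h1, fun h => absurd h (by omega), h2⟩

/-- The invariant CR structure of the homogeneous space. -/
def distribution (k : ℕ) (m : HomSpace k) :
    Submodule ℂ (CTangent ((𝓡 2).prod (𝓡 (2 * k + 1))) m) :=
  (modelKernel k 0 ((coframe k (center m)).map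
    (extChartAt ((𝓡 2).prod (𝓡 (2 * k + 1))) m m)).1).comap
    ((coframe k (center m)).coord m m)

lemma isInducedBy_distribution : IsInducedBy k (distribution k) := by
  intro g
  have hs := mem_extChartAt_source (I := (𝓡 2).prod (𝓡 (2 * k + 1))) (proj k g)
  ext w
  constructor
  · intro hw
    obtain ⟨a, b, rfl⟩ := exists_eq_tmul w
    obtain ⟨A, p, rfl⟩ := exists_tangentOf g a
    obtain ⟨B, q, rfl⟩ := exists_tangentOf g b
    exact ⟨A, B, p, q, (mem_modelKernel_iff hs A B p q).1 hw, rfl⟩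
  · rintro ⟨A, B, p, q, h, rfl⟩
    exact (mem_modelKernel_iff hs A B p q).2 h

lemma mem_distribution_iff (g : Gtau k) (A B : su2) (p q : Vtau k) :
    (1 : ℂ) ⊗ₜ[ℝ] tangentOf k g A p + Complex.I ⊗ₜ[ℝ] tangentOf k g B q ∈
      distribution k (proj k g) ↔
    ((A : Matrix (Fin 2) (Fin 2) ℂ) + Complex.I • (B : Matrix (Fin 2) (Fin 2) ℂ),
        (p : Fun2) + Complex.I • (q : Fun2)) ∈ crAlgebra k :=
  mem_modelKernel_iff (mem_extChartAt_source (I := (𝓡 2).prod (𝓡 (2 * k + 1))) (proj k g)) A B p q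

/-- The distribution was defined with the chart centred at each point. In any other chart the model
condition is again equivalent to membership in 𝔣, so the two agree. -/
lemma isModelled_distribution : IsModelled k (distribution k) := by
  intro m₀
  refine ⟨coframe k (center m₀), fun m hm w => ?_⟩
  induction m using QuotientGroup.induction_on with
  | H g =>
    obtain ⟨a, b, rfl⟩ := exists_eq_tmul w
    obtain ⟨A, p, rfl⟩ := exists_tangentOf g a
    obtain ⟨B, q, rfl⟩ := exists_tangentOf g b
    exact (mem_distribution_iff g A B p q).trans (mem_modelKernel_iff hm A B p q).symm

lemma contMDiff_smul (g : Gtau k) : ContMDiff ((𝓡 2).prod (𝓡 (2 * k + 1)))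
    ((𝓡 2).prod (𝓡 (2 * k + 1))) ∞ fun m : HomSpace k => g • m := by
  intro m
  induction m using QuotientGroup.induction_on with
  | H x =>
    obtain ⟨s, hs, -, hsec⟩ := exists_section x
    have h1 : ContMDiff ((𝓡 3).prod (𝓡 (2 * k + 1))) ((𝓡 2).prod (𝓡 (2 * k + 1))) ∞
        fun y : Gtau k => proj k (g * y) :=
      contMDiff_proj.comp (contMDiff_mul_left (I := (𝓡 3).prod (𝓡 (2 * k + 1))))
    have h2 := h1.contMDiffAt.comp _ hs
    refine h2.congr_of_eventuallyEq ?_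
    filter_upwards [hsec] with m hm
    exact congrArg (g • ·) hm.symm

lemma mfderiv_smul_tangentOf (g x : Gtau k) (A : su2) (p : Vtau k) :
    mfderiv ((𝓡 2).prod (𝓡 (2 * k + 1))) ((𝓡 2).prod (𝓡 (2 * k + 1)))
      (fun m : HomSpace k => g • m) (proj k x) (tangentOf k x A p) = tangentOf k (g * x) A p := by
  have h1 := mfderiv_velocity (curve_zero x A p)
    ((contMDiff_curve x A p).mdifferentiable (by simp) 0)
    ((contMDiff_smul g).mdifferentiable (by simp) (proj k x))
  have h2 : (fun t => g • curve x A p t) = curve (g * x) A p := by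
    funext t
    rw [curve, curve, mul_assoc]
    rfl
  rw [h2] at h1
  exact h1

/-- Left translation carries the velocity of (A, p) at x to that of the same (A, p) at g x, and
membership in 𝔣 does not mention the base point. -/
lemma isInvariant_distribution :
    IsInvariant ((𝓡 2).prod (𝓡 (2 * k + 1))) (Gtau k) (distribution k) := by
  intro g
  refine ⟨contMDiff_smul g, fun m => ?_⟩
  induction m using QuotientGroup.induction_on with
  | H x =>
    have hb : ∀ (A B : su2) (p q : Vtau k),
        LinearMap.baseChange ℂ (mfderiv ((𝓡 2).prod (𝓡 (2 * k + 1))) ((𝓡 2).prod (𝓡 (2 * k + 1)))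
          (fun m : HomSpace k => g • m) (proj k x)).toLinearMap
          ((1 : ℂ) ⊗ₜ[ℝ] tangentOf k x A p + Complex.I ⊗ₜ[ℝ] tangentOf k x B q) =
        (1 : ℂ) ⊗ₜ[ℝ] tangentOf k (g * x) A p + Complex.I ⊗ₜ[ℝ] tangentOf k (g * x) B q := by
      intro A B p q
      rw [map_add]
      exact congrArg₂ (· + ·) (congrArg ((1 : ℂ) ⊗ₜ[ℝ] ·) (mfderiv_smul_tangentOf g x A p))
        (congrArg (Complex.I ⊗ₜ[ℝ] ·) (mfderiv_smul_tangentOf g x B q))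
    refine le_antisymm ?_ fun w hw => ?_
    · rintro _ ⟨w, hw, rfl⟩
      obtain ⟨a, b, rfl⟩ := exists_eq_tmul w
      obtain ⟨A, p, rfl⟩ := exists_tangentOf x a
      obtain ⟨B, q, rfl⟩ := exists_tangentOf x b
      exact (congrArg (· ∈ distribution k (proj k (g * x))) (hb A B p q)).mpr
        ((mem_distribution_iff (g * x) A B p q).2 ((mem_distribution_iff x A B p q).1 hw))
    · obtain ⟨a, b, rfl⟩ := exists_eq_tmul w
      obtain ⟨A, p, rfl⟩ := exists_tangentOf (g * x) a
      obtain ⟨B, q, rfl⟩ := exists_tangentOf (g * x) b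
      exact ⟨_, (mem_distribution_iff x A B p q).2
        ((mem_distribution_iff (g * x) A B p q).1 hw), hb A B p q⟩

end HomSpace

end CRGeom

end

theorem mainTheorem2 (k : ℕ) (hk : 1 ≤ k) :
    Module.finrank ℝ (CRGeom.Vtau k) = 2 * k + 1 ∧
    (∀ W : Submodule ℝ (CRGeom.Vtau k),
      (∀ (g : CRGeom.SU2), ∀ v ∈ W, CRGeom.rho k g v ∈ W) → W = ⊥ ∨ W = ⊤) ∧
    T2Space (CRGeom.HomSpace k) ∧ SecondCountableTopology (CRGeom.HomSpace k) ∧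
    ∃ (_ : ChartedSpace (ModelProd (EuclideanSpace ℝ (Fin 3))
          (EuclideanSpace ℝ (Fin (2 * k + 1)))) (CRGeom.Gtau k))
      (_ : ChartedSpace (CRGeom.ModelM k) (CRGeom.HomSpace k))
      (_ : ChartedSpace (EuclideanSpace ℝ (Fin 2)) CRGeom.CP1)
      (_ : LieGroup ((𝓡 3).prod (𝓡 (2 * k + 1))) ∞ (CRGeom.Gtau k))
      (_ : IsManifold ((𝓡 2).prod (𝓡 (2 * k + 1))) ∞ (CRGeom.HomSpace k))
      (_ : IsManifold (𝓡 2) ∞ CRGeom.CP1),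
      -- the smooth structures of the quotient and of the projective line are the usual ones
      CRGeom.IsSmoothSubmersion ((𝓡 3).prod (𝓡 (2 * k + 1))) ((𝓡 2).prod (𝓡 (2 * k + 1)))
        (CRGeom.HomSpace.proj k) ∧
      CRGeom.IsSmoothSubmersion ((𝓡 3).prod (𝓡 (2 * k + 1))) (𝓡 2)
        (fun g : CRGeom.Gtau k => g.rot.line) ∧
      -- the quotient is the associated bundle
      (∃ Φ : CRGeom.AssocBundle k ≃ₜ CRGeom.HomSpace k,
        (∀ (g : CRGeom.SU2) (v : CRGeom.Vtau k), Φ (Quot.mk _ (g, v)) =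
          CRGeom.HomSpace.proj k (CRGeom.Gtau.ofRot k g * CRGeom.Gtau.ofTrans v)) ∧
        CRGeom.IsSmoothSubmersion ((𝓡 3).prod (𝓡 (2 * k + 1))) ((𝓡 2).prod (𝓡 (2 * k + 1)))
          (fun x : CRGeom.Gtau k => Φ (Quot.mk _ (x.rot, x.trans)))) ∧
      -- the fibration over the projective line with Euclidean fibre
      (∃ p : CRGeom.HomSpace k → CRGeom.CP1,
        (∀ g : CRGeom.Gtau k, p (CRGeom.HomSpace.proj k g) = g.rot.line) ∧
        CRGeom.IsSmoothFibreBundle ((𝓡 2).prod (𝓡 (2 * k + 1))) (𝓡 2)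
          (EuclideanSpace ℝ (Fin (2 * k + 1))) p) ∧
      -- the invariant CR structure
      ∃ D : ∀ m : CRGeom.HomSpace k,
          Submodule ℂ (CRGeom.CTangent ((𝓡 2).prod (𝓡 (2 * k + 1))) m),
        CRGeom.IsInducedBy k D ∧
        CRGeom.IsInvariant ((𝓡 2).prod (𝓡 (2 * k + 1))) (CRGeom.Gtau k) D ∧
        CRGeom.IsCRStructure D (k + 1) 1 ∧
        ∀ m : CRGeom.HomSpace k, CRGeom.IsNondegenerateAt D k m :=
  ⟨CRGeom.finrank_Vtau k, CRGeom.rho_irreducible, inferInstance, inferInstance,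
    inferInstance, inferInstance, inferInstance, inferInstance, inferInstance, inferInstance,
    CRGeom.HomSpace.isSmoothSubmersion_proj, CRGeom.HomSpace.isSmoothSubmersion_line,
    ⟨CRGeom.HomSpace.assoc k, CRGeom.HomSpace.assoc_mk,
      CRGeom.HomSpace.isSmoothSubmersion_assoc⟩,
    ⟨CRGeom.HomSpace.base k, fun _ => rfl, CRGeom.HomSpace.isSmoothFibreBundle_base⟩,
    CRGeom.HomSpace.distribution k, CRGeom.HomSpace.isInducedBy_distribution,
    CRGeom.HomSpace.isInvariant_distribution,
    CRGeom.isCRStructure_of_isModelled CRGeom.HomSpace.isModelled_distribution,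
    CRGeom.isNondegenerateAt_of_isModelled hk CRGeom.HomSpace.isModelled_distribution⟩
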